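/- Let $I=[0,1]$ and give $I^2$ the Euclidean metric $d$. A real $x$ is computable if some algorithm produces, on input $n$, a rational $q_n$ with $|q_n-x|\le 2^{-n}$; a sequence $(x_k)$ of reals is computable if some algorithm produces, on input $(k,n)$, a rational $q_{k,n}$ with $|q_{k,n}-x_k|\le 2^{-n}$. Points and sequences of points of $I^2$ are computable if they are so in each coordinate. A map $g:I^2\to I^2$ is computable (in the sense of the Polish school, Pour-El and Richards) if it maps every computable sequence of points to a computable sequence of points and there is a computable $m:\mathbb N\to\mathbb N$ with $d(g(x),g(y))\le 2^{-n}$ whenever $d(x,y)\le 2^{-m(n)}$. For $W\subseteq I^2$ and $\varepsilon\ge 0$, let $W^{\blacksquare\varepsilon}$ (respectively $W^{\square\varepsilon}$) be the set of $x\in W$ with $d(x,\delta W\setminus\delta I^2)\ge\varepsilon$ (respectively $=\varepsilon$), where $\delta$ denotes the boundary. Interiors ${}^\circ$ are taken in $I^2$. **Theorem (Baigger's example).** There are computable sequences $(a_n)_{n\ge0}$, $(b_n)_{n\ge0}$ of rationals with $0\le a_n<b_n\le 1$ such that the intervals $J_n=[a_n,b_n]$ satisfy (i) $J_n\cap J_m$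 has at most one point for $n\ne m$; (ii) if $a_n\ne 0$ then $a_n\in\{b_0,b_1,\dots\}$, and if $b_n\neq 1$ then $b_n\in\{a_0,a_1,\dots\}$; (iii) $\{x\in I : x \text{ computable}\}\subsetneq\bigcup_n J_n\subsetneq I$; and, putting $C_n=\bigcup_{k,\ell\le n}J_k\times J_\ell$, $v_n=\inf\{x\in I : (x,x)\notin C_n\}$, $t_n=(v_n,v_n)$ and $D_n=\bigl(C_n^{\blacksquare 2^{-n}}\setminus C_n^{\blacksquare\frac54 2^{-n}}\bigr)^\circ$, there are maps $f_n:I^2\to I^2$ $(n\ge0)$ and $f:I^2\to I^2$ such that: 1. each $f_n$ is computable, moves every point of $\bigl(C_n^{\blacksquare 2^{-n}}\bigr)^\circ$, and is the identity outside $C_n^{\blacksquare 2^{-n}}$; 2. for each $n$ there is a constant $c_n>0$ such that $f_n$ moves every $x\in D_n$ in the direction of $t_n$ by the amount $c_n\, d\bigl(x,C_n^{\square 2^{-n}}\bigr)$; 3. $f_{n+1}=f_n$ on $C_n^{\blacksquare\frac32 2^{-n}}$, and $f_n\to f$ uniformly on $I^2$; 4. $f$ is computable, in particular it has a computable uniform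 modulus of continuity, and $f(x)\ne x$ for every computable point $x\in I^2$; 5. the set of fixed points of $f$ is exactly $I^2\setminus\bigcup_n C_n$; with every fixed point, $f$ fixes all points of the vertical segment $\{x\}\times I$ or all points of the horizontal segment $I\times\{y\}$ through it, and $f$ has no isolated fixed point; 6. the sequence $(v_n)$ converges to some $v\in I$, the real $v$ is not computable, and $(v,v)$ is a fixed point of $f$. -/

import Mathlib

open Set Filter Topology

/-! ### Computable rationals, reals, points and functions -/

/-- A computable family of rationals, indexed by a type with a computable coding:
`q i = (-1) ^ (s i) * b i / c i` with computable `s, b, c` and `c i ≠ 0`. -/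
def ComputableRat {α : Type} [Primcodable α] (q : α → ℚ) : Prop :=
  ∃ s b c : α → ℕ, Computable s ∧ Computable b ∧ Computable c ∧
    ∀ i, c i ≠ 0 ∧ q i = (-1) ^ (s i) * (b i : ℚ) / (c i : ℚ)

/-- A computable real: an algorithm produces, on input `n`, a rational approximation with error
at most `2⁻ⁿ`. -/
def ComputableReal (x : ℝ) : Prop :=
  ∃ q : ℕ → ℚ, ComputableRat q ∧ ∀ n, |(q n : ℝ) - x| ≤ (1 / 2 : ℝ) ^ n

/-- A computable sequence of reals: one algorithm produces, on input `(k, n)`, a rational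
approximation of `x k` with error at most `2⁻ⁿ`. -/
def ComputableRealSeq (x : ℕ → ℝ) : Prop :=
  ∃ q : ℕ × ℕ → ℚ, ComputableRat q ∧ ∀ k n, |(q (k, n) : ℝ) - x k| ≤ (1 / 2 : ℝ) ^ n

/-- The Euclidean plane. -/
abbrev Plane : Type := EuclideanSpace ℝ (Fin 2)

/-- The unit square `I²` as a subset of the plane. -/
def unitSquare : Set Plane := {p | ∀ i, p i ∈ Icc (0 : ℝ) 1}

/-- The unit square `I²` as a space of its own, with the Euclidean metric and the subspace
topology. -/
abbrev Square : Type := unitSquare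

/-- A computable point of `I²`: all its coordinates are computable reals. -/
def ComputablePoint (p : Square) : Prop := ∀ i, ComputableReal (p.1 i)

/-- A computable sequence of points of `I²`: all its coordinate sequences are computable. -/
def ComputablePointSeq (p : ℕ → Square) : Prop := ∀ i, ComputableRealSeq fun k => (p k).1 i

/-- Computability of a map `I² → I²` in the sense of the Polish school (Pour-El and Richards):
computable sequences are mapped to computable sequences, and there is a computable uniform
modulus of continuity. -/
structure PolishComputable (f : Square → Square) : Prop where
  map_seq : ∀ p : ℕ → Square, ComputablePointSeq p → ComputablePointSeq fun k => f (p k)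
  modulus : ∃ d : ℕ → ℕ, Computable d ∧
    ∀ n (p q : Square), dist p q ≤ (1 / 2 : ℝ) ^ d n → dist (f p) (f q) ≤ (1 / 2 : ℝ) ^ n

/-! ### The intervals `J_n`, the sets `C_n` and the target points `t_n` -/

/-- The interval `J_n = [a_n, b_n]`. -/
def J (a b : ℕ → ℚ) (n : ℕ) : Set ℝ := Icc (a n : ℝ) (b n : ℝ)

/-- The sequence of rational intervals `J_n = [a_n, b_n]` is computable, the intervals do not
overlap, each endpoint in the open unit interval is shared with a neighbouring interval, and the
intervals cover all computable reals of the unit interval `I`, but not all of `I`. -/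
structure IsIntervalSystem (a b : ℕ → ℚ) : Prop where
  computable_left : ComputableRat a
  computable_right : ComputableRat b
  left_nonneg : ∀ n, 0 ≤ a n
  left_lt_right : ∀ n, a n < b n
  right_le_one : ∀ n, b n ≤ 1
  inter : ∀ n m, n ≠ m → (J a b n ∩ J a b m).encard ≤ 1
  left_mem : ∀ n, a n ≠ 0 → a n ∈ range b
  right_mem : ∀ n, b n ≠ 1 → b n ∈ range a
  covers : {x : ℝ | x ∈ Icc (0 : ℝ) 1 ∧ ComputableReal x} ⊂ ⋃ n, J a b n
  not_all : (⋃ n, J a b n) ⊂ Icc (0 : ℝ) 1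

/-- `C_n`, the union of the rectangles `J_k × J_l` with `k, l ≤ n`. -/
def C (a b : ℕ → ℚ) (n : ℕ) : Set Square :=
  {p | ∃ k ≤ n, ∃ l ≤ n, p.1 0 ∈ J a b k ∧ p.1 1 ∈ J a b l}

/-- The point `(x, x)` of the diagonal of `I²`. -/
noncomputable def diag (x : Icc (0 : ℝ) 1) : Square :=
  ⟨!₂[(x : ℝ), (x : ℝ)], fun i => by fin_cases i <;> exact x.2⟩

/-- `v_n`, the infimum of the `x ∈ I` with `(x, x) ∉ C_n`. -/
noncomputable def targetCoord (a b : ℕ → ℚ) (n : ℕ) : ℝ :=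
  sInf {x : ℝ | ∃ h : x ∈ Icc (0 : ℝ) 1, diag ⟨x, h⟩ ∉ C a b n}

/-- The target point `t_n = (v_n, v_n)`. -/
noncomputable def target (a b : ℕ → ℚ) (n : ℕ) : Plane :=
  !₂[targetCoord a b n, targetCoord a b n]

/-- `δW \ δI²`. Away from `δI²` it does not matter whether the boundary of `W` is taken in `I²` or
in the plane. -/
def innerBoundary (W : Set Square) : Set Square :=
  {p | p ∈ frontier W ∧ (p : Plane) ∉ frontier unitSquare}

/-- `W^{■ε}`, the points of `W` at distance at least `ε` from `δW \ δI²`. -/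
def core (W : Set Square) (ε : ℝ) : Set Square :=
  {p | p ∈ W ∧ ε ≤ Metric.infDist p (innerBoundary W)}

/-- `W^{□ε}`, the points of `W` at distance exactly `ε` from `δW \ δI²`. -/
def coreEdge (W : Set Square) (ε : ℝ) : Set Square :=
  {p | p ∈ W ∧ Metric.infDist p (innerBoundary W) = ε}

/-- `D_n`, the interior (in `I²`) of `C_n^{■2⁻ⁿ} \ C_n^{■(5/4)2⁻ⁿ}`. -/
def collar (a b : ℕ → ℚ) (n : ℕ) : Set Square :=
  interior (core (C a b n) ((1 / 2) ^ n) \ core (C a b n) (5 / 4 * (1 / 2) ^ n))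

/-- The stage maps `F n : I² → I²`. Each is computable, moves every point of the interior (in `I²`)
of `C_n^{■2⁻ⁿ}`, is the identity outside `C_n^{■2⁻ⁿ}`, and moves the points of `D_n` towards `t_n`
by an amount proportional to their distance from `C_n^{□2⁻ⁿ}`; and `F (n + 1)` agrees with `F n` on
`C_n^{■(3/2)2⁻ⁿ}`. -/
structure IsStageSequence (a b : ℕ → ℚ) (F : ℕ → Square → Square) : Prop where
  computable : ∀ n, PolishComputable (F n)
  moves : ∀ n, ∀ p ∈ interior (core (C a b n) ((1 / 2) ^ n)), F n p ≠ p
  identity : ∀ n, ∀ p ∉ core (C a b n) ((1 / 2) ^ n), F n p = p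
  push : ∀ n, ∃ c : ℝ, 0 < c ∧ ∀ p ∈ collar a b n,
    (F n p : Plane) - p =
      (c * Metric.infDist p (coreEdge (C a b n) ((1 / 2) ^ n))) •
        (‖target a b n - p‖⁻¹ • (target a b n - p))
  agree : ∀ n, ∀ p ∈ core (C a b n) (3 / 2 * (1 / 2) ^ n), F (n + 1) p = F n p

/-! ### Computable families of rationals -/

section ComputableRat

variable {α β : Type} [Primcodable α] [Primcodable β]

/-! The intervals come from a decidable binary tree without computable branches. A branch `p` dies
once some program number `e` is seen to output `p e` on input `e`. A computable branch dies through
its own program (`exists_dead`); a diagonal branch never dies (`exists_forall_not_dead`). In the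
Cantor scheme, a live node contributes the middle third of its Cantor interval, and a first dead
node contributes its whole Cantor interval. A computable real outside all these intervals would
compute the branch it follows, so there is none (`ComputableReal.mem_iUnion_J`), while the point of
the diagonal branch stays uncovered (`exists_not_mem_iUnion_J`). Inner endpoints match because
eventually constant branches are computable, hence die.

On `C_n` the distance to the inner boundary is the smaller of the two one-dimensional depths of the
coordinates (`infDist_innerBoundary`). All conditions on the stage maps thus become conditions on
the scaled depth `s_n`, which is `2 ^ n` times this minimum: the core is `1 ≤ s_n`, the collar lies
in `1 < s_n < 5/4`, and the `n`-th map must be final where `3/2 ≤ s_n`. Since `2 * s_n ≤ s_(n+1)`,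
the transition zones of different stages do not interfere.

The `n`-th map pulls `p` a fraction `push` of the way to `aim`. The aim passes from `t_m` to
`t_(m+1)` while `s_m` falls from `12/8` to `10/8`, changing one coordinate at a time. Hence one of
its coordinates is always some `v_k` with `k` so large that `p`, having positive depth, cannot share
it; so the aim is never `p` (`exists_aim_ne`). The push is positive exactly where `1 < s_n`.

Stages `n` and `n + 1` differ only where `s_n < 3/2`, and there both displacements are of order
`2⁻ⁿ`, so the limit exists uniformly. The limit moves precisely the points of the union of the
`C_n`; its fixed points form the union of the full lines through uncovered coordinates. At rational
points everything except the distance to a target is rational and computable, that distance is an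
approximable square root, and explicit Lipschitz bounds extend the computation to all computable
sequences (`polishComputable_of_dist_stage_le`). Finally `v_n` increases to a limit of depth zero in
every stage, which is therefore uncovered and not computable. -/

theorem Computable.nat_add' {f g : α → ℕ} (hf : Computable f) (hg : Computable g) :
    Computable fun a => f a + g a :=
  Primrec.nat_add.to_comp.comp hf hg

theorem Computable.nat_mul' {f g : α → ℕ} (hf : Computable f) (hg : Computable g) :
    Computable fun a => f a * g a :=
  Primrec.nat_mul.to_comp.comp hf hg

theorem Computable.nat_sub' {f g : α → ℕ} (hf : Computable f) (hg : Computable g) :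
    Computable fun a => f a - g a :=
  Primrec.nat_sub.to_comp.comp hf hg

theorem Computable.nat_div' {f g : α → ℕ} (hf : Computable f) (hg : Computable g) :
    Computable fun a => f a / g a :=
  Primrec.nat_div.to_comp.comp hf hg

theorem Computable.nat_mod' {f g : α → ℕ} (hf : Computable f) (hg : Computable g) :
    Computable fun a => f a % g a :=
  Primrec.nat_mod.to_comp.comp hf hg

theorem Computable.nat_pow' {f g : α → ℕ} (hf : Computable f) (hg : Computable g) :
    Computable fun a => f a ^ g a :=
  (Computable.nat_rec hg (Computable.const 1)
    ((Computable.snd.comp Computable.snd).nat_mul' (hf.comp Computable.fst)).to₂).of_eq fun a => by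
      induction g a with
      | zero => rfl
      | succ k ih => simp_all [pow_succ]

theorem Computable.decide_nat_le {f g : α → ℕ} (hf : Computable f) (hg : Computable g) :
    Computable fun a => decide (f a ≤ g a) :=
  (PrimrecRel.decide Primrec.nat_le).to_comp.comp hf hg

theorem Computable.decide_nat_lt {f g : α → ℕ} (hf : Computable f) (hg : Computable g) :
    Computable fun a => decide (f a < g a) :=
  (PrimrecRel.decide Primrec.nat_lt).to_comp.comp hf hg

theorem Computable.decide_nat_eq {f g : α → ℕ} (hf : Computable f) (hg : Computable g) :
    Computable fun a => decide (f a = g a) :=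
  (PrimrecRel.decide Primrec.eq).to_comp.comp hf hg

theorem Computable.ite_bool {σ : Type} [Primcodable σ] {c : α → Bool} {f g : α → σ}
    (hc : Computable c) (hf : Computable f) (hg : Computable g) :
    Computable fun a => if c a = true then f a else g a :=
  (Computable.cond hc hf hg).of_eq fun a => by cases c a <;> rfl

theorem Computable.bool_and {f g : α → Bool} (hf : Computable f) (hg : Computable g) :
    Computable fun a => f a && g a :=
  Primrec.and.to_comp.comp hf hg

theorem Computable.bool_or {f g : α → Bool} (hf : Computable f) (hg : Computable g) :
    Computable fun a => f a || g a :=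
  Primrec.or.to_comp.comp hf hg

theorem Computable.bool_not {f : α → Bool} (hf : Computable f) : Computable fun a => !(f a) :=
  Primrec.not.to_comp.comp hf

theorem ComputableRat.of_sub {q : α → ℚ} {p m c : α → ℕ} (hp : Computable p) (hm : Computable m)
    (hc : Computable c) (h0 : ∀ a, c a ≠ 0) (hq : ∀ a, q a = ((p a : ℚ) - m a) / c a) :
    ComputableRat q := by
  refine ⟨fun a => if decide (m a ≤ p a) = true then 0 else 1,
    fun a => (p a - m a) + (m a - p a), c,
    (hm.decide_nat_le hp).ite_bool (Computable.const 0) (Computable.const 1),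
    (hp.nat_sub' hm).nat_add' (hm.nat_sub' hp), hc, fun a => ⟨h0 a, ?_⟩⟩
  rw [hq]
  rcases le_total (m a) (p a) with h | h
  · simp [h, Nat.sub_eq_zero_of_le h]
  · rcases h.eq_or_lt with h' | h'
    · simp [h']
    · simp [h'.not_ge, Nat.sub_eq_zero_of_le h, Nat.cast_sub h]

theorem ComputableRat.exists_sub {q : α → ℚ} (h : ComputableRat q) :
    ∃ p m c : α → ℕ, Computable p ∧ Computable m ∧ Computable c ∧
      ∀ a, c a ≠ 0 ∧ q a = ((p a : ℚ) - m a) / c a := by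
  obtain ⟨s, b, c, hs, hb, hc, h⟩ := h
  have he : Computable fun a => decide (s a % 2 = 0) :=
    (hs.nat_mod' (Computable.const 2)).decide_nat_eq (Computable.const 0)
  refine ⟨fun a => if decide (s a % 2 = 0) = true then b a else 0,
    fun a => if decide (s a % 2 = 0) = true then 0 else b a, c,
    he.ite_bool hb (Computable.const 0), he.ite_bool (Computable.const 0) hb, hc,
    fun a => ⟨(h a).1, ?_⟩⟩
  rw [(h a).2]
  rcases Nat.even_or_odd (s a) with h' | h'
  · simp [h'.neg_one_pow, Nat.even_iff.1 h']
  · simp [h'.neg_one_pow, Nat.odd_iff.1 h']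

theorem ComputableRat.comp {q : β → ℚ} (hq : ComputableRat q) {g : α → β} (hg : Computable g) :
    ComputableRat fun a => q (g a) := by
  obtain ⟨s, b, c, hs, hb, hc, h⟩ := hq
  exact ⟨_, _, _, hs.comp hg, hb.comp hg, hc.comp hg, fun a => h (g a)⟩

theorem ComputableRat.of_eq {q r : α → ℚ} (hq : ComputableRat q) (h : ∀ a, q a = r a) :
    ComputableRat r := (funext h : q = r) ▸ hq

theorem ComputableRat.natCast {f : α → ℕ} (hf : Computable f) :
    ComputableRat fun a => (f a : ℚ) :=
  .of_sub hf (Computable.const 0) (Computable.const 1) (by simp) (by simp)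

theorem ComputableRat.const (r : ℚ) : ComputableRat fun _ : α => r := by
  refine .of_sub (Computable.const r.num.toNat) (Computable.const (-r.num).toNat)
    (Computable.const r.den) (by simp) fun _ => ?_
  have h : ((r.num.toNat : ℤ) : ℚ) - ((-r.num).toNat : ℤ) = r.num := by
    rw [← Int.cast_sub, Int.toNat_sub_toNat_neg]
  push_cast at h
  rw [h, Rat.num_div_den]

theorem ComputableRat.neg {q : α → ℚ} (hq : ComputableRat q) : ComputableRat fun a => -q a := by
  obtain ⟨p, m, c, hp, hm, hc, h⟩ := hq.exists_sub
  refine .of_sub hm hp hc (fun a => (h a).1) fun a => ?_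
  rw [(h a).2]; ring

theorem ComputableRat.add {q r : α → ℚ} (hq : ComputableRat q) (hr : ComputableRat r) :
    ComputableRat fun a => q a + r a := by
  obtain ⟨p, m, c, hp, hm, hc, h⟩ := hq.exists_sub
  obtain ⟨p', m', c', hp', hm', hc', h'⟩ := hr.exists_sub
  refine .of_sub ((hp.nat_mul' hc').nat_add' (hp'.nat_mul' hc))
    ((hm.nat_mul' hc').nat_add' (hm'.nat_mul' hc)) (hc.nat_mul' hc')
    (fun a => mul_ne_zero (h a).1 (h' a).1) fun a => ?_
  have h1 : (c a : ℚ) ≠ 0 := Nat.cast_ne_zero.2 (h a).1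
  have h2 : (c' a : ℚ) ≠ 0 := Nat.cast_ne_zero.2 (h' a).1
  rw [(h a).2, (h' a).2]; push_cast; field_simp; ring

theorem ComputableRat.sub {q r : α → ℚ} (hq : ComputableRat q) (hr : ComputableRat r) :
    ComputableRat fun a => q a - r a :=
  (hq.add hr.neg).of_eq fun _ => (sub_eq_add_neg _ _).symm

theorem ComputableRat.mul {q r : α → ℚ} (hq : ComputableRat q) (hr : ComputableRat r) :
    ComputableRat fun a => q a * r a := by
  obtain ⟨p, m, c, hp, hm, hc, h⟩ := hq.exists_sub
  obtain ⟨p', m', c', hp', hm', hc', h'⟩ := hr.exists_sub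
  refine .of_sub ((hp.nat_mul' hp').nat_add' (hm.nat_mul' hm'))
    ((hp.nat_mul' hm').nat_add' (hm.nat_mul' hp')) (hc.nat_mul' hc')
    (fun a => mul_ne_zero (h a).1 (h' a).1) fun a => ?_
  have h1 : (c a : ℚ) ≠ 0 := Nat.cast_ne_zero.2 (h a).1
  have h2 : (c' a : ℚ) ≠ 0 := Nat.cast_ne_zero.2 (h' a).1
  rw [(h a).2, (h' a).2]; push_cast; field_simp; ring

theorem ComputableRat.inv {q : α → ℚ} (hq : ComputableRat q) : ComputableRat fun a => (q a)⁻¹ := by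
  obtain ⟨s, b, c, hs, hb, hc, h⟩ := hq
  have hz : Computable fun a => decide (b a = 0) := hb.decide_nat_eq (Computable.const 0)
  refine ⟨s, fun a => if decide (b a = 0) = true then 0 else c a,
    fun a => if decide (b a = 0) = true then 1 else b a, hs,
    hz.ite_bool (Computable.const 0) hc, hz.ite_bool (Computable.const 1) hb, fun a => ?_⟩
  by_cases h0 : b a = 0
  · simp [h0, (h a).2]
  · have h1 : ((-1 : ℚ) ^ s a)⁻¹ = (-1) ^ s a := by
      rcases neg_one_pow_eq_or ℚ (s a) with h | h <;> rw [h] <;> norm_num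
    simp only [h0, decide_false, Bool.false_eq_true, if_false, ne_eq, not_false_eq_true, true_and]
    rw [(h a).2, inv_div, div_mul_eq_div_div, div_right_comm, div_eq_mul_inv (c a / b a : ℚ), h1]
    ring

theorem ComputableRat.div {q r : α → ℚ} (hq : ComputableRat q) (hr : ComputableRat r) :
    ComputableRat fun a => q a / r a :=
  (hq.mul hr.inv).of_eq fun _ => (div_eq_mul_inv _ _).symm

theorem ComputableRat.pow {q : ℚ} {f : α → ℕ} (hf : Computable f) :
    ComputableRat fun a => q ^ f a := by
  obtain ⟨s, b, c, -, -, -, h⟩ := ComputableRat.const (α := ℕ) q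
  refine ⟨fun a => s 0 * f a, fun a => b 0 ^ f a, fun a => c 0 ^ f a,
    (Computable.const _).nat_mul' hf, (Computable.const _).nat_pow' hf,
    (Computable.const _).nat_pow' hf, fun a => ⟨pow_ne_zero _ (h 0).1, ?_⟩⟩
  have e : q = (-1) ^ s 0 * (b 0 : ℚ) / (c 0 : ℚ) := (h 0).2
  simp only [e]; push_cast; rw [div_pow, mul_pow, pow_mul]

theorem ComputableRat.decide_le {q r : α → ℚ} (hq : ComputableRat q) (hr : ComputableRat r) :
    Computable fun a => decide (q a ≤ r a) := by
  obtain ⟨p, m, c, hp, hm, hc, h⟩ := hq.exists_sub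
  obtain ⟨p', m', c', hp', hm', hc', h'⟩ := hr.exists_sub
  refine (((hp.nat_mul' hc').nat_add' (hm'.nat_mul' hc)).decide_nat_le
    ((hp'.nat_mul' hc).nat_add' (hm.nat_mul' hc'))).of_eq fun a => ?_
  have h1 : (0 : ℚ) < c a := Nat.cast_pos.2 (Nat.pos_of_ne_zero (h a).1)
  have h2 : (0 : ℚ) < c' a := Nat.cast_pos.2 (Nat.pos_of_ne_zero (h' a).1)
  rw [(h a).2, (h' a).2]
  congr 1
  rw [div_le_div_iff₀ h1 h2, ← Nat.cast_le (α := ℚ)]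
  push_cast
  rw [eq_iff_iff]
  constructor <;> intro h <;> linarith

theorem ComputableRat.decide_lt {q r : α → ℚ} (hq : ComputableRat q) (hr : ComputableRat r) :
    Computable fun a => decide (q a < r a) :=
  (hr.decide_le hq).bool_not.of_eq fun a => by simp [← not_le]

theorem ComputableRat.decide_eq {q r : α → ℚ} (hq : ComputableRat q) (hr : ComputableRat r) :
    Computable fun a => decide (q a = r a) :=
  ((hq.decide_le hr).bool_and (hr.decide_le hq)).of_eq fun a => by
    simp [le_antisymm_iff]

theorem ComputableRat.ite {t : α → Bool} {q r : α → ℚ} (ht : Computable t) (hq : ComputableRat q)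
    (hr : ComputableRat r) : ComputableRat fun a => if t a = true then q a else r a := by
  obtain ⟨s, b, c, hs, hb, hc, h⟩ := hq
  obtain ⟨s', b', c', hs', hb', hc', h'⟩ := hr
  refine ⟨_, _, _, ht.ite_bool hs hs', ht.ite_bool hb hb', ht.ite_bool hc hc', fun a => ?_⟩
  rcases Bool.eq_false_or_eq_true (t a) with e | e
  · simpa [e] using h a
  · simpa [e] using h' a

theorem ComputableRat.max {q r : α → ℚ} (hq : ComputableRat q) (hr : ComputableRat r) :
    ComputableRat fun a => max (q a) (r a) :=
  (ComputableRat.ite (hq.decide_le hr) hr hq).of_eq fun a => by simp [max_def]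

theorem ComputableRat.min {q r : α → ℚ} (hq : ComputableRat q) (hr : ComputableRat r) :
    ComputableRat fun a => min (q a) (r a) :=
  (ComputableRat.ite (hq.decide_le hr) hq hr).of_eq fun a => by simp [min_def]

theorem ComputableRat.abs {q : α → ℚ} (hq : ComputableRat q) : ComputableRat fun a => |q a| :=
  hq.max hq.neg

/-- Computable families of rationals are closed under recursion along `ℕ`. -/
theorem ComputableRat.nat_rec {N : α → ℕ} {g : α → ℚ} {h : α → ℕ → ℚ → ℚ} (hN : Computable N)
    (hg : ComputableRat g)
    (hh : ∀ {β : Type} [Primcodable β] {A : β → α} {k : β → ℕ} {x : β → ℚ}, Computable A →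
      Computable k → ComputableRat x → ComputableRat fun i => h (A i) (k i) (x i)) :
    ComputableRat fun a => Nat.rec (motive := fun _ => ℚ) (g a) (fun k x => h a k x) (N a) := by
  -- The last entry stores the denominator minus one, so that every triple of naturals codes a
  -- rational and the recursion can run on triples.
  let val : ℕ × ℕ × ℕ → ℚ := fun t => (-1) ^ t.1 * (t.2.1 : ℚ) / ((t.2.2 + 1 : ℕ) : ℚ)
  have hval : ComputableRat fun i : α × ℕ × ℕ × ℕ × ℕ => val i.2.2 :=
    ⟨fun i => i.2.2.1, fun i => i.2.2.2.1, fun i => i.2.2.2.2 + 1,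
      Computable.fst.comp (Computable.snd.comp Computable.snd),
      Computable.fst.comp (Computable.snd.comp (Computable.snd.comp Computable.snd)),
      Computable.succ.comp
        (Computable.snd.comp (Computable.snd.comp (Computable.snd.comp Computable.snd))),
      fun i => ⟨Nat.succ_ne_zero _, rfl⟩⟩
  obtain ⟨s, b, c, hs, hb, hc, e⟩ := hg
  obtain ⟨s', b', c', hs', hb', hc', e'⟩ :=
    hh (β := α × ℕ × ℕ × ℕ × ℕ) Computable.fst (Computable.fst.comp Computable.snd) hval
  have hrec := Computable.nat_rec (f := N) (g := fun a => (s a, b a, (c a).pred))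
    (h := fun a i => (s' (a, i), b' (a, i), (c' (a, i)).pred)) hN
    (hs.pair (hb.pair (Computable.pred.comp hc)))
    (hs'.pair (hb'.pair (Computable.pred.comp hc'))).to₂
  refine ⟨_, _, _, Computable.fst.comp hrec, Computable.fst.comp (Computable.snd.comp hrec),
    Computable.succ.comp (Computable.snd.comp (Computable.snd.comp hrec)),
    fun a => ⟨Nat.succ_ne_zero _, ?_⟩⟩
  let st : ℕ → ℕ × ℕ × ℕ := fun n => Nat.rec (s a, b a, (c a).pred)
    (fun y IH => (s' (a, y, IH), b' (a, y, IH), (c' (a, y, IH)).pred)) n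
  suffices H : ∀ n, Nat.rec (motive := fun _ => ℚ) (g a) (fun k x => h a k x) n = val (st n) from
    H (N a)
  intro n
  induction n with
  | zero =>
    change g a = (-1) ^ s a * (b a : ℚ) / (((c a).pred + 1 : ℕ) : ℚ)
    rw [← Nat.succ_eq_add_one, Nat.succ_pred (e a).1, (e a).2]
  | succ k ih =>
    change h a k (Nat.rec (motive := fun _ => ℚ) (g a) (fun k x => h a k x) k) =
      (-1) ^ s' (a, k, st k) * (b' (a, k, st k) : ℚ) / (((c' (a, k, st k)).pred + 1 : ℕ) : ℚ)
    rw [← Nat.succ_eq_add_one, Nat.succ_pred (e' _).1, ← (e' _).2, ih]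

theorem ComputableRat.sum {N : α → ℕ} {g : α × ℕ → ℚ} (hN : Computable N) (hg : ComputableRat g) :
    ComputableRat fun a => ∑ k ∈ Finset.range (N a), g (a, k) :=
  (ComputableRat.nat_rec (h := fun a k x => x + g (a, k)) hN (ComputableRat.const 0)
    fun hA hk hx => hx.add (hg.comp (hA.pair hk))).of_eq fun a => by
      induction N a with
      | zero => rfl
      | succ k ih => rw [Finset.sum_range_succ, ← ih]

/-- The minimum of `1` and the `g k`, `k < n`. -/
def minBelow (g : ℕ → ℚ) (n : ℕ) : ℚ := Nat.rec 1 (fun k x => min x (g k)) n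

theorem le_minBelow_iff {g : ℕ → ℚ} {n : ℕ} {z : ℚ} :
    z ≤ minBelow g n ↔ z ≤ 1 ∧ ∀ k < n, z ≤ g k := by
  induction n with
  | zero => simp [minBelow]
  | succ n ih =>
    change z ≤ min (minBelow g n) (g n) ↔ _
    rw [le_min_iff, ih, and_assoc, Nat.forall_lt_succ_right]

theorem minBelow_eq (g : ℕ → ℚ) (n : ℕ) :
    minBelow g n = 1 ∨ ∃ k < n, minBelow g n = g k := by
  induction n with
  | zero => exact Or.inl rfl
  | succ n ih =>
    change min (minBelow g n) (g n) = 1 ∨ ∃ k < n + 1, min (minBelow g n) (g n) = g k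
    rcases min_choice (minBelow g n) (g n) with h | h
    · rw [h]
      exact ih.imp_right fun ⟨k, hk, e⟩ => ⟨k, hk.trans n.lt_succ_self, e⟩
    · exact Or.inr ⟨n, n.lt_succ_self, h⟩

theorem ComputableRat.minBelow {N : α → ℕ} {g : α × ℕ → ℚ} (hN : Computable N)
    (hg : ComputableRat g) : ComputableRat fun a => minBelow (fun k => g (a, k)) (N a) :=
  ComputableRat.nat_rec (h := fun a k x => Min.min x (g (a, k))) hN (ComputableRat.const 1)
    fun hA hk hx => hx.min (hg.comp (hA.pair hk))

theorem ComputableRat.natFloor {q : α → ℚ} (hq : ComputableRat q) (h0 : ∀ a, 0 ≤ q a) :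
    Computable fun a => ⌊q a⌋₊ := by
  obtain ⟨p, m, c, hp, hm, hc, h⟩ := hq.exists_sub
  refine ((hp.nat_sub' hm).nat_div' hc).of_eq fun a => ?_
  have h1 : (0 : ℚ) < c a := Nat.cast_pos.2 (Nat.pos_of_ne_zero (h a).1)
  have h2 : m a ≤ p a := by
    have := h0 a
    rw [(h a).2, le_div_iff₀ h1, zero_mul, sub_nonneg] at this
    exact_mod_cast this
  rw [(h a).2, ← Nat.cast_sub h2, Nat.floor_div_eq_div]

/-- A rational approximation, with error at most `2⁻ᵏ`, of the square root of `q`. -/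
def ratSqrt (q : ℚ) (k : ℕ) : ℚ := (Nat.sqrt ⌊q * 4 ^ k⌋₊ : ℚ) / 2 ^ k

theorem ComputableRat.ratSqrt {q : α → ℚ} {k : α → ℕ} (hq : ComputableRat q) (h0 : ∀ a, 0 ≤ q a)
    (hk : Computable k) : ComputableRat fun a => ratSqrt (q a) (k a) :=
  (ComputableRat.natCast (Primrec.nat_sqrt.to_comp.comp
    ((hq.mul (ComputableRat.pow hk)).natFloor fun a => mul_nonneg (h0 a) (by positivity)))).div
    (ComputableRat.pow hk)

/-- After scaling by `2 ^ k`, the integer root of the floor is within one of the true root: taking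
the floor first does not lose an integer. -/
theorem abs_ratSqrt_sub_le {q : ℚ} (h0 : 0 ≤ q) (k : ℕ) :
    |(ratSqrt q k : ℝ) - Real.sqrt q| ≤ (1 / 2) ^ k := by
  set N := ⌊q * 4 ^ k⌋₊ with hN
  have hq : (0 : ℝ) ≤ q := by exact_mod_cast h0
  have hs : Real.sqrt ((q : ℝ) * 4 ^ k) = Real.sqrt q * 2 ^ k := by
    have e4 : (4 : ℝ) ^ k = (2 ^ k) ^ 2 := by rw [← pow_mul, mul_comm, pow_mul]; norm_num
    rw [Real.sqrt_mul hq, e4, Real.sqrt_sq (by positivity)]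
  have h1 : (Nat.sqrt N : ℝ) ≤ Real.sqrt q * 2 ^ k := by
    rw [← hs]
    apply Real.le_sqrt_of_sq_le
    have a1 : Nat.sqrt N ^ 2 ≤ N := Nat.sqrt_le' N
    have a2 : (N : ℚ) ≤ q * 4 ^ k := Nat.floor_le (by positivity)
    have a3 : (N : ℝ) ≤ q * 4 ^ k := by exact_mod_cast a2
    exact le_trans (by exact_mod_cast a1) a3
  have h2 : Real.sqrt q * 2 ^ k ≤ Nat.sqrt N + 1 := by
    rw [← hs]
    apply Real.sqrt_le_iff.2 ⟨by positivity, ?_⟩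
    have a1 : N + 1 ≤ (Nat.sqrt N + 1) ^ 2 := Nat.succ_le_succ_sqrt' N
    have a2 : q * 4 ^ k < (N : ℚ) + 1 := Nat.lt_floor_add_one _
    have a3 : (q : ℝ) * 4 ^ k < (N : ℝ) + 1 := by exact_mod_cast a2
    exact a3.le.trans (by exact_mod_cast a1)
  have e : (ratSqrt q k : ℝ) - Real.sqrt q = (Nat.sqrt N - Real.sqrt q * 2 ^ k) * (1 / 2) ^ k := by
    rw [ratSqrt, ← hN]; push_cast; rw [one_div, inv_pow]; field_simp
  rw [e, abs_mul, abs_of_nonneg (by positivity : (0 : ℝ) ≤ (1 / 2) ^ k)]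
  refine mul_le_of_le_one_left (by positivity) (abs_le.2 ⟨by linarith, by linarith⟩)

end ComputableRat

/-! ### Computable enumerations -/

section Enumeration

variable {α : Type} [Primcodable α]

theorem Computable.decide_exists_lt {N : α → ℕ} {P : α × ℕ → Bool} (hN : Computable N)
    (hP : Computable P) : Computable fun a => decide (∃ k < N a, P (a, k) = true) := by
  refine (Computable.nat_rec (σ := Bool) (h := fun a i => i.2 || P (a, i.1)) hN
    (Computable.const false) (Computable.bool_or (Computable.snd.comp Computable.snd)
      (hP.comp (Computable.fst.pair (Computable.fst.comp Computable.snd)))).to₂).of_eq fun a => ?_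
  induction N a with
  | zero => simp
  | succ n ih =>
    change (Nat.rec (motive := fun _ => Bool) false (fun k x => x || P (a, k)) n || P (a, n)) = _
    rw [ih, Bool.eq_iff_iff]
    simp only [Bool.or_eq_true, decide_eq_true_eq, Nat.exists_lt_succ_right]

theorem Computable.testBit : Computable fun i : ℕ × ℕ => i.1.testBit i.2 :=
  (((Computable.fst.nat_div' ((Computable.const 2).nat_pow' Computable.snd)).nat_mod'
    (Computable.const 2)).decide_nat_eq (Computable.const 1)).of_eq fun i => by
      rw [Nat.testBit_eq_decide_div_mod_eq]

/-- Unbounded search for the element of the set that has exactly `n` predecessors in it; infinitude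
makes the search terminate. -/
theorem Computable.nat_nth {S : ℕ → Bool} (hS : Computable S) (hi : {i | S i = true}.Infinite) :
    Computable (Nat.nth fun i => S i = true) := by
  have hc : Computable (Nat.count fun i => S i = true) := by
    refine (Computable.nat_rec (σ := ℕ) (h := fun _ i => i.2 + if S i.1 = true then 1 else 0)
      Computable.id (Computable.const 0) (Computable.nat_add' (Computable.snd.comp Computable.snd)
        ((hS.comp (Computable.fst.comp Computable.snd)).ite_bool (Computable.const 1)
          (Computable.const 0))).to₂).of_eq fun n => ?_
    induction n with
    | zero => simp
    | succ n ih => simp only [id] at ih ⊢; rw [Nat.count_succ, ← ih]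
  have hP : Computable₂ fun n i => S i && decide (Nat.count (fun i => S i = true) i = n) :=
    ((hS.comp Computable.snd).bool_and
      ((hc.comp Computable.snd).decide_nat_eq Computable.fst)).to₂
  refine (Partrec.rfind hP.partrec₂).of_eq_tot fun n => ?_
  have hex : ∃ i, (S i && decide (Nat.count (fun i => S i = true) i = n)) = true :=
    ⟨Nat.nth (fun i => S i = true) n, by
      simp [Nat.nth_mem_of_infinite hi n, Nat.count_nth_of_infinite hi n]⟩
  obtain ⟨i, hi'⟩ := hex
  obtain ⟨m, hm, -⟩ := Nat.rfind_min'
    (p := fun i => S i && decide (Nat.count (fun i => S i = true) i = n)) hi'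
  have h1 := Nat.rfind_spec hm
  simp only [PFun.coe_val, Part.mem_some_iff, Bool.true_eq, Bool.and_eq_true,
    decide_eq_true_eq] at h1
  have h2 : Nat.nth (fun i => S i = true) n = m := by
    rw [← h1.2]; exact Nat.nth_count (p := fun i => S i = true) h1.1
  rw [h2]; exact hm

end Enumeration

/-! ### A tree without computable branches -/

open Nat.Partrec (Code)

/-- Some `e < d` is such that the `e`-th program is seen within `d` steps to agree at `e` with
`p`. -/
def Dead (p : ℕ → Bool) (d : ℕ) : Prop :=
  ∃ e < d, Code.evaln d (Denumerable.ofNat Code e) e = some (p e).toNat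

instance (p : ℕ → Bool) (d : ℕ) : Decidable (Dead p d) := by unfold Dead; infer_instance

theorem Dead.mono {p : ℕ → Bool} {d d' : ℕ} (h : Dead p d) (hd : d ≤ d') : Dead p d' := by
  obtain ⟨e, he, h⟩ := h
  exact ⟨e, he.trans_le hd, Code.evaln_mono hd h⟩

theorem Dead.congr {p q : ℕ → Bool} {d : ℕ} (h : ∀ e < d, p e = q e) : Dead p d ↔ Dead q d :=
  exists_congr fun e => and_congr_right fun he => by rw [h e he]

/-- The program computing `p` agrees with `p` at its own code. -/
theorem exists_dead {p : ℕ → Bool} (hp : Computable p) : ∃ d, Dead p d := by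
  have hf : Computable fun n => (p n).toNat :=
    (hp.ite_bool (Computable.const 1) (Computable.const 0)).of_eq fun n => by cases p n <;> rfl
  obtain ⟨c, hc⟩ := Code.exists_code.1 (Partrec.nat_iff.1 hf.partrec)
  have h1 : (p (Encodable.encode c)).toNat ∈ c.eval (Encodable.encode c) := by
    rw [hc]; simp
  obtain ⟨k, hk⟩ := Code.evaln_complete.1 h1
  -- The level must exceed both the running time and the index of the program.
  refine ⟨max k (Encodable.encode c + 1), Encodable.encode c, by simp, ?_⟩
  rw [Denumerable.ofNat_encode]
  exact Code.evaln_mono (le_max_left _ _) hk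

/-- Diagonalization: the turn at `e` differs from whatever the `e`-th program outputs on `e`. -/
theorem exists_forall_not_dead : ∃ p : ℕ → Bool, ∀ d, ¬ Dead p d := by
  classical
  refine ⟨fun e => !decide (1 ∈ (Denumerable.ofNat Code e).eval e), fun d => ?_⟩
  rintro ⟨e, -, h⟩
  have h' := Code.evaln_sound (Option.mem_def.2 h)
  by_cases h1 : 1 ∈ (Denumerable.ofNat Code e).eval e
  · simp only [h1, decide_true, Bool.not_true, Bool.toNat_false] at h'
    exact absurd (Part.mem_unique h1 h') one_ne_zero
  · simp only [h1, decide_false, Bool.not_false, Bool.toNat_true] at h'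

theorem computable_dead :
    Computable fun i : ℕ × ℕ => decide (Dead i.2.testBit i.1) := by
  have h : Computable fun i : (ℕ × ℕ) × ℕ =>
      decide (Code.evaln i.1.1 (Denumerable.ofNat Code i.2) i.2 =
        some (i.1.2.testBit i.2).toNat) := by
    have h1 : Computable fun i : (ℕ × ℕ) × ℕ =>
        Code.evaln i.1.1 (Denumerable.ofNat Code i.2) i.2 :=
      Code.primrec_evaln.to_comp.comp
        (((Computable.fst.comp Computable.fst).pair
          ((Computable.ofNat Code).comp Computable.snd)).pair Computable.snd)
    have h2 : Computable fun i : (ℕ × ℕ) × ℕ => some (i.1.2.testBit i.2).toNat :=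
      Computable.option_some.comp
        (((Computable.testBit.comp ((Computable.snd.comp Computable.fst).pair
          Computable.snd)).ite_bool (Computable.const 1) (Computable.const 0)).of_eq fun i => by
            cases i.1.2.testBit i.2 <;> rfl)
    exact (PrimrecRel.decide Primrec.eq).to_comp.comp h1 h2
  exact (Computable.decide_exists_lt Computable.fst h).of_eq fun i => by simp [Dead]

/-! ### Cantor intervals -/

/-- The left endpoint of the interval of level `d` of the Cantor set along the branch `p`. -/
def cantorLeft (p : ℕ → Bool) (d : ℕ) : ℚ :=
  ∑ e ∈ Finset.range d, if p e = true then 2 / 3 ^ (e + 1) else 0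

/-- The right endpoint of the interval of level `d` of the Cantor set along the branch `p`. -/
def cantorRight (p : ℕ → Bool) (d : ℕ) : ℚ := cantorLeft p d + 1 / 3 ^ d

theorem cantorLeft_congr {p q : ℕ → Bool} {d : ℕ} (h : ∀ e < d, p e = q e) :
    cantorLeft p d = cantorLeft q d :=
  Finset.sum_congr rfl fun e he => by rw [h e (Finset.mem_range.1 he)]

theorem cantorLeft_succ (p : ℕ → Bool) (d : ℕ) :
    cantorLeft p (d + 1) = cantorLeft p d + if p d = true then 2 / 3 ^ (d + 1) else 0 :=
  Finset.sum_range_succ _ _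

theorem one_div_three_pow_succ (d : ℕ) : (1 : ℚ) / 3 ^ d = 3 * (1 / 3 ^ (d + 1)) := by
  rw [pow_succ]; field_simp

theorem cantorLeft_succ_of_true {p : ℕ → Bool} {d : ℕ} (h : p d = true) :
    cantorLeft p (d + 1) = cantorLeft p d + 2 / 3 ^ (d + 1) := by simp [cantorLeft_succ, h]

theorem cantorLeft_succ_of_false {p : ℕ → Bool} {d : ℕ} (h : p d = false) :
    cantorLeft p (d + 1) = cantorLeft p d := by simp [cantorLeft_succ, h]

theorem cantorRight_succ_of_true {p : ℕ → Bool} {d : ℕ} (h : p d = true) :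
    cantorRight p (d + 1) = cantorRight p d := by
  rw [cantorRight, cantorRight, cantorLeft_succ_of_true h, one_div_three_pow_succ d]; ring

theorem cantorRight_succ_of_false {p : ℕ → Bool} {d : ℕ} (h : p d = false) :
    cantorRight p (d + 1) = cantorLeft p d + 1 / 3 ^ (d + 1) := by
  rw [cantorRight, cantorLeft_succ_of_false h]

theorem monotone_cantorLeft (p : ℕ → Bool) : Monotone (cantorLeft p) :=
  monotone_nat_of_le_succ fun d => by
    rw [cantorLeft_succ]; split_ifs <;> [exact le_add_of_nonneg_right (by positivity); simp]

theorem antitone_cantorRight (p : ℕ → Bool) : Antitone (cantorRight p) :=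
  antitone_nat_of_succ_le fun d => by
    cases h : p d
    · rw [cantorRight_succ_of_false h, cantorRight, one_div_three_pow_succ d]
      have : (0 : ℚ) < 1 / 3 ^ (d + 1) := by positivity
      linarith
    · exact (cantorRight_succ_of_true h).le

theorem cantorLeft_nonneg (p : ℕ → Bool) (d : ℕ) : 0 ≤ cantorLeft p d :=
  monotone_cantorLeft p d.zero_le

theorem cantorRight_le_one (p : ℕ → Bool) (d : ℕ) : cantorRight p d ≤ 1 := by
  simpa [cantorRight, cantorLeft] using antitone_cantorRight p d.zero_le

/-- At the first disagreement `e` one branch enters the left and the other the right third; the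
middle third separates them from then on. -/
theorem cantorRight_lt_cantorLeft {p q : ℕ → Bool} {e d d' : ℕ} (h : ∀ i < e, p i = q i)
    (hp : p e = false) (hq : q e = true) (hd : e < d) (hd' : e < d') :
    cantorRight p d < cantorLeft q d' := by
  have h1 := antitone_cantorRight p hd
  have h2 := monotone_cantorLeft q hd'
  rw [Nat.succ_eq_add_one, cantorRight_succ_of_false hp, cantorLeft_congr h] at h1
  rw [Nat.succ_eq_add_one, cantorLeft_succ_of_true hq] at h2
  have h3 : (2 : ℚ) / 3 ^ (e + 1) = 2 * (1 / 3 ^ (e + 1)) := by ring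
  have : (0 : ℚ) < 1 / 3 ^ (e + 1) := by positivity
  linarith

/-- The left endpoint was created at the last turn to the right, as the right end of the middle
third removed there. -/
theorem cantorLeft_eq_zero_or (p : ℕ → Bool) (d : ℕ) :
    cantorLeft p d = 0 ∨ ∃ e < d, cantorLeft p d = cantorLeft p e + 2 / 3 ^ (e + 1) := by
  induction d with
  | zero => exact Or.inl rfl
  | succ d ih =>
    cases h : p d
    · rw [cantorLeft_succ_of_false h]
      exact ih.imp_right fun ⟨e, he, h⟩ => ⟨e, he.trans d.lt_succ_self, h⟩
    · exact Or.inr ⟨d, d.lt_succ_self, cantorLeft_succ_of_true h⟩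

theorem cantorRight_eq_one_or (p : ℕ → Bool) (d : ℕ) :
    cantorRight p d = 1 ∨ ∃ e < d, cantorRight p d = cantorLeft p e + 1 / 3 ^ (e + 1) := by
  induction d with
  | zero => exact Or.inl (by simp [cantorRight, cantorLeft])
  | succ d ih =>
    cases h : p d
    · exact Or.inr ⟨d, d.lt_succ_self, cantorRight_succ_of_false h⟩
    · rw [cantorRight_succ_of_true h]
      exact ih.imp_right fun ⟨e, he, h⟩ => ⟨e, he.trans d.lt_succ_self, h⟩

theorem cantorLeft_eq_of_false {p : ℕ → Bool} {d d' : ℕ} (hd : d ≤ d')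
    (h : ∀ e, d ≤ e → p e = false) : cantorLeft p d' = cantorLeft p d := by
  induction d', hd using Nat.le_induction with
  | base => rfl
  | succ n hn ih => rw [cantorLeft_succ_of_false (h n hn), ih]

theorem cantorRight_eq_of_true {p : ℕ → Bool} {d d' : ℕ} (hd : d ≤ d')
    (h : ∀ e, d ≤ e → p e = true) : cantorRight p d' = cantorRight p d := by
  induction d', hd using Nat.le_induction with
  | base => rfl
  | succ n hn ih => rw [cantorRight_succ_of_true (h n hn), ih]

/-! ### The intervals of the tree -/

/-- The left endpoint of the interval of a node: the middle third of the Cantor interval of a live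
node, the whole Cantor interval of a dead node. -/
def nodeLeft (p : ℕ → Bool) (d : ℕ) : ℚ :=
  if Dead p d then cantorLeft p d else cantorLeft p d + 1 / 3 ^ (d + 1)

/-- The right endpoint of the interval of a node. -/
def nodeRight (p : ℕ → Bool) (d : ℕ) : ℚ :=
  if Dead p d then cantorRight p d else cantorLeft p d + 2 / 3 ^ (d + 1)

theorem nodeLeft_congr {p q : ℕ → Bool} {d : ℕ} (h : ∀ e < d, p e = q e) :
    nodeLeft p d = nodeLeft q d := by
  simp only [nodeLeft, Dead.congr h, cantorLeft_congr h]

theorem nodeRight_congr {p q : ℕ → Bool} {d : ℕ} (h : ∀ e < d, p e = q e) :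
    nodeRight p d = nodeRight q d := by
  simp only [nodeRight, cantorRight, Dead.congr h, cantorLeft_congr h]

theorem cantorLeft_le_nodeLeft (p : ℕ → Bool) (d : ℕ) : cantorLeft p d ≤ nodeLeft p d := by
  unfold nodeLeft; split_ifs <;> [exact le_rfl; exact le_add_of_nonneg_right (by positivity)]

theorem two_div_three_pow (d : ℕ) : (2 : ℚ) / 3 ^ d = 2 * (1 / 3 ^ d) := by ring

theorem nodeRight_le_cantorRight (p : ℕ → Bool) (d : ℕ) : nodeRight p d ≤ cantorRight p d := by
  unfold nodeRight cantorRight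
  rw [one_div_three_pow_succ d, two_div_three_pow]
  have : (0 : ℚ) < 1 / 3 ^ (d + 1) := by positivity
  split_ifs <;> linarith

theorem nodeLeft_lt_nodeRight (p : ℕ → Bool) (d : ℕ) : nodeLeft p d < nodeRight p d := by
  unfold nodeLeft nodeRight cantorRight
  rw [one_div_three_pow_succ d, two_div_three_pow]
  have : (0 : ℚ) < 1 / 3 ^ (d + 1) := by positivity
  split_ifs <;> linarith

/-- The node of level `d` along `p` belongs to the tree of nodes with live predecessors. -/
def IsNode (p : ℕ → Bool) (d : ℕ) : Prop := ∀ e < d, ¬ Dead p e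

theorem IsNode.congr {p q : ℕ → Bool} {d : ℕ} (h : ∀ e < d, p e = q e) :
    IsNode p d ↔ IsNode q d :=
  forall₂_congr fun e he => by rw [Dead.congr fun i hi => h i (hi.trans he)]

theorem IsNode.of_le {p : ℕ → Bool} {d e : ℕ} (h : IsNode p d) (he : e ≤ d) : IsNode p e :=
  fun i hi => h i (hi.trans_le he)

/-- Death is permanent, so only the immediate predecessor has to be tested. -/
theorem isNode_iff (p : ℕ → Bool) (d : ℕ) : IsNode p d ↔ d = 0 ∨ ¬ Dead p (d - 1) := by
  refine ⟨fun h => d.eq_zero_or_pos.imp_right fun hd => h _ (Nat.sub_lt hd one_pos), ?_⟩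
  rintro (rfl | h) e he hD
  · exact absurd he (Nat.not_lt_zero e)
  · exact h (hD.mono (Nat.le_sub_one_of_lt he))

/-- Either the first node is a proper ancestor of the second, hence live, and its middle third
avoids the outer third containing the second; or the branches have split, and already their Cantor
intervals are disjoint. -/
theorem IsNode.nodeRight_le_nodeLeft_of_le {p q : ℕ → Bool} {d d' : ℕ} (hdd : d ≤ d')
    (hq : IsNode q d') (hne : ¬ (d = d' ∧ ∀ e < d, p e = q e)) :
    nodeRight p d ≤ nodeLeft q d' ∨ nodeRight q d' ≤ nodeLeft p d := by
  by_cases h : ∀ e < d, p e = q e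
  · have hlt : d < d' := lt_of_le_of_ne hdd fun e => hne ⟨e, h⟩
    have hal : ¬ Dead p d := by rw [Dead.congr h]; exact hq d hlt
    cases hd : q d
    · right
      have h1 := (nodeRight_le_cantorRight q d').trans (antitone_cantorRight q hlt)
      rw [Nat.succ_eq_add_one, cantorRight_succ_of_false hd, ← cantorLeft_congr h] at h1
      simpa [nodeLeft, hal] using h1
    · left
      have h1 := (monotone_cantorLeft q hlt).trans (cantorLeft_le_nodeLeft q d')
      rw [Nat.succ_eq_add_one, cantorLeft_succ_of_true hd, ← cantorLeft_congr h] at h1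
      simpa [nodeRight, hal] using h1
  · push Not at h
    have hs := Nat.find_spec h
    have hm : ∀ i < Nat.find h, p i = q i := fun i hi => by
      have := Nat.find_min h hi
      push Not at this
      exact this (hi.trans hs.1)
    cases hp : p (Nat.find h)
    · have hq' : q (Nat.find h) = true := by
        have := hs.2; rw [hp] at this; exact Bool.eq_true_of_not_eq_false (Ne.symm this)
      exact Or.inl ((nodeRight_le_cantorRight _ _).trans ((cantorRight_lt_cantorLeft hm hp hq' hs.1
        (hs.1.trans_le hdd)).le.trans (cantorLeft_le_nodeLeft _ _)))
    · have hq' : q (Nat.find h) = false := by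
        have := hs.2; rw [hp] at this; exact Bool.eq_false_of_not_eq_true (Ne.symm this)
      exact Or.inr ((nodeRight_le_cantorRight _ _).trans ((cantorRight_lt_cantorLeft
        (fun i hi => (hm i hi).symm) hq' hp (hs.1.trans_le hdd) hs.1).le.trans
          (cantorLeft_le_nodeLeft _ _)))

theorem IsNode.nodeRight_le_nodeLeft {p q : ℕ → Bool} {d d' : ℕ} (hp : IsNode p d)
    (hq : IsNode q d') (hne : ¬ (d = d' ∧ ∀ e < d, p e = q e)) :
    nodeRight p d ≤ nodeLeft q d' ∨ nodeRight q d' ≤ nodeLeft p d := by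
  rcases le_total d d' with h | h
  · exact hq.nodeRight_le_nodeLeft_of_le h hne
  · refine (hp.nodeRight_le_nodeLeft_of_le h ?_).symm
    rintro ⟨rfl, h'⟩
    exact hne ⟨rfl, fun e he => (h' e he).symm⟩

/-- The first death on the branch cannot occur below `d`, since the node at level `d` has live
predecessors. -/
theorem IsNode.exists_dead_of_computable {p : ℕ → Bool} (hp : Computable p) {d : ℕ}
    (h : IsNode p d) : ∃ d' ≥ d, IsNode p d' ∧ Dead p d' := by
  classical
  have hex := exists_dead hp
  refine ⟨Nat.find hex, ?_, fun e he => Nat.find_min hex he, Nat.find_spec hex⟩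
  by_contra hlt
  exact h _ (not_le.1 hlt) (Nat.find_spec hex)

/-- The branch that follows `p` below level `d`, takes the turn `v` there and the turn `w` at all
later levels. -/
def branch (p : ℕ → Bool) (d : ℕ) (v w : Bool) (e : ℕ) : Bool :=
  if e < d then p e else if e = d then v else w

theorem branch_of_lt {p : ℕ → Bool} {d e : ℕ} {v w : Bool} (h : e < d) :
    branch p d v w e = p e := by
  simp [branch, h]

theorem branch_self (p : ℕ → Bool) (d : ℕ) (v w : Bool) : branch p d v w d = v := by simp [branch]

theorem branch_of_gt {p : ℕ → Bool} {d e : ℕ} {v w : Bool} (h : d < e) : branch p d v w e = w := by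
  simp [branch, h.not_gt, h.ne']

theorem computable_branch (c d : ℕ) (v w : Bool) : Computable (branch c.testBit d v w) :=
  ((Computable.id.decide_nat_lt (Computable.const d)).ite_bool
    (Computable.testBit.comp ((Computable.const c).pair Computable.id))
    ((Computable.id.decide_nat_eq (Computable.const d)).ite_bool (Computable.const v)
      (Computable.const w))).of_eq fun e => by simp [branch]

theorem exists_testBit_eq (p : ℕ → Bool) (d : ℕ) : ∃ c < 2 ^ d, ∀ e < d, c.testBit e = p e :=
  ⟨Nat.ofBits fun i : Fin d => p i, Nat.ofBits_lt_two_pow _, fun e he => by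
    rw [Nat.testBit_ofBits_lt _ _ he]⟩

/-- Supplies the neighbour of a middle third: the branch hugging one of its endpoints is eventually
constant, hence computable, hence dies. -/
theorem exists_dead_branch (p : ℕ → Bool) {d : ℕ} (hp : ¬ Dead p d) (v w : Bool) :
    ∃ q : ℕ → Bool, (∀ e < d, q e = p e) ∧ q d = v ∧ (∀ e, d < e → q e = w) ∧
      ∃ d' > d, IsNode q d' ∧ Dead q d' := by
  -- `p` itself may be non-computable; its first `d` turns are replaced by the digits of a number.
  obtain ⟨c, -, hc⟩ := exists_testBit_eq p d
  have hq : ∀ e < d, branch c.testBit d v w e = p e := fun e he => by rw [branch_of_lt he, hc e he]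
  refine ⟨branch c.testBit d v w, hq, branch_self _ _ _ _, fun e he => branch_of_gt he, ?_⟩
  have hN : IsNode (branch c.testBit d v w) (d + 1) := fun e he hD =>
    hp ((Dead.congr hq).1 (hD.mono (Nat.le_of_lt_succ he)))
  exact hN.exists_dead_of_computable (computable_branch c d v w)

/-- The left end of a dead node is the right end of the middle third of an ancestor. The left end of
a middle third is the right end of the branch that turns left and then always right, and that branch
dies without moving this endpoint. -/
theorem IsNode.exists_nodeRight_eq_nodeLeft {p : ℕ → Bool} {d : ℕ} (hp : IsNode p d)
    (h0 : nodeLeft p d ≠ 0) : ∃ q d', IsNode q d' ∧ nodeRight q d' = nodeLeft p d := by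
  by_cases hD : Dead p d
  · have e0 : nodeLeft p d = cantorLeft p d := if_pos hD
    rcases cantorLeft_eq_zero_or p d with h | ⟨e, he, h⟩
    · exact absurd (e0.trans h) h0
    · exact ⟨p, e, hp.of_le he.le, by rw [e0, h, nodeRight, if_neg (hp e he)]⟩
  · obtain ⟨q, h1, h2, h3, d', hd', hN, hD'⟩ := exists_dead_branch p hD false true
    refine ⟨q, d', hN, ?_⟩
    rw [nodeRight, if_pos hD', nodeLeft, if_neg hD,
      cantorRight_eq_of_true (Nat.succ_le_of_lt hd') fun e he => h3 e he, Nat.succ_eq_add_one,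
      cantorRight_succ_of_false h2, cantorLeft_congr h1]

theorem IsNode.exists_nodeLeft_eq_nodeRight {p : ℕ → Bool} {d : ℕ} (hp : IsNode p d)
    (h0 : nodeRight p d ≠ 1) : ∃ q d', IsNode q d' ∧ nodeLeft q d' = nodeRight p d := by
  by_cases hD : Dead p d
  · have e0 : nodeRight p d = cantorRight p d := if_pos hD
    rcases cantorRight_eq_one_or p d with h | ⟨e, he, h⟩
    · exact absurd (e0.trans h) h0
    · exact ⟨p, e, hp.of_le he.le, by rw [e0, h, nodeLeft, if_neg (hp e he)]⟩
  · obtain ⟨q, h1, h2, h3, d', hd', hN, hD'⟩ := exists_dead_branch p hD true false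
    refine ⟨q, d', hN, ?_⟩
    rw [nodeLeft, if_pos hD', nodeRight, if_neg hD,
      cantorLeft_eq_of_false (Nat.succ_le_of_lt hd') fun e he => h3 e he, Nat.succ_eq_add_one,
      cantorLeft_succ_of_true h2, cantorLeft_congr h1]

/-! ### The enumeration of the intervals -/

/-- The test for codes of nodes of the tree. -/
def nodeTest (i : ℕ) : Bool :=
  decide (i.unpair.2 < 2 ^ i.unpair.1) &&
    (decide (i.unpair.1 = 0) || !decide (Dead i.unpair.2.testBit (i.unpair.1 - 1)))

theorem nodeTest_iff (i : ℕ) :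
    nodeTest i = true ↔ i.unpair.2 < 2 ^ i.unpair.1 ∧ IsNode i.unpair.2.testBit i.unpair.1 := by
  simp [nodeTest, isNode_iff]

theorem computable_nodeTest : Computable nodeTest := by
  have h1 : Computable fun i : ℕ => i.unpair.1 := Computable.fst.comp Computable.unpair
  have h2 : Computable fun i : ℕ => i.unpair.2 := Computable.snd.comp Computable.unpair
  exact (h2.decide_nat_lt ((Computable.const 2).nat_pow' h1)).bool_and
    ((h1.decide_nat_eq (Computable.const 0)).bool_or
      (computable_dead.comp ((h1.nat_sub' (Computable.const 1)).pair h2)).bool_not)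

theorem IsNode.exists_code {p : ℕ → Bool} {d : ℕ} (h : IsNode p d) :
    ∃ c, nodeTest (Nat.pair d c) = true ∧ ∀ e < d, c.testBit e = p e := by
  obtain ⟨c, hc, hb⟩ := exists_testBit_eq p d
  refine ⟨c, (nodeTest_iff _).2 ?_, hb⟩
  rw [Nat.unpair_pair]
  exact ⟨hc, (IsNode.congr hb).2 h⟩

/-- The branch that never dies has a node at every level. -/
theorem infinite_nodeTest : {i | nodeTest i = true}.Infinite := by
  obtain ⟨p, hp⟩ := exists_forall_not_dead
  choose c hc _ using fun d => IsNode.exists_code (p := p) (d := d) fun e _ => hp e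
  exact Set.infinite_of_injective_forall_mem (f := fun d => Nat.pair d (c d))
    (fun d d' h => (Nat.pair_eq_pair.1 h).1) hc

/-- The level of the `n`-th node. -/
noncomputable def nodeLevel (n : ℕ) : ℕ := (Nat.nth (fun i => nodeTest i = true) n).unpair.1

/-- The code of the `n`-th node. -/
noncomputable def nodeCode (n : ℕ) : ℕ := (Nat.nth (fun i => nodeTest i = true) n).unpair.2

theorem nodeTest_nth (n : ℕ) : nodeTest (Nat.nth (fun i => nodeTest i = true) n) = true :=
  Nat.nth_mem_of_infinite infinite_nodeTest n

theorem isNode_nodeCode (n : ℕ) : IsNode (nodeCode n).testBit (nodeLevel n) :=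
  ((nodeTest_iff _).1 (nodeTest_nth n)).2

theorem computable_nodeLevel : Computable nodeLevel :=
  Computable.fst.comp (Computable.unpair.comp (Computable.nat_nth computable_nodeTest
    infinite_nodeTest))

theorem computable_nodeCode : Computable nodeCode :=
  Computable.snd.comp (Computable.unpair.comp (Computable.nat_nth computable_nodeTest
    infinite_nodeTest))

theorem eq_of_nodeCode {n m : ℕ} (hd : nodeLevel n = nodeLevel m)
    (h : ∀ e < nodeLevel n, (nodeCode n).testBit e = (nodeCode m).testBit e) : n = m := by
  have hn := ((nodeTest_iff _).1 (nodeTest_nth n)).1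
  have hm := ((nodeTest_iff _).1 (nodeTest_nth m)).1
  change nodeCode n < 2 ^ nodeLevel n at hn
  change nodeCode m < 2 ^ nodeLevel m at hm
  have hc : nodeCode n = nodeCode m := by
    refine Nat.eq_of_testBit_eq fun e => ?_
    rcases lt_or_ge e (nodeLevel n) with he | he
    · exact h e he
    · rw [Nat.testBit_lt_two_pow (hn.trans_le (Nat.pow_le_pow_right two_pos he)),
        Nat.testBit_lt_two_pow (hm.trans_le (Nat.pow_le_pow_right two_pos (hd ▸ he)))]
  apply Nat.nth_injective infinite_nodeTest
  rw [← Nat.pair_unpair (Nat.nth _ n), ← Nat.pair_unpair (Nat.nth _ m)]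
  exact congrArg₂ Nat.pair hd hc

/-- The left endpoints of the intervals of the tree. -/
noncomputable def treeLeft (n : ℕ) : ℚ := nodeLeft (nodeCode n).testBit (nodeLevel n)

/-- The right endpoints of the intervals of the tree. -/
noncomputable def treeRight (n : ℕ) : ℚ := nodeRight (nodeCode n).testBit (nodeLevel n)

theorem IsNode.exists_index {p : ℕ → Bool} {d : ℕ} (h : IsNode p d) :
    ∃ n, treeLeft n = nodeLeft p d ∧ treeRight n = nodeRight p d := by
  obtain ⟨c, hc, hb⟩ := h.exists_code
  obtain ⟨n, hn⟩ : Nat.pair d c ∈ range (Nat.nth fun i => nodeTest i = true) := by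
    rw [Nat.range_nth_of_infinite infinite_nodeTest]; exact hc
  have h1 : nodeLevel n = d := by rw [nodeLevel, hn, Nat.unpair_pair]
  have h2 : nodeCode n = c := by rw [nodeCode, hn, Nat.unpair_pair]
  exact ⟨n, by rw [treeLeft, h1, h2, nodeLeft_congr hb],
    by rw [treeRight, h1, h2, nodeRight_congr hb]⟩

theorem computableRat_cantorLeft {α : Type} [Primcodable α] {c d : α → ℕ} (hc : Computable c)
    (hd : Computable d) : ComputableRat fun a => cantorLeft (c a).testBit (d a) := by
  have h : ComputableRat fun i : α × ℕ =>
      if (c i.1).testBit i.2 = true then (2 : ℚ) / 3 ^ (i.2 + 1) else 0 :=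
    (ComputableRat.ite (Computable.testBit.comp ((hc.comp Computable.fst).pair Computable.snd))
      ((ComputableRat.const 2).div (ComputableRat.pow (Computable.succ.comp Computable.snd)))
      (ComputableRat.const 0))
  exact ComputableRat.sum hd h

theorem computableRat_three_pow {α : Type} [Primcodable α] (r : ℚ) {d : α → ℕ}
    (hd : Computable d) : ComputableRat fun a => r / 3 ^ (d a) :=
  (ComputableRat.const r).div (ComputableRat.pow hd)

theorem computableRat_treeLeft : ComputableRat treeLeft := by
  have h := computableRat_cantorLeft computable_nodeCode computable_nodeLevel
  exact (ComputableRat.ite (computable_dead.comp (computable_nodeLevel.pair computable_nodeCode)) h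
    (h.add (computableRat_three_pow 1 (Computable.succ.comp computable_nodeLevel)))).of_eq
      fun n => by simp [treeLeft, nodeLeft]

theorem computableRat_treeRight : ComputableRat treeRight := by
  have h := computableRat_cantorLeft computable_nodeCode computable_nodeLevel
  exact (ComputableRat.ite (computable_dead.comp (computable_nodeLevel.pair computable_nodeCode))
    (h.add (computableRat_three_pow 1 computable_nodeLevel))
    (h.add (computableRat_three_pow 2 (Computable.succ.comp computable_nodeLevel)))).of_eq
      fun n => by simp [treeRight, nodeRight, cantorRight]

theorem treeRight_le_treeLeft {n m : ℕ} (h : n ≠ m) :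
    treeRight n ≤ treeLeft m ∨ treeRight m ≤ treeLeft n :=
  (isNode_nodeCode n).nodeRight_le_nodeLeft (isNode_nodeCode m) fun h' =>
    h (eq_of_nodeCode h'.1 h'.2)

/-! ### The intervals cover the computable numbers -/

theorem mem_iUnion_of_dead {p : ℕ → Bool} {d : ℕ} (h : IsNode p d) (hD : Dead p d) {x : ℝ}
    (hx : x ∈ Icc (cantorLeft p d : ℝ) (cantorRight p d)) : x ∈ ⋃ n, J treeLeft treeRight n := by
  obtain ⟨n, h1, h2⟩ := h.exists_index
  rw [nodeLeft, if_pos hD] at h1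
  rw [nodeRight, if_pos hD] at h2
  exact mem_iUnion.2 ⟨n, by rw [J, h1, h2]; exact hx⟩

theorem mem_iUnion_of_not_dead {p : ℕ → Bool} {d : ℕ} (h : IsNode p d) (hD : ¬ Dead p d) {x : ℝ}
    (hx : x ∈ Icc ((cantorLeft p d + 1 / 3 ^ (d + 1) : ℚ) : ℝ)
      ((cantorLeft p d + 2 / 3 ^ (d + 1) : ℚ) : ℝ)) : x ∈ ⋃ n, J treeLeft treeRight n := by
  obtain ⟨n, h1, h2⟩ := h.exists_index
  rw [nodeLeft, if_neg hD] at h1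
  rw [nodeRight, if_neg hD] at h2
  exact mem_iUnion.2 ⟨n, by rw [J, h1, h2]; exact hx⟩

/-- The test whether a point with rational approximations `q`, in the Cantor interval of level `d`
with code `c`, lies in the right half of that interval. -/
def branchTest (q : ℕ → ℚ) (d c : ℕ) : Bool :=
  decide (cantorLeft c.testBit d + 1 / 2 * (1 / 3 ^ d) < q (2 * d + 4))

/-- The code of the initial segment of length `d` of the branch whose turn at level `d` is found by
applying the test `T d` to the code of the preceding segment. -/
def branchCode (T : ℕ → ℕ → Bool) (d : ℕ) : ℕ :=
  Nat.rec 0 (fun k c => 2 ^ k * (T k c).toNat + c) d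

/-- The turns of the branch described by `branchCode`. -/
def branchTurn (T : ℕ → ℕ → Bool) (d : ℕ) : Bool := T d (branchCode T d)

theorem branchCode_succ (T : ℕ → ℕ → Bool) (d : ℕ) :
    branchCode T (d + 1) = 2 ^ d * (branchTurn T d).toNat + branchCode T d := rfl

/-- Each turn is written as the next binary digit, which leaves the earlier digits unchanged. -/
theorem branchCode_spec (T : ℕ → ℕ → Bool) (d : ℕ) :
    branchCode T d < 2 ^ d ∧ ∀ e < d, (branchCode T d).testBit e = branchTurn T e := by
  induction d with
  | zero => exact ⟨by simp [branchCode], fun e he => absurd he e.not_lt_zero⟩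
  | succ d ih =>
    refine ⟨?_, fun e he => ?_⟩
    · rw [branchCode_succ, pow_succ]
      have := Bool.toNat_le (branchTurn T d)
      nlinarith [ih.1]
    · rw [branchCode_succ, Nat.testBit_two_pow_mul_add _ ih.1]
      split_ifs with h
      · exact ih.2 e h
      · have : e = d := by omega
        subst this
        rw [Nat.sub_self]
        cases branchTurn T e <;> rfl

theorem computable_branchTurn {T : ℕ → ℕ → Bool} (hT : Computable₂ T) :
    Computable (branchTurn T) := by
  have h : Computable fun i : ℕ × ℕ => T i.1 i.2 := hT
  have hn : Computable fun i : ℕ × ℕ => (T i.1 i.2).toNat :=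
    (h.ite_bool (Computable.const 1) (Computable.const 0)).of_eq fun i => by
      cases T i.1 i.2 <;> rfl
  have hs : Computable fun i : ℕ × ℕ × ℕ => 2 ^ i.2.1 * (T i.2.1 i.2.2).toNat + i.2.2 :=
    (((Computable.const 2).nat_pow' (Computable.fst.comp Computable.snd)).nat_mul'
      (hn.comp Computable.snd)).nat_add' (Computable.snd.comp Computable.snd)
  have hc : Computable (branchCode T) :=
    Computable.nat_rec (f := fun n : ℕ => n) (g := fun _ => 0)
      (h := fun (_ : ℕ) (i : ℕ × ℕ) => 2 ^ i.1 * (T i.1 i.2).toNat + i.2)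
      Computable.id (Computable.const 0) hs.to₂
  exact hT.comp Computable.id hc

theorem computable_branchTest {q : ℕ → ℚ} (hq : ComputableRat q) :
    Computable₂ (branchTest q) := by
  have hk : Computable fun i : ℕ × ℕ => 2 * i.1 + 4 :=
    ((Computable.const 2).nat_mul' Computable.fst).nat_add' (Computable.const 4)
  exact Computable.to₂ <| ((computableRat_cantorLeft Computable.snd Computable.fst).add
      ((ComputableRat.const (1 / 2)).mul (computableRat_three_pow 1 Computable.fst))).decide_lt
      (hq.comp hk)

/-- The approximation error stays below half the length of the middle third. Comparing the
approximation with the midpoint therefore gives the correct side whenever the real is outside the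
middle third. -/
theorem half_pow_lt_third_pow (d : ℕ) : (1 / 2 : ℝ) ^ (2 * d + 4) < 1 / 2 * (1 / 3 ^ (d + 1)) := by
  have h : (1 / 2 : ℝ) ^ (2 * d) ≤ (1 / 3) ^ d := by
    rw [pow_mul]; exact pow_le_pow_left₀ (by norm_num) (by norm_num) d
  have h' : (1 / 3 : ℝ) ^ d = 1 / 3 ^ d := by rw [one_div_pow]
  have : (0 : ℝ) < 1 / 3 ^ d := by positivity
  rw [pow_add, pow_succ 3 d, ← div_div]
  linarith

/-- An uncovered real only meets live nodes and avoids every middle third, so its approximations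
decide each turn. The resulting branch is computable and never dies, a contradiction. -/
theorem ComputableReal.mem_iUnion_J {x : ℝ} (hx : ComputableReal x) (hI : x ∈ Icc (0 : ℝ) 1) :
    x ∈ ⋃ n, J treeLeft treeRight n := by
  by_contra hU
  obtain ⟨q, hq, happ⟩ := hx
  have key : ∀ d, IsNode (branchTurn (branchTest q)) d ∧
      x ∈ Icc (cantorLeft (branchTurn (branchTest q)) d : ℝ)
        (cantorRight (branchTurn (branchTest q)) d) := by
    intro d
    induction d with
    | zero =>
      exact ⟨fun e he => absurd he e.not_lt_zero, by simpa [cantorLeft, cantorRight] using hI⟩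
    | succ d ih =>
      obtain ⟨hN, hm⟩ := ih
      have hD : ¬ Dead (branchTurn (branchTest q)) d := fun hD => hU (mem_iUnion_of_dead hN hD hm)
      refine ⟨fun e he hDe => hD (hDe.mono (Nat.le_of_lt_succ he)), ?_⟩
      have hM := fun h => hU (mem_iUnion_of_not_dead hN hD (x := x) h)
      have ha := abs_le.1 (happ (2 * d + 4))
      have hb := half_pow_lt_third_pow d
      have e1 : (1 : ℝ) / 3 ^ d = 3 * (1 / 3 ^ (d + 1)) := by rw [pow_succ]; field_simp
      have e2 : (2 : ℝ) / 3 ^ (d + 1) = 2 * (1 / 3 ^ (d + 1)) := by ring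
      have hpos : (0 : ℝ) < 1 / 3 ^ (d + 1) := by positivity
      -- The test sees only the code of the first `d` turns, but these determine the left endpoint.
      have hturn : branchTurn (branchTest q) d =
          decide (cantorLeft (branchTurn (branchTest q)) d + 1 / 2 * (1 / 3 ^ d) < q (2 * d + 4)) := by
        rw [← cantorLeft_congr (branchCode_spec (branchTest q) d).2]; rfl
      rw [mem_Icc] at hm hM ⊢
      simp only [cantorRight] at hm
      push_cast at hm hM
      rw [e2] at hM
      rw [e1] at hm
      rcases Bool.eq_false_or_eq_true (branchTurn (branchTest q) d) with hv | hv
      · have hv' := hv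
        rw [hturn, decide_eq_true_eq] at hv'
        have hv' : ((cantorLeft (branchTurn (branchTest q)) d + 1 / 2 * (1 / 3 ^ d) : ℚ) : ℝ) <
            (q (2 * d + 4) : ℝ) := by exact_mod_cast hv'
        push_cast at hv'
        rw [e1] at hv'
        rw [cantorLeft_succ_of_true hv, cantorRight_succ_of_true hv, cantorRight]
        push_cast
        rw [e1, e2]
        refine ⟨?_, hm.2⟩
        by_contra hlt
        exact hM ⟨by linarith, by linarith⟩
      · have hv' := hv
        rw [hturn, decide_eq_false_iff_not, not_lt] at hv'
        have hv' : (q (2 * d + 4) : ℝ) ≤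
            ((cantorLeft (branchTurn (branchTest q)) d + 1 / 2 * (1 / 3 ^ d) : ℚ) : ℝ) := by exact_mod_cast hv'
        push_cast at hv'
        rw [e1] at hv'
        rw [cantorLeft_succ_of_false hv, cantorRight_succ_of_false hv]
        push_cast
        refine ⟨hm.1, ?_⟩
        by_contra hlt
        exact hM ⟨by linarith, by linarith⟩
  obtain ⟨d, hd⟩ := exists_dead (computable_branchTurn (computable_branchTest hq))
  exact (key (d + 1)).1 d d.lt_succ_self hd

/-! ### The intervals do not cover the unit interval -/

/-- The witness is the point of the Cantor set on a branch that never dies. An interval containing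
it belongs to a node on this branch, since diverging branches have disjoint Cantor intervals. The
node is live, so the point lies in its middle third and in an outer third, and is a common endpoint
of both. This forces the branch to be eventually constant, hence computable, hence to die. -/
theorem exists_not_mem_iUnion_J : ∃ x ∈ Icc (0 : ℝ) 1, x ∉ ⋃ n, J treeLeft treeRight n := by
  obtain ⟨p, hp⟩ := exists_forall_not_dead
  have hle : ∀ d d', (cantorLeft p d : ℝ) ≤ cantorRight p d' := fun d d' => by
    have h1 := monotone_cantorLeft p (le_max_left d d')
    have h2 := antitone_cantorRight p (le_max_right d d')
    have h3 : cantorLeft p (max d d') ≤ cantorRight p (max d d') :=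
      le_add_of_nonneg_right (by positivity)
    exact_mod_cast h1.trans (h3.trans h2)
  have hbdd : BddAbove (range fun d => (cantorLeft p d : ℝ)) :=
    ⟨cantorRight p 0, by rintro _ ⟨d, rfl⟩; exact hle d 0⟩
  set x : ℝ := ⨆ d, (cantorLeft p d : ℝ) with hx
  have h1 : ∀ d, (cantorLeft p d : ℝ) ≤ x := fun d => le_ciSup hbdd d
  have h2 : ∀ d, x ≤ cantorRight p d := fun d => ciSup_le fun d' => hle d' d
  refine ⟨x, ⟨by simpa [cantorLeft] using h1 0, by simpa [cantorRight, cantorLeft] using h2 0⟩, ?_⟩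
  rw [mem_iUnion]
  rintro ⟨n, hn1, hn2⟩
  set q := (nodeCode n).testBit with hq
  set d := nodeLevel n with hd
  change (nodeLeft q d : ℝ) ≤ x at hn1
  change x ≤ (nodeRight q d : ℝ) at hn2
  by_cases hag : ∀ e < d, p e = q e
  · rw [← nodeLeft_congr hag, nodeLeft, if_neg (hp d)] at hn1
    rw [← nodeRight_congr hag, nodeRight, if_neg (hp d)] at hn2
    have hc : ∀ v w, (p d = v) → (∀ e, d < e → p e = w) → False := fun v w hv hw => by
      have : p = branch q d v w := funext fun e => by
        rcases lt_trichotomy e d with h | rfl | h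
        · rw [branch_of_lt h, hag e h]
        · rw [branch_self, hv]
        · rw [branch_of_gt h, hw e h]
      obtain ⟨d', hd'⟩ := exists_dead (this ▸ computable_branch (nodeCode n) d v w)
      exact hp d' hd'
    cases hv : p d
    -- After a left turn at `d` the point is the right end of the left third; any further left turn
    -- would push the right end below it.
    · refine hc _ true hv fun e he => ?_
      by_contra h
      have h3 := h2 (e + 1)
      rw [cantorRight_succ_of_false (by simpa using h)] at h3
      have h4 := antitone_cantorRight p (Nat.succ_le_of_lt he)
      rw [Nat.succ_eq_add_one, cantorRight_succ_of_false hv, cantorRight,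
        one_div_three_pow_succ e] at h4
      have h5 : (cantorLeft p d + 1 / 3 ^ (d + 1) : ℚ) ≤ cantorLeft p e + 1 / 3 ^ (e + 1) := by
        exact_mod_cast hn1.trans h3
      have : (0 : ℚ) < 1 / 3 ^ (e + 1) := by positivity
      linarith
    · refine hc _ false hv fun e he => ?_
      by_contra h
      have h3 := h1 (e + 1)
      rw [cantorLeft_succ_of_true (by simpa using h)] at h3
      have h4 := monotone_cantorLeft p (Nat.succ_le_of_lt he)
      rw [Nat.succ_eq_add_one, cantorLeft_succ_of_true hv] at h4
      have h5 : cantorLeft p e + 2 / 3 ^ (e + 1) ≤ (cantorLeft p d + 2 / 3 ^ (d + 1) : ℚ) := by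
        exact_mod_cast h3.trans hn2
      have : (0 : ℚ) < 2 / 3 ^ (e + 1) := by positivity
      linarith
  · push Not at hag
    have hs := Nat.find_spec hag
    have hm : ∀ i < Nat.find hag, p i = q i := fun i hi => by
      have := Nat.find_min hag hi
      push Not at this
      exact this (hi.trans hs.1)
    set e := Nat.find hag
    cases hpe : p e
    · have hqe : q e = true := by
        have := hs.2; rw [hpe] at this; exact Bool.eq_true_of_not_eq_false (Ne.symm this)
      have h3 := (cantorRight_lt_cantorLeft hm hpe hqe e.lt_succ_self hs.1).trans_le
        (cantorLeft_le_nodeLeft q d)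
      have h4 : (cantorRight p (e + 1) : ℝ) < nodeLeft q d := by exact_mod_cast h3
      linarith [h2 (e + 1)]
    · have hqe : q e = false := by
        have := hs.2; rw [hpe] at this; exact Bool.eq_false_of_not_eq_true (Ne.symm this)
      have h3 := (nodeRight_le_cantorRight q d).trans_lt (cantorRight_lt_cantorLeft
        (fun i hi => (hm i hi).symm) hqe hpe hs.1 e.lt_succ_self)
      have h4 : (nodeRight q d : ℝ) < cantorLeft p (e + 1) := by exact_mod_cast h3
      linarith [h1 (e + 1)]

theorem ComputableReal.of_affine {x : ℝ} {r s : ℚ} (hs : 0 < s)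
    (h : ComputableReal (r + s * x)) : ComputableReal x := by
  obtain ⟨q, hq, happ⟩ := h
  have hs' : (0 : ℝ) < s := by exact_mod_cast hs
  -- `K` extra digits of precision compensate for the division by `s`.
  obtain ⟨K, hK⟩ := exists_pow_lt_of_lt_one hs' (by norm_num : (1 / 2 : ℝ) < 1)
  refine ⟨fun n => (q (n + K) - r) / s,
    ((hq.comp (Computable.id.nat_add' (Computable.const K))).sub (ComputableRat.const r)).div
      (ComputableRat.const s), fun n => ?_⟩
  have e : (((q (n + K) - r) / s : ℚ) : ℝ) - x = (q (n + K) - (r + s * x)) / s := by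
    push_cast; field_simp; ring
  rw [e, abs_div, abs_of_pos hs', div_le_iff₀ hs']
  refine (happ (n + K)).trans ?_
  rw [pow_add]
  exact mul_le_mul_of_nonneg_left hK.le (by positivity)

theorem isIntervalSystem_tree : IsIntervalSystem treeLeft treeRight where
  computable_left := computableRat_treeLeft
  computable_right := computableRat_treeRight
  left_nonneg n := (cantorLeft_nonneg _ _).trans (cantorLeft_le_nodeLeft _ _)
  left_lt_right n := nodeLeft_lt_nodeRight _ _
  right_le_one n := (nodeRight_le_cantorRight _ _).trans (cantorRight_le_one _ _)
  inter n m h := by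
    rw [Set.encard_le_one_iff]
    rintro x y ⟨⟨h1, h2⟩, h3, h4⟩ ⟨⟨h1', h2'⟩, h3', h4'⟩
    rcases treeRight_le_treeLeft h with h | h
    · have h : (treeRight n : ℝ) ≤ treeLeft m := by exact_mod_cast h
      linarith
    · have h : (treeRight m : ℝ) ≤ treeLeft n := by exact_mod_cast h
      linarith
  left_mem n h := by
    obtain ⟨q, d, hq, e⟩ := (isNode_nodeCode n).exists_nodeRight_eq_nodeLeft h
    obtain ⟨m, -, hm⟩ := hq.exists_index
    exact ⟨m, hm.trans e⟩
  right_mem n h := by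
    obtain ⟨q, d, hq, e⟩ := (isNode_nodeCode n).exists_nodeLeft_eq_nodeRight h
    obtain ⟨m, hm, -⟩ := hq.exists_index
    exact ⟨m, hm.trans e⟩
  covers := by
    refine (Set.ssubset_iff_of_subset fun x hx => hx.2.mem_iUnion_J hx.1).2 ?_
    -- A non-computable covered real: the image of an uncovered one under the rational affine map of
    -- the unit interval onto `J_0`.
    obtain ⟨v, hv, hv'⟩ := exists_not_mem_iUnion_J
    have hlt : treeLeft 0 < treeRight 0 := nodeLeft_lt_nodeRight _ _
    have hlt' : (treeLeft 0 : ℝ) < treeRight 0 := by exact_mod_cast hlt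
    refine ⟨(treeLeft 0 : ℝ) + ((treeRight 0 - treeLeft 0 : ℚ) : ℝ) * v,
      mem_iUnion.2 ⟨0, ?_, ?_⟩, fun h =>
        hv' ((ComputableReal.of_affine (sub_pos.2 hlt) h.2).mem_iUnion_J hv)⟩
    · push_cast; nlinarith [hv.1]
    · push_cast; nlinarith [hv.2]
  not_all := by
    refine (Set.ssubset_iff_of_subset ?_).2 exists_not_mem_iUnion_J
    rintro x hx
    obtain ⟨n, h1, h2⟩ := mem_iUnion.1 hx
    have h3 : (0 : ℝ) ≤ treeLeft n := by
      exact_mod_cast (cantorLeft_nonneg _ _).trans (cantorLeft_le_nodeLeft _ _)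
    have h4 : (treeRight n : ℝ) ≤ 1 := by
      exact_mod_cast (nodeRight_le_cantorRight _ _).trans (cantorRight_le_one _ _)
    exact ⟨h3.trans h1, h2.trans h4⟩

/-! ### The depth of a point in the union of the first intervals -/

/-- The points of `I` outside `J_0, …, J_n`. -/
def uncovered (a b : ℕ → ℚ) (n : ℕ) : Set ℝ := {x | x ∈ Icc (0 : ℝ) 1 ∧ ∀ k ≤ n, x ∉ J a b k}

/-- The distance to the points of `I` outside `J_0, …, J_n`. -/
noncomputable def depth (a b : ℕ → ℚ) (n : ℕ) (x : ℝ) : ℝ := Metric.infDist x (uncovered a b n)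

/-- The right endpoint of `J_k` is not an endpoint of another of the intervals `J_0, …, J_n`. -/
def IsRightEdge (a b : ℕ → ℚ) (n k : ℕ) : Prop := b k ≠ 1 ∧ ∀ j ≤ n, a j ≠ b k

/-- The left endpoint of `J_k` is not an endpoint of another of the intervals `J_0, …, J_n`. -/
def IsLeftEdge (a b : ℕ → ℚ) (n k : ℕ) : Prop := a k ≠ 0 ∧ ∀ j ≤ n, b j ≠ a k

/-- The endpoints of `J_0 ∪ … ∪ J_n` inside the open unit interval. -/
def edges (a b : ℕ → ℚ) (n : ℕ) : Set ℚ :=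
  {e | ∃ k ≤ n, e = b k ∧ IsRightEdge a b n k ∨ e = a k ∧ IsLeftEdge a b n k}

section Depth

variable {a b : ℕ → ℚ}

theorem uncovered_anti {n m : ℕ} (h : n ≤ m) : uncovered a b m ⊆ uncovered a b n :=
  fun _ hx => ⟨hx.1, fun k hk => hx.2 k (hk.trans h)⟩

theorem depth_nonneg (n : ℕ) (x : ℝ) : 0 ≤ depth a b n x := Metric.infDist_nonneg

theorem depth_le_add (n : ℕ) (x y : ℝ) : depth a b n x ≤ depth a b n y + |x - y| :=
  Metric.infDist_le_infDist_add_dist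

theorem depth_eq_zero {n : ℕ} {x : ℝ} (hx : x ∈ closure (uncovered a b n)) : depth a b n x = 0 := by
  rw [depth, ← Metric.infDist_closure]; exact Metric.infDist_zero_of_mem hx

theorem finite_edges (n : ℕ) : (edges a b n).Finite := by
  refine (((finite_Iic n).image b).union ((finite_Iic n).image a)).subset ?_
  rintro e ⟨k, hk, ⟨rfl, -⟩ | ⟨rfl, -⟩⟩
  · exact Or.inl (mem_image_of_mem b hk)
  · exact Or.inr (mem_image_of_mem a hk)

namespace IsIntervalSystem

variable (h : IsIntervalSystem a b)
include h

theorem uncovered_nonempty (n : ℕ) : (uncovered a b n).Nonempty := by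
  obtain ⟨x, hx, hx'⟩ := Set.exists_of_ssubset h.not_all
  exact ⟨x, hx, fun k _ hk => hx' (mem_iUnion.2 ⟨k, hk⟩)⟩

theorem depth_mono {n m : ℕ} (hn : n ≤ m) (x : ℝ) : depth a b n x ≤ depth a b m x :=
  Metric.infDist_le_infDist_of_subset (uncovered_anti hn) (h.uncovered_nonempty m)

/-- Otherwise the larger left endpoint and the smaller right endpoint would be two distinct common
points. -/
theorem right_le_left {n m : ℕ} (hnm : n ≠ m) : b n ≤ a m ∨ b m ≤ a n := by
  by_contra! hc
  have h1 : max (a n) (a m) < min (b n) (b m) :=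
    max_lt (lt_min (h.left_lt_right n) hc.2) (lt_min hc.1 (h.left_lt_right m))
  have hmem : ∀ x : ℚ, max (a n) (a m) ≤ x → x ≤ min (b n) (b m) →
      (x : ℝ) ∈ J a b n ∩ J a b m := fun x h1 h2 =>
    ⟨⟨by exact_mod_cast (le_max_left _ _).trans h1, by exact_mod_cast h2.trans (min_le_left _ _)⟩,
      by exact_mod_cast (le_max_right _ _).trans h1, by exact_mod_cast h2.trans (min_le_right _ _)⟩
  have := Set.encard_le_one_iff.1 (h.inter n m hnm) _ _ (hmem _ le_rfl h1.le) (hmem _ h1.le le_rfl)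
  exact h1.ne (by exact_mod_cast this)

theorem edge_mem_Ioo {n : ℕ} {e : ℚ} (he : e ∈ edges a b n) : (e : ℝ) ∈ Ioo (0 : ℝ) 1 := by
  obtain ⟨k, -, ⟨rfl, h1, -⟩ | ⟨rfl, h1, -⟩⟩ := he
  · exact ⟨by exact_mod_cast (h.left_nonneg k).trans_lt (h.left_lt_right k),
      by exact_mod_cast lt_of_le_of_ne (h.right_le_one k) h1⟩
  · exact ⟨by exact_mod_cast lt_of_le_of_ne (h.left_nonneg k) h1.symm,
      by exact_mod_cast (h.left_lt_right k).trans_le (h.right_le_one k)⟩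

theorem edge_mem_J {n : ℕ} {e : ℚ} (he : e ∈ edges a b n) : ∃ k ≤ n, (e : ℝ) ∈ J a b k := by
  obtain ⟨k, hk, ⟨rfl, -⟩ | ⟨rfl, -⟩⟩ := he
  · exact ⟨k, hk, by exact_mod_cast (h.left_lt_right k).le, le_rfl⟩
  · exact ⟨k, hk, le_rfl, by exact_mod_cast (h.left_lt_right k).le⟩

/-- Just beyond an unshared endpoint each of the finitely many intervals is absent: those on the far
side start at a positive distance. -/
theorem edge_mem_closure {n : ℕ} {e : ℚ} (he : e ∈ edges a b n) :
    (e : ℝ) ∈ closure (uncovered a b n) := by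
  have hI := h.edge_mem_Ioo he
  obtain ⟨k, hk, ⟨rfl, h1, h2⟩ | ⟨rfl, h1, h2⟩⟩ := he
  · have hev : ∀ j ∈ Iic n, ∀ᶠ x in 𝓝[>] (b k : ℝ), x ∉ J a b j := by
      intro j hj
      rcases le_or_gt (b j) (b k) with hjk | hjk
      · filter_upwards [self_mem_nhdsWithin] with x hx hxJ
        exact absurd (hxJ.2.trans (by exact_mod_cast hjk)) (not_le.2 hx)
      · have hlt : b k < a j := by
          rcases h.right_le_left (n := j) (m := k) (fun e => hjk.ne (by rw [e])) with h3 | h3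
          · exact absurd (h3.trans (h.left_lt_right k).le) (not_le.2 hjk)
          · exact lt_of_le_of_ne h3 (h2 j hj).symm
        have hlt' : (b k : ℝ) < a j := by exact_mod_cast hlt
        filter_upwards [nhdsWithin_le_nhds (Iio_mem_nhds hlt')] with x hx hxJ
        exact absurd hxJ.1 (not_le.2 hx)
    have hall := (eventually_all_finite (finite_Iic n)).2 hev
    have hev' : ∀ᶠ x in 𝓝[>] (b k : ℝ), x ∈ uncovered a b n := by
      filter_upwards [hall, nhdsWithin_le_nhds (Ioo_mem_nhds hI.1 hI.2)] with x hx hx'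
      exact ⟨Ioo_subset_Icc_self hx', hx⟩
    exact mem_closure_iff_frequently.2 (hev'.frequently.filter_mono nhdsWithin_le_nhds)
  · have hev : ∀ j ∈ Iic n, ∀ᶠ x in 𝓝[<] (a k : ℝ), x ∉ J a b j := by
      intro j hj
      rcases le_or_gt (a k) (a j) with hjk | hjk
      · filter_upwards [self_mem_nhdsWithin] with x hx hxJ
        have : (a k : ℝ) ≤ a j := by exact_mod_cast hjk
        exact absurd (this.trans hxJ.1) (not_le.2 hx)
      · have hlt : b j < a k := by
          rcases h.right_le_left (n := j) (m := k) (fun e => hjk.ne (by rw [e])) with h3 | h3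
          · exact lt_of_le_of_ne h3 (h2 j hj)
          · exact absurd ((h.left_lt_right k).le.trans h3) (not_le.2 hjk)
        have hlt' : (b j : ℝ) < a k := by exact_mod_cast hlt
        filter_upwards [nhdsWithin_le_nhds (Ioi_mem_nhds hlt')] with x hx hxJ
        exact absurd hxJ.2 (not_le.2 hx)
    have hall := (eventually_all_finite (finite_Iic n)).2 hev
    have hev' : ∀ᶠ x in 𝓝[<] (a k : ℝ), x ∈ uncovered a b n := by
      filter_upwards [hall, nhdsWithin_le_nhds (Ioo_mem_nhds hI.1 hI.2)] with x hx hx'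
      exact ⟨Ioo_subset_Icc_self hx', hx⟩
    exact mem_closure_iff_frequently.2 (hev'.frequently.filter_mono nhdsWithin_le_nhds)

/-- Take the last right endpoint between `x` and `z`. An interval starting there would either end
later before `z`, against maximality, or contain `z`. -/
theorem exists_isRightEdge {n k₀ : ℕ} {x z : ℝ} (hk₀ : k₀ ≤ n) (hx : x ∈ J a b k₀)
    (hz : z ∈ uncovered a b n) (hxz : x < z) :
    ∃ k ≤ n, IsRightEdge a b n k ∧ x ≤ b k ∧ (b k : ℝ) < z := by
  have h0 : (b k₀ : ℝ) < z := by
    by_contra hc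
    exact hz.2 k₀ hk₀ ⟨hx.1.trans hxz.le, not_lt.1 hc⟩
  obtain ⟨k, ⟨hk, h1, h2⟩, hmax⟩ := Set.exists_max_image
    {k | k ≤ n ∧ x ≤ b k ∧ (b k : ℝ) < z} b ((finite_Iic n).subset fun k hk => hk.1)
    ⟨k₀, hk₀, hx.2, h0⟩
  refine ⟨k, hk, ⟨fun e => ?_, fun j hj e => ?_⟩, h1, h2⟩
  · rw [e, Rat.cast_one] at h2
    exact absurd hz.1.2 (not_le.2 h2)
  · have hlt : b k < b j := e ▸ h.left_lt_right j
    by_cases hjz : (b j : ℝ) < z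
    · exact absurd (hmax j ⟨hj, h1.trans (by exact_mod_cast hlt.le), hjz⟩) (not_le.2 hlt)
    · exact hz.2 j hj ⟨by rw [e]; exact h2.le, not_lt.1 hjz⟩

theorem exists_isLeftEdge {n k₀ : ℕ} {x z : ℝ} (hk₀ : k₀ ≤ n) (hx : x ∈ J a b k₀)
    (hz : z ∈ uncovered a b n) (hxz : z < x) :
    ∃ k ≤ n, IsLeftEdge a b n k ∧ (a k : ℝ) ≤ x ∧ z < (a k : ℝ) := by
  have h0 : z < (a k₀ : ℝ) := by
    by_contra hc
    exact hz.2 k₀ hk₀ ⟨not_lt.1 hc, hxz.le.trans hx.2⟩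
  obtain ⟨k, ⟨hk, h1, h2⟩, hmin⟩ := Set.exists_min_image
    {k | k ≤ n ∧ (a k : ℝ) ≤ x ∧ z < (a k : ℝ)} a ((finite_Iic n).subset fun k hk => hk.1)
    ⟨k₀, hk₀, hx.1, h0⟩
  refine ⟨k, hk, ⟨fun e => ?_, fun j hj e => ?_⟩, h1, h2⟩
  · rw [e, Rat.cast_zero] at h2
    exact absurd hz.1.1 (not_le.2 h2)
  · have hlt : a j < a k := e ▸ h.left_lt_right j
    by_cases hjz : z < (a j : ℝ)
    · exact absurd (hmin j ⟨hj, le_trans (by exact_mod_cast hlt.le) h1, hjz⟩) (not_le.2 hlt)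
    · exact hz.2 j hj ⟨not_lt.1 hjz, by rw [e]; exact h2.le⟩

theorem exists_edge_le {n k₀ : ℕ} {x z : ℝ} (hk₀ : k₀ ≤ n) (hx : x ∈ J a b k₀)
    (hz : z ∈ uncovered a b n) : ∃ e ∈ edges a b n, |x - e| ≤ |x - z| := by
  rcases lt_trichotomy x z with hxz | rfl | hxz
  · obtain ⟨k, hk, hE, h1, h2⟩ := h.exists_isRightEdge hk₀ hx hz hxz
    refine ⟨b k, ⟨k, hk, Or.inl ⟨rfl, hE⟩⟩, ?_⟩
    rw [abs_of_nonpos (by linarith), abs_of_nonpos (by linarith)]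
    linarith
  · exact absurd hx (hz.2 k₀ hk₀)
  · obtain ⟨k, hk, hE, h1, h2⟩ := h.exists_isLeftEdge hk₀ hx hz hxz
    refine ⟨a k, ⟨k, hk, Or.inr ⟨rfl, hE⟩⟩, ?_⟩
    rw [abs_of_nonneg (by linarith), abs_of_nonneg (by linarith)]
    linarith

theorem depth_le_of_edge {n : ℕ} (x : ℝ) {e : ℚ} (he : e ∈ edges a b n) :
    depth a b n x ≤ |x - e| := by
  have := depth_le_add (a := a) (b := b) n x e
  rwa [depth_eq_zero (h.edge_mem_closure he), zero_add] at this

/-- Any path from a covered point to an uncovered one crosses an edge, so the depth is a minimum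
over a finite set of rationals. This makes it computable at rational points. -/
theorem exists_edge {n k₀ : ℕ} {x : ℝ} (hk₀ : k₀ ≤ n) (hx : x ∈ J a b k₀) :
    ∃ e ∈ edges a b n, depth a b n x = |x - e| := by
  obtain ⟨z, hz⟩ := h.uncovered_nonempty n
  obtain ⟨e', he', -⟩ := h.exists_edge_le hk₀ hx hz
  obtain ⟨e, he, hmin⟩ := Set.exists_min_image (edges a b n) (fun e : ℚ => |x - e|)
    (finite_edges n) ⟨e', he'⟩
  refine ⟨e, he, le_antisymm (h.depth_le_of_edge x he) ?_⟩
  refine (Metric.le_infDist ⟨z, hz⟩).2 fun w hw => ?_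
  obtain ⟨e'', he'', hle⟩ := h.exists_edge_le hk₀ hx hw
  exact (hmin e'' he'').trans hle

/-- Here the sharing of endpoints is essential: it puts every covered point into the interior,
relative to the unit interval, of a finite union of the intervals. -/
theorem exists_depth_pos {x : ℝ} (hx : x ∈ ⋃ n, J a b n) : ∃ n, 0 < depth a b n x := by
  obtain ⟨k, hk1, hk2⟩ := mem_iUnion.1 hx
  -- The left side of `x` is covered by `J_k` or, if `x` is its left end, by the interval ending
  -- there; at `0` nothing has to be covered and any `α < x` serves.
  have hl : ∃ α < x, ∃ n, ∀ y, α < y → y ≤ x → y ∈ Icc (0 : ℝ) 1 → ∃ j ≤ n, y ∈ J a b j := by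
    rcases hk1.lt_or_eq with h1 | h1
    · exact ⟨_, h1, k, fun y hy hy' _ => ⟨k, le_rfl, hy.le, hy'.trans hk2⟩⟩
    · by_cases h0 : a k = 0
      · rw [h0, Rat.cast_zero] at h1
        refine ⟨x - 1, by linarith, k, fun y hy hy' hyI => ⟨k, le_rfl, ?_, hy'.trans hk2⟩⟩
        rw [h0, Rat.cast_zero]; exact hyI.1
      · obtain ⟨j, hj⟩ := h.left_mem k h0
        rw [← hj] at h1
        have : (a j : ℝ) < b j := by exact_mod_cast h.left_lt_right j
        exact ⟨a j, this.trans_eq h1, j, fun y hy hy' _ => ⟨j, le_rfl, hy.le, hy'.trans_eq h1.symm⟩⟩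
  have hr : ∃ β > x, ∃ n, ∀ y, y < β → x ≤ y → y ∈ Icc (0 : ℝ) 1 → ∃ j ≤ n, y ∈ J a b j := by
    rcases hk2.lt_or_eq with h1 | h1
    · exact ⟨_, h1, k, fun y hy hy' _ => ⟨k, le_rfl, hk1.trans hy', hy.le⟩⟩
    · by_cases h0 : b k = 1
      · rw [h0, Rat.cast_one] at h1
        refine ⟨x + 1, by linarith, k, fun y hy hy' hyI => ⟨k, le_rfl, hk1.trans hy', ?_⟩⟩
        rw [h0, Rat.cast_one]; exact hyI.2
      · obtain ⟨j, hj⟩ := h.right_mem k h0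
        rw [← hj] at h1
        have : (a j : ℝ) < b j := by exact_mod_cast h.left_lt_right j
        exact ⟨b j, h1.trans_lt this, j, fun y hy hy' _ => ⟨j, le_rfl, h1.symm.le.trans hy', hy.le⟩⟩
  obtain ⟨α, hα, n₁, h1⟩ := hl
  obtain ⟨β, hβ, n₂, h2⟩ := hr
  have hpos : x ∉ closure (uncovered a b (max n₁ n₂)) → 0 < depth a b (max n₁ n₂) x :=
    (Metric.infDist_pos_iff_notMem_closure (h.uncovered_nonempty _)).1
  refine ⟨max n₁ n₂, hpos fun hc => ?_⟩
  obtain ⟨y, ⟨hy1, hy2⟩, hyI, hy⟩ := mem_closure_iff_nhds.1 hc _ (Ioo_mem_nhds hα hβ)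
  rcases le_total y x with hyx | hyx
  · obtain ⟨j, hj, hyJ⟩ := h1 y hy1 hyx hyI
    exact hy j (hj.trans (le_max_left _ _)) hyJ
  · obtain ⟨j, hj, hyJ⟩ := h2 y hy2 hyx hyI
    exact hy j (hj.trans (le_max_right _ _)) hyJ

/-! ### The target coordinates -/

omit h in
theorem targetCoord_eq (n : ℕ) : targetCoord a b n = sInf (uncovered a b n) := by
  have hd : ∀ (x : ℝ) (hx : x ∈ Icc (0 : ℝ) 1) (i : Fin 2), (diag ⟨x, hx⟩).1 i = x :=
    fun x hx i => by fin_cases i <;> rfl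
  rw [targetCoord]
  congr 1
  ext x
  refine ⟨fun ⟨hx, hC⟩ => ⟨hx, fun k hk hxJ => hC ⟨k, hk, k, hk, ?_, ?_⟩⟩,
    fun ⟨hx, hC⟩ => ⟨hx, ?_⟩⟩
  · rwa [hd]
  · rwa [hd]
  · rintro ⟨k, hk, -, -, hxJ, -⟩
    rw [hd] at hxJ
    exact hC k hk hxJ

omit h in
theorem bddBelow_uncovered (n : ℕ) : BddBelow (uncovered a b n) := ⟨0, fun _ hx => hx.1.1⟩

theorem targetCoord_mem_closure (n : ℕ) : targetCoord a b n ∈ closure (uncovered a b n) := by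
  rw [targetCoord_eq]
  exact csInf_mem_closure (h.uncovered_nonempty n) (bddBelow_uncovered n)

theorem depth_targetCoord (n : ℕ) : depth a b n (targetCoord a b n) = 0 :=
  depth_eq_zero (h.targetCoord_mem_closure n)

theorem targetCoord_mem_Icc (n : ℕ) : targetCoord a b n ∈ Icc (0 : ℝ) 1 :=
  closure_minimal (fun _ hx => hx.1) isClosed_Icc (h.targetCoord_mem_closure n)

theorem monotone_targetCoord : Monotone (targetCoord a b) := fun n m hnm => by
  rw [targetCoord_eq, targetCoord_eq]
  exact csInf_le_csInf (bddBelow_uncovered n) (h.uncovered_nonempty m) (uncovered_anti hnm)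

/-- If the limit were covered, its depth would be positive at some stage and remain so. But `v_n`
has depth zero at stage `n`, depth is 1-Lipschitz, and `v_n` comes arbitrarily close. -/
theorem exists_tendsto_targetCoord : ∃ v ∈ Icc (0 : ℝ) 1, Tendsto (targetCoord a b) atTop (𝓝 v) ∧
    v ∉ ⋃ n, J a b n := by
  have ht := tendsto_atTop_ciSup h.monotone_targetCoord
    ⟨1, by rintro _ ⟨n, rfl⟩; exact (h.targetCoord_mem_Icc n).2⟩
  refine ⟨_, isClosed_Icc.mem_of_tendsto ht (Eventually.of_forall h.targetCoord_mem_Icc), ht,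
    fun hv => ?_⟩
  obtain ⟨n, hn⟩ := h.exists_depth_pos hv
  obtain ⟨N, hN⟩ := Metric.tendsto_atTop.1 ht _ hn
  have h1 := hN _ (le_max_right n N)
  have h2 := depth_le_add (a := a) (b := b) (max n N) (⨆ i, targetCoord a b i)
    (targetCoord a b (max n N))
  rw [h.depth_targetCoord, zero_add, abs_sub_comm] at h2
  exact absurd (h2.trans_lt h1) (not_lt.2 (h.depth_mono (le_max_left n N) _))

end IsIntervalSystem

end Depth

/-! ### Points of the square -/

section Square

theorem Square.dist_eq (p q : Square) :
    dist p q = Real.sqrt (|p.1 0 - q.1 0| ^ 2 + |p.1 1 - q.1 1| ^ 2) := by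
  rw [Subtype.dist_eq, EuclideanSpace.dist_eq]
  simp [Fin.sum_univ_two, Real.dist_eq]

theorem Square.abs_sub_le_dist (p q : Square) (i : Fin 2) : |p.1 i - q.1 i| ≤ dist p q := by
  rw [Square.dist_eq]
  apply Real.le_sqrt_of_sq_le
  fin_cases i
  · exact le_add_of_nonneg_right (by positivity)
  · exact le_add_of_nonneg_left (by positivity)

theorem Square.dist_le (p q : Square) :
    dist p q ≤ |p.1 0 - q.1 0| + |p.1 1 - q.1 1| := by
  rw [Square.dist_eq]
  refine Real.sqrt_le_iff.2 ⟨by positivity, ?_⟩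
  nlinarith [abs_nonneg (p.1 0 - q.1 0), abs_nonneg (p.1 1 - q.1 1)]

theorem Square.ext_coord {p q : Square} (h : ∀ i, p.1 i = q.1 i) : p = q :=
  Subtype.ext (PiLp.ext h)

/-- The point of the square with given coordinates. -/
def Square.ofFun (g : Fin 2 → ℝ) (hg : ∀ i, g i ∈ Icc (0 : ℝ) 1) : Square :=
  ⟨WithLp.toLp 2 g, hg⟩

/-- The point of the square with `i`-th coordinate `x` and the other coordinate `y`. -/
def Square.cons (i : Fin 2) {x y : ℝ} (hx : x ∈ Icc (0 : ℝ) 1) (hy : y ∈ Icc (0 : ℝ) 1) : Square :=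
  Square.ofFun (fun j => if j = i then x else y) fun j => by split_ifs <;> assumption

variable {i : Fin 2} {x y : ℝ} (hx : x ∈ Icc (0 : ℝ) 1) (hy : y ∈ Icc (0 : ℝ) 1)

theorem Square.cons_self : (Square.cons i hx hy).1 i = x := if_pos rfl

theorem Square.cons_rev : (Square.cons i hx hy).1 i.rev = y :=
  if_neg (by fin_cases i <;> decide)

theorem Square.forall_coord {P : Fin 2 → Prop} (i : Fin 2) : (∀ j, P j) ↔ P i ∧ P i.rev := by
  fin_cases i <;> simp [Fin.forall_fin_two, and_comm]

theorem Square.dist_cons_le (p : Square) :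
    dist p (Square.cons i hx hy) ≤ |p.1 i - x| + |p.1 i.rev - y| := by
  have h := Square.dist_le p (Square.cons i hx hy)
  have h1 : (Square.cons i hx hy).1 i = x := Square.cons_self hx hy
  have h2 : (Square.cons i hx hy).1 i.rev = y := Square.cons_rev hx hy
  have h3 : |p.1 0 - (Square.cons i hx hy).1 0| + |p.1 1 - (Square.cons i hx hy).1 1| =
      |p.1 i - (Square.cons i hx hy).1 i| + |p.1 i.rev - (Square.cons i hx hy).1 i.rev| := by
    generalize Square.cons i hx hy = q
    fin_cases i
    · rfl
    · exact add_comm _ _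
  rwa [h3, h1, h2] at h

theorem Square.notMem_frontier {p : Square} (hp : ∀ i, p.1 i ∈ Ioo (0 : ℝ) 1) :
    (p : Plane) ∉ frontier unitSquare := by
  have ho : IsOpen {p : Plane | ∀ i, p i ∈ Ioo (0 : ℝ) 1} := by
    simp only [ofPred_forall]
    exact isOpen_iInter_of_finite fun i => isOpen_Ioo.preimage (by fun_prop)
  have hs : {p : Plane | ∀ i, p i ∈ Ioo (0 : ℝ) 1} ⊆ interior unitSquare :=
    interior_maximal (fun p hp i => Ioo_subset_Icc_self (hp i)) ho
  exact fun h => h.2 (hs hp)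

end Square

/-! ### Depth in the sets `C_n` -/

/-- The smaller one of the depths of the coordinates. -/
noncomputable def rectDepth (a b : ℕ → ℚ) (n : ℕ) (p : Square) : ℝ :=
  min (depth a b n (p.1 0)) (depth a b n (p.1 1))

section RectDepth

variable {a b : ℕ → ℚ}

theorem rectDepth_le (n : ℕ) (p : Square) (i : Fin 2) :
    rectDepth a b n p ≤ depth a b n (p.1 i) := by
  fin_cases i
  · exact min_le_left _ _
  · exact min_le_right _ _

theorem exists_rectDepth_eq (n : ℕ) (p : Square) :
    ∃ i, rectDepth a b n p = depth a b n (p.1 i) := by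
  rcases min_choice (depth a b n (p.1 0)) (depth a b n (p.1 1)) with h | h
  · exact ⟨0, h⟩
  · exact ⟨1, h⟩

theorem rectDepth_nonneg (n : ℕ) (p : Square) : 0 ≤ rectDepth a b n p :=
  le_min (depth_nonneg _ _) (depth_nonneg _ _)

theorem rectDepth_le_add_dist (n : ℕ) (p q : Square) :
    rectDepth a b n p ≤ rectDepth a b n q + dist p q := by
  obtain ⟨i, hi⟩ := exists_rectDepth_eq (a := a) (b := b) n q
  rw [hi]
  exact (rectDepth_le n p i).trans ((depth_le_add n _ _).trans
    (add_le_add_right (Square.abs_sub_le_dist p q i) _))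

theorem mem_C_iff {n : ℕ} {p : Square} : p ∈ C a b n ↔ ∀ i, ∃ k ≤ n, p.1 i ∈ J a b k := by
  rw [Fin.forall_fin_two]
  exact ⟨fun ⟨k, hk, l, hl, h0, h1⟩ => ⟨⟨k, hk, h0⟩, l, hl, h1⟩,
    fun ⟨⟨k, hk, h0⟩, l, hl, h1⟩ => ⟨k, hk, l, hl, h0, h1⟩⟩

theorem mem_C_of_rectDepth_pos {n : ℕ} {p : Square} (hp : 0 < rectDepth a b n p) : p ∈ C a b n := by
  refine mem_C_iff.2 fun i => ?_
  by_contra! hc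
  have := (hp.trans_le (rectDepth_le n p i)).ne'
  exact this (depth_eq_zero (subset_closure ⟨p.2 i, hc⟩))

namespace IsIntervalSystem

variable (h : IsIntervalSystem a b)
include h

theorem rectDepth_mono {n m : ℕ} (hn : n ≤ m) (p : Square) :
    rectDepth a b n p ≤ rectDepth a b m p :=
  min_le_min (h.depth_mono hn _) (h.depth_mono hn _)

omit h in
theorem rectDepth_eq_zero_of_mem_frontier {n : ℕ} {p : Square} (hp : p ∈ frontier (C a b n)) :
    rectDepth a b n p = 0 := by
  by_contra hne
  have hpos : 0 < rectDepth a b n p := lt_of_le_of_ne (rectDepth_nonneg n p) (Ne.symm hne)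
  refine hp.2 (mem_interior_iff_mem_nhds.2 (Metric.mem_nhds_iff.2 ⟨_, hpos, fun q hq => ?_⟩))
  apply mem_C_of_rectDepth_pos
  have := rectDepth_le_add_dist (a := a) (b := b) n p q
  rw [Metric.mem_ball, dist_comm] at hq
  linarith

/-- Moving coordinate `i` to the edge `e` reaches the boundary of `C_n`. The other coordinate is
nudged by less than `ε` into the open interval, so that the point is not on the boundary of the
square. -/
theorem exists_mem_innerBoundary {n : ℕ} {p : Square} (hp : p ∈ C a b n) (i : Fin 2) {e : ℚ}
    (he : e ∈ edges a b n) {ε : ℝ} (hε : 0 < ε) :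
    ∃ q ∈ innerBoundary (C a b n), dist p q < |p.1 i - e| + ε := by
  obtain ⟨l, hl, hpl⟩ := mem_C_iff.1 hp i.rev
  have hI := h.edge_mem_Ioo he
  have hlt : (a l : ℝ) < b l := by exact_mod_cast h.left_lt_right l
  have hcl : p.1 i.rev ∈ closure (Ioo (a l : ℝ) (b l)) := by rw [closure_Ioo hlt.ne]; exact hpl
  obtain ⟨y, hy, hpy⟩ := Metric.mem_closure_iff.1 hcl ε hε
  have hyJ : y ∈ J a b l := Ioo_subset_Icc_self hy
  have hy01 : y ∈ Ioo (0 : ℝ) 1 := by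
    have h1 : (0 : ℝ) ≤ a l := by exact_mod_cast h.left_nonneg l
    have h2 : (b l : ℝ) ≤ 1 := by exact_mod_cast h.right_le_one l
    exact ⟨h1.trans_lt hy.1, hy.2.trans_le h2⟩
  refine ⟨Square.cons i (Ioo_subset_Icc_self hI) (Ioo_subset_Icc_self hy01), ⟨⟨?_, fun hint => ?_⟩,
    Square.notMem_frontier ?_⟩, ?_⟩
  · refine subset_closure (mem_C_iff.2 ((Square.forall_coord i).2 ⟨?_, l, hl, ?_⟩))
    · rw [Square.cons_self]; exact h.edge_mem_J he
    · rw [Square.cons_rev]; exact hyJ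
  · obtain ⟨δ, hδ, hball⟩ := Metric.mem_nhds_iff.1 (mem_interior_iff_mem_nhds.1 hint)
    obtain ⟨z, hz, hez⟩ := Metric.mem_closure_iff.1 (h.edge_mem_closure he) δ hδ
    have hmem : Square.cons i hz.1 (Ioo_subset_Icc_self hy01) ∈ C a b n := by
      apply hball
      rw [Metric.mem_ball, dist_comm]
      refine (Square.dist_cons_le _ _ _).trans_lt ?_
      rw [Square.cons_self, Square.cons_rev, sub_self, abs_zero, add_zero]
      exact hez
    obtain ⟨k, hk, hzk⟩ := mem_C_iff.1 hmem i
    rw [Square.cons_self] at hzk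
    exact hz.2 k hk hzk
  · refine (Square.forall_coord i).2 ⟨?_, ?_⟩
    · rw [Square.cons_self]; exact hI
    · rw [Square.cons_rev]; exact hy01
  · refine (Square.dist_cons_le _ _ _).trans_lt ?_
    rw [Real.dist_eq] at hpy
    linarith

/-- The boundary consists of axis-parallel pieces, so moving one coordinate to its nearest edge is
optimal; the converse bound holds because `rectDepth` is 1-Lipschitz and vanishes on the boundary.
-/
theorem infDist_innerBoundary {n : ℕ} {p : Square} (hp : p ∈ C a b n) :
    Metric.infDist p (innerBoundary (C a b n)) = rectDepth a b n p := by
  have hedge : ∀ i, ∃ e ∈ edges a b n, depth a b n (p.1 i) = |p.1 i - e| := fun i => by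
    obtain ⟨k, hk, hpk⟩ := mem_C_iff.1 hp i
    exact h.exists_edge hk hpk
  apply le_antisymm
  · obtain ⟨i, hi⟩ := exists_rectDepth_eq (a := a) (b := b) n p
    obtain ⟨e, he, hd⟩ := hedge i
    rw [hi, hd]
    refine le_of_forall_pos_le_add fun ε hε => ?_
    obtain ⟨q, hq, hpq⟩ := h.exists_mem_innerBoundary hp i he hε
    exact (Metric.infDist_le_dist_of_mem hq).trans hpq.le
  · obtain ⟨e, he, -⟩ := hedge 0
    obtain ⟨q, hq, -⟩ := h.exists_mem_innerBoundary hp 0 he one_pos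
    refine (Metric.le_infDist ⟨q, hq⟩).2 fun q hq => ?_
    have := rectDepth_le_add_dist (a := a) (b := b) n p q
    rwa [rectDepth_eq_zero_of_mem_frontier hq.1, zero_add] at this

theorem mem_core_iff {n : ℕ} {ε : ℝ} (hε : 0 < ε) {p : Square} :
    p ∈ core (C a b n) ε ↔ ε ≤ rectDepth a b n p := by
  refine ⟨fun hp => (h.infDist_innerBoundary hp.1) ▸ hp.2, fun hp => ?_⟩
  have hC := mem_C_of_rectDepth_pos (hε.trans_le hp)
  exact ⟨hC, by rwa [h.infDist_innerBoundary hC]⟩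

theorem mem_coreEdge_iff {n : ℕ} {ε : ℝ} (hε : 0 < ε) {p : Square} :
    p ∈ coreEdge (C a b n) ε ↔ rectDepth a b n p = ε := by
  refine ⟨fun hp => (h.infDist_innerBoundary hp.1) ▸ hp.2, fun hp => ?_⟩
  have hC := mem_C_of_rectDepth_pos (hε.trans_eq hp.symm)
  exact ⟨hC, by rwa [h.infDist_innerBoundary hC]⟩

/-- Slide the shallower coordinate along the segment to its nearest edge: the distance to that edge
decreases at unit speed. -/
theorem exists_rectDepth_le {n : ℕ} {p : Square} {s : ℝ} (hs : 0 ≤ s)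
    (hsp : s ≤ rectDepth a b n p) (hp : 0 < rectDepth a b n p) :
    ∃ q, dist p q ≤ rectDepth a b n p - s ∧ rectDepth a b n q ≤ s := by
  obtain ⟨i, hi⟩ := exists_rectDepth_eq (a := a) (b := b) n p
  obtain ⟨k, hk, hpk⟩ := mem_C_iff.1 (mem_C_of_rectDepth_pos hp) i
  obtain ⟨e, he, hd⟩ := h.exists_edge hk hpk
  set r := rectDepth a b n p
  have hI := Ioo_subset_Icc_self (h.edge_mem_Ioo he)
  have hx : (s / r) * p.1 i + (1 - s / r) * e ∈ Icc (0 : ℝ) 1 :=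
    (convex_Icc (0 : ℝ) 1) (p.2 i) hI (by positivity)
      (sub_nonneg.2 ((div_le_one hp).2 hsp)) (by ring)
  refine ⟨Square.cons i hx (p.2 i.rev), ?_, ?_⟩
  · refine (Square.dist_cons_le _ _ _).trans ?_
    rw [sub_self, abs_zero, add_zero]
    have e1 : p.1 i - ((s / r) * p.1 i + (1 - s / r) * e) = (1 - s / r) * (p.1 i - e) := by ring
    rw [e1, abs_mul, ← hd, ← hi, abs_of_nonneg (sub_nonneg.2 ((div_le_one hp).2 hsp))]
    exact le_of_eq (by field_simp)
  · refine (rectDepth_le n _ i).trans ((h.depth_le_of_edge _ he).trans ?_)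
    rw [Square.cons_self]
    have e1 : (s / r) * p.1 i + (1 - s / r) * e - e = (s / r) * (p.1 i - e) := by ring
    rw [e1, abs_mul, ← hd, ← hi, abs_of_nonneg (by positivity)]
    exact le_of_eq (by field_simp)

theorem infDist_coreEdge {n : ℕ} {p : Square} {ε : ℝ} (hε : 0 < ε)
    (hp : ε ≤ rectDepth a b n p) :
    Metric.infDist p (coreEdge (C a b n) ε) = rectDepth a b n p - ε := by
  obtain ⟨q, hq, hq'⟩ := h.exists_rectDepth_le hε.le hp (hε.trans_le hp)
  have hpq := rectDepth_le_add_dist (a := a) (b := b) n p q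
  have hqe : q ∈ coreEdge (C a b n) ε := (h.mem_coreEdge_iff hε).2 (by linarith)
  refine le_antisymm ((Metric.infDist_le_dist_of_mem hqe).trans hq) ?_
  refine (Metric.le_infDist ⟨q, hqe⟩).2 fun z hz => ?_
  have := rectDepth_le_add_dist (a := a) (b := b) n p z
  rw [(h.mem_coreEdge_iff hε).1 hz] at this
  linarith

/-- From depth exactly `ε` an arbitrarily short slide leaves the core. -/
theorem lt_rectDepth_of_mem_interior_core {n : ℕ} {p : Square} {ε : ℝ} (hε : 0 < ε)
    (hp : p ∈ interior (core (C a b n) ε)) : ε < rectDepth a b n p := by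
  have h1 := (h.mem_core_iff hε).1 (interior_subset hp)
  by_contra hlt
  have heq : rectDepth a b n p = ε := le_antisymm (not_lt.1 hlt) h1
  obtain ⟨δ, hδ, hball⟩ := Metric.mem_nhds_iff.1 (mem_interior_iff_mem_nhds.1 hp)
  have hm : 0 < min ε δ := lt_min hε hδ
  obtain ⟨q, hq, hq'⟩ := h.exists_rectDepth_le (p := p) (n := n) (s := ε - min ε δ / 2)
    (by linarith [min_le_left ε δ]) (by linarith) (by linarith)
  have hqc : q ∈ core (C a b n) ε := hball (by
    rw [Metric.mem_ball, dist_comm]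
    linarith [min_le_right ε δ])
  have := (h.mem_core_iff hε).1 hqc
  linarith

theorem rectDepth_of_mem_collar {n : ℕ} {p : Square} (hp : p ∈ collar a b n) :
    (1 / 2 : ℝ) ^ n < rectDepth a b n p ∧ rectDepth a b n p < 5 / 4 * (1 / 2) ^ n := by
  have hε : (0 : ℝ) < (1 / 2) ^ n := by positivity
  refine ⟨h.lt_rectDepth_of_mem_interior_core hε (interior_mono sdiff_subset hp), ?_⟩
  have := (interior_subset hp).2
  rwa [h.mem_core_iff (by positivity), not_le] at this

theorem exists_rectDepth_pos {p : Square} (hp : p ∈ ⋃ n, C a b n) :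
    ∃ n, 0 < rectDepth a b n p := by
  obtain ⟨m, hm⟩ := mem_iUnion.1 hp
  have hU : ∀ i, ∃ n, 0 < depth a b n (p.1 i) := fun i => by
    obtain ⟨k, -, hk⟩ := mem_C_iff.1 hm i
    exact h.exists_depth_pos (mem_iUnion.2 ⟨k, hk⟩)
  obtain ⟨n₀, h0⟩ := hU 0
  obtain ⟨n₁, h1⟩ := hU 1
  exact ⟨max n₀ n₁, lt_min (h0.trans_le (h.depth_mono (le_max_left _ _) _))
    (h1.trans_le (h.depth_mono (le_max_right _ _) _))⟩

omit h in
theorem mem_iUnion_C_iff {p : Square} : p ∈ ⋃ n, C a b n ↔ ∀ i, p.1 i ∈ ⋃ n, J a b n := by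
  refine ⟨fun hp i => ?_, fun hp => ?_⟩
  · obtain ⟨m, hm⟩ := mem_iUnion.1 hp
    obtain ⟨k, -, hk⟩ := mem_C_iff.1 hm i
    exact mem_iUnion.2 ⟨k, hk⟩
  · choose k hk using fun i => mem_iUnion.1 (hp i)
    exact mem_iUnion.2 ⟨max (k 0) (k 1), mem_C_iff.2 (Fin.forall_fin_two.2
      ⟨⟨k 0, le_max_left _ _, hk 0⟩, k 1, le_max_right _ _, hk 1⟩)⟩

end IsIntervalSystem

end RectDepth

/-! ### The stage maps -/

section Stage

/-- The depth in `C_m`, scaled by the factor `2 ^ m`. -/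
noncomputable def scaledDepth (a b : ℕ → ℚ) (m : ℕ) (p : Square) : ℝ := 2 ^ m * rectDepth a b m p

/-- A function of the scaled depth that decreases from `1` to `0` while eight times the scaled depth
increases from `c - 1` to `c`. -/
noncomputable def ramp (a b : ℕ → ℚ) (c : ℝ) (m : ℕ) (p : Square) : ℝ :=
  max 0 (min 1 (c - 8 * scaledDepth a b m p))

/-- The coordinates of the point towards which the `n`-th stage map moves `p`. As the depth of `p` in
`C_m` decreases, the aim moves from the `m`-th to the next target point, first vertically and then
horizontally. -/
noncomputable def aim (a b : ℕ → ℚ) (n : ℕ) (p : Square) (i : Fin 2) : ℝ :=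
  targetCoord a b 0 + ∑ m ∈ Finset.range n,
    (targetCoord a b (m + 1) - targetCoord a b m) * ramp a b (11 + (i : ℕ)) m p

/-- A cutoff function that vanishes at the points which are not affected by the stage maps from the
`m`-th one on. -/
noncomputable def cutoff (a b : ℕ → ℚ) : ℕ → Square → ℝ
  | 0, _ => 1
  | m + 1, p => ramp a b 12 m p

/-- The contribution of the `m`-th stage to the amount by which a point `p` is moved, in terms of
the distance `r` of `p` from the `m`-th target point. -/
noncomputable def pushTerm (a b : ℕ → ℚ) (m : ℕ) (p : Square) (r : ℝ) : ℝ :=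
  (1 / 4) ^ m / 16 * (cutoff a b m p * max 0 (scaledDepth a b m p - 1) * (max 1 (2 ^ m * r))⁻¹)

/-- The proportion of the distance from `p` to its aim by which the `n`-th stage map moves `p`, in
terms of the distances `r m` of `p` from the target points. -/
noncomputable def push (a b : ℕ → ℚ) (n : ℕ) (p : Square) (r : ℕ → ℝ) : ℝ :=
  ∑ m ∈ Finset.range (n + 1), pushTerm a b m p (r m)

/-- The distance from `p` to the `m`-th target point. -/
noncomputable def targetDist (a b : ℕ → ℚ) (p : Square) (m : ℕ) : ℝ := ‖target a b m - p‖

variable {a b : ℕ → ℚ}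

theorem le_rectDepth_iff {c : ℝ} {m : ℕ} {p : Square} :
    c * (1 / 2) ^ m ≤ rectDepth a b m p ↔ c ≤ scaledDepth a b m p := by
  rw [scaledDepth, one_div_pow, mul_one_div, div_le_iff₀ (by positivity), mul_comm]

theorem one_le_scaledDepth_iff {m : ℕ} {p : Square} :
    (1 / 2 : ℝ) ^ m ≤ rectDepth a b m p ↔ 1 ≤ scaledDepth a b m p := by
  rw [← le_rectDepth_iff, one_mul]

theorem ramp_nonneg (c : ℝ) (m : ℕ) (p : Square) : 0 ≤ ramp a b c m p := le_max_left _ _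

theorem ramp_le_one (c : ℝ) (m : ℕ) (p : Square) : ramp a b c m p ≤ 1 :=
  max_le zero_le_one (min_le_left _ _)

theorem ramp_eq_zero {c : ℝ} {m : ℕ} {p : Square} (hc : c ≤ 8 * scaledDepth a b m p) :
    ramp a b c m p = 0 :=
  max_eq_left ((min_le_right _ _).trans (by linarith))

theorem ramp_eq_one {c : ℝ} {m : ℕ} {p : Square} (hc : 8 * scaledDepth a b m p ≤ c - 1) :
    ramp a b c m p = 1 := by
  rw [ramp, min_eq_left (by linarith), max_eq_right zero_le_one]

theorem cutoff_nonneg (m : ℕ) (p : Square) : 0 ≤ cutoff a b m p := by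
  cases m <;> [exact zero_le_one; exact ramp_nonneg _ _ _]

theorem cutoff_le_one (m : ℕ) (p : Square) : cutoff a b m p ≤ 1 := by
  cases m <;> [exact le_rfl; exact ramp_le_one _ _ _]

theorem pushTerm_nonneg (m : ℕ) (p : Square) (r : ℝ) : 0 ≤ pushTerm a b m p r :=
  mul_nonneg (by positivity) (mul_nonneg (mul_nonneg (cutoff_nonneg m p) (le_max_left _ _))
    (inv_nonneg.2 (zero_le_one.trans (le_max_left _ _))))

theorem pushTerm_eq_zero {m : ℕ} {p : Square} (hp : scaledDepth a b m p ≤ 1) (r : ℝ) :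
    pushTerm a b m p r = 0 := by
  rw [pushTerm, max_eq_left (by linarith : scaledDepth a b m p - 1 ≤ 0)]; ring

theorem push_nonneg (n : ℕ) (p : Square) (r : ℕ → ℝ) : 0 ≤ push a b n p r :=
  Finset.sum_nonneg fun m _ => pushTerm_nonneg m p _

theorem inv_max_one_le_one (x : ℝ) : (max 1 x)⁻¹ ≤ 1 := inv_le_one_of_one_le₀ (le_max_left _ _)

theorem inv_max_one_nonneg (x : ℝ) : 0 ≤ (max 1 x)⁻¹ :=
  inv_nonneg.2 (zero_le_one.trans (le_max_left _ _))

namespace IsIntervalSystem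

variable (h : IsIntervalSystem a b)
include h

/-! ### Scale separation and bounds for push and aim -/

theorem depth_le_one (n : ℕ) {x : ℝ} (hx : x ∈ Icc (0 : ℝ) 1) : depth a b n x ≤ 1 := by
  obtain ⟨z, hz⟩ := h.uncovered_nonempty n
  refine (Metric.infDist_le_dist_of_mem hz).trans ?_
  rw [Real.dist_eq, abs_le]
  constructor <;> linarith [hx.1, hx.2, hz.1.1, hz.1.2]

theorem scaledDepth_le (m : ℕ) (p : Square) : scaledDepth a b m p ≤ 2 ^ m :=
  mul_le_of_le_one_right (by positivity) ((rectDepth_le m p 0).trans (h.depth_le_one m (p.2 0)))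

theorem scaledDepth_mono {n m : ℕ} (hn : n ≤ m) (p : Square) :
    scaledDepth a b n p ≤ scaledDepth a b m p :=
  mul_le_mul (pow_le_pow_right₀ one_le_two hn) (h.rectDepth_mono hn p) (rectDepth_nonneg _ _)
    (by positivity)

/-- This separates the stages: scaled depth above `1` at one stage exceeds `3/2` at all later ones,
and scaled depth at most `2` means at most `1` at all earlier ones. -/
theorem two_mul_scaledDepth_le {n m : ℕ} (hn : n < m) (p : Square) :
    2 * scaledDepth a b n p ≤ scaledDepth a b m p := by
  refine le_trans ?_ (h.scaledDepth_mono (Nat.succ_le_of_lt hn) p)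
  rw [scaledDepth, scaledDepth, ← mul_assoc, ← pow_succ']
  exact mul_le_mul_of_nonneg_left (h.rectDepth_mono n.le_succ p) (by positivity)

theorem pushTerm_le (m : ℕ) (p : Square) (r : ℝ) : pushTerm a b m p r ≤ (1 / 2) ^ m / 16 := by
  have h1 : cutoff a b m p * max 0 (scaledDepth a b m p - 1) * (max 1 (2 ^ m * r))⁻¹ ≤
      1 * 2 ^ m * 1 := by
    refine mul_le_mul (mul_le_mul (cutoff_le_one m p) (max_le (by positivity) ?_) (le_max_left _ _)
      zero_le_one) (inv_max_one_le_one _) (inv_max_one_nonneg _) (by positivity)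
    linarith [h.scaledDepth_le m p]
  refine (mul_le_mul_of_nonneg_left h1 (by positivity)).trans (le_of_eq ?_)
  rw [show (1 / 4 : ℝ) = 1 / 2 * (1 / 2) by norm_num, mul_pow, one_mul, mul_one, div_mul_eq_mul_div,
    mul_assoc, ← mul_pow]
  norm_num

theorem push_le (n : ℕ) (p : Square) (r : ℕ → ℝ) : push a b n p r ≤ 1 / 8 := by
  have h1 : push a b n p r ≤ ∑ m ∈ Finset.range (n + 1), (1 / 2 : ℝ) ^ m / 16 :=
    Finset.sum_le_sum fun m _ => h.pushTerm_le m p _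
  rw [← Finset.sum_div] at h1
  have h2 := sum_geometric_two_le (n + 1)
  linarith

/-- The increments of `v_m` are nonnegative and weighted by ramps in `[0, 1]`, so the sum is bounded
by the telescoping one. -/
theorem aim_mem_Icc (n : ℕ) (p : Square) (i : Fin 2) : aim a b n p i ∈ Icc (0 : ℝ) 1 := by
  have hm : ∀ m, 0 ≤ targetCoord a b (m + 1) - targetCoord a b m := fun m =>
    sub_nonneg.2 (h.monotone_targetCoord m.le_succ)
  constructor
  · exact add_nonneg (h.targetCoord_mem_Icc 0).1
      (Finset.sum_nonneg fun m _ => mul_nonneg (hm m) (ramp_nonneg _ _ _))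
  · have h1 : aim a b n p i ≤ targetCoord a b 0 + ∑ m ∈ Finset.range n,
        (targetCoord a b (m + 1) - targetCoord a b m) :=
      add_le_add_right (Finset.sum_le_sum fun m _ =>
        mul_le_of_le_one_right (hm m) (ramp_le_one _ _ _)) _
    rw [Finset.sum_range_sub] at h1
    linarith [(h.targetCoord_mem_Icc n).2]

/-- The `n`-th stage map. -/
noncomputable def stage (n : ℕ) (p : Square) : Square :=
  Square.ofFun (fun i => p.1 i + push a b n p (targetDist a b p) * (aim a b n p i - p.1 i))
    fun i => by
      have h1 := push_nonneg (a := a) (b := b) n p (targetDist a b p)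
      have h2 := h.push_le n p (targetDist a b p)
      have := (convex_Icc (0 : ℝ) 1) (p.2 i) (h.aim_mem_Icc n p i)
        (a := 1 - push a b n p (targetDist a b p)) (by linarith) h1 (by ring)
      convert this using 1
      simp only [smul_eq_mul]; ring

theorem stage_apply (n : ℕ) (p : Square) (i : Fin 2) : (h.stage n p).1 i =
    p.1 i + push a b n p (targetDist a b p) * (aim a b n p i - p.1 i) := rfl

theorem push_eq_zero {n : ℕ} {p : Square} (hp : scaledDepth a b n p ≤ 1) (r : ℕ → ℝ) :
    push a b n p r = 0 :=
  Finset.sum_eq_zero fun _ hm => pushTerm_eq_zero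
    ((h.scaledDepth_mono (Nat.le_of_lt_succ (Finset.mem_range.1 hm)) p).trans hp) _

theorem stage_eq_self {n : ℕ} {p : Square} (hp : scaledDepth a b n p ≤ 1) : h.stage n p = p :=
  Square.ext_coord fun i => by rw [stage_apply, h.push_eq_zero hp]; ring

/-- The ramps have constants `11` and `12`, so they vanish once eight times the scaled depth reaches
`12`, which is the threshold `3/2`. -/
theorem aim_eq_of_le {n k : ℕ} (hk : n ≤ k) {p : Square} (hp : 3 / 2 ≤ scaledDepth a b n p)
    (i : Fin 2) : aim a b k p i = aim a b n p i := by
  induction k, hk using Nat.le_induction with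
  | base => rfl
  | succ k hk ih =>
    have h1 := h.scaledDepth_mono hk p
    have h2 : ((i : ℕ) : ℝ) ≤ 1 := by exact_mod_cast Nat.le_of_lt_succ i.2
    rw [← ih, aim, Finset.sum_range_succ, ramp_eq_zero (by linarith), mul_zero, add_zero, aim]

theorem push_eq_of_le {n k : ℕ} (hk : n ≤ k) {p : Square} (hp : 3 / 2 ≤ scaledDepth a b n p)
    (r : ℕ → ℝ) : push a b k p r = push a b n p r := by
  induction k, hk using Nat.le_induction with
  | base => rfl
  | succ k hk ih =>
    have h1 := h.scaledDepth_mono hk p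
    rw [← ih, push, Finset.sum_range_succ, pushTerm, cutoff, ramp_eq_zero (by linarith), push]
    ring

theorem stage_eq_of_le {n k : ℕ} (hk : n ≤ k) {p : Square} (hp : 3 / 2 ≤ scaledDepth a b n p) :
    h.stage k p = h.stage n p :=
  Square.ext_coord fun i => by
    rw [stage_apply, stage_apply, h.push_eq_of_le hk hp, h.aim_eq_of_le hk hp]

omit h in
theorem push_pos {n : ℕ} {p : Square} (hp : 1 < scaledDepth a b n p) (r : ℕ → ℝ) :
    0 < push a b n p r := by
  classical
  -- The first stage with scaled depth above `1` contributes: its predecessor, if any, has scaled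
  -- depth at most `1`, so the cutoff is `1`.
  have hex : ∃ m, 1 < scaledDepth a b m p := ⟨n, hp⟩
  set m := Nat.find hex with hm
  have h1 : 1 < scaledDepth a b m p := Nat.find_spec hex
  have hcut : cutoff a b m p = 1 := by
    rcases Nat.eq_zero_or_eq_succ_pred m with h0 | h0
    · rw [h0]; rfl
    · have h2 := Nat.find_min hex (m := m.pred) (by omega)
      rw [h0]
      exact ramp_eq_one (by linarith [not_lt.1 h2])
  refine Finset.sum_pos' (fun k _ => pushTerm_nonneg k p _)
    ⟨m, Finset.mem_range.2 (Nat.lt_succ_of_le (Nat.find_min' hex hp)), ?_⟩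
  rw [pushTerm, hcut, max_eq_right (by linarith : (0 : ℝ) ≤ scaledDepth a b m p - 1)]
  have : 0 < (max 1 (2 ^ m * r m))⁻¹ := inv_pos.2 (zero_lt_one.trans_le (le_max_left _ _))
  have h3 : 0 < scaledDepth a b m p - 1 := by linarith
  positivity

omit h in
theorem aim_eq_targetCoord {n : ℕ} {p : Square} (hp : ∀ m < n, 8 * scaledDepth a b m p ≤ 10)
    (i : Fin 2) : aim a b n p i = targetCoord a b n := by
  rw [aim, Finset.sum_congr rfl (g := fun m => targetCoord a b (m + 1) - targetCoord a b m),
    Finset.sum_range_sub]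
  · ring
  · intro m hm
    have := hp m (Finset.mem_range.1 hm)
    have h2 : (0 : ℝ) ≤ ((i : ℕ) : ℝ) := by positivity
    rw [ramp_eq_one (by linarith), mul_one]

omit h in
theorem rectDepth_pos_of_scaledDepth_pos {n : ℕ} {p : Square} (hp : 0 < scaledDepth a b n p) :
    0 < rectDepth a b n p :=
  pos_of_mul_pos_right hp (by positivity)

/-- Changing the coordinates of the aim one after the other keeps one of them equal to a target
coordinate `v_k`. That coordinate has depth zero at stage `k`, whereas those of `p` have positive
depth there. -/
theorem exists_aim_ne {n : ℕ} {p : Square} (hp : 0 < scaledDepth a b n p) :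
    ∃ i, aim a b n p i ≠ p.1 i := by
  classical
  have hz : ∀ {m : ℕ}, 0 < scaledDepth a b m p → ∀ (k : ℕ) (i : Fin 2), m ≤ k →
      targetCoord a b k ≠ p.1 i := by
    intro m hm k i hk he
    have h1 := (rectDepth_pos_of_scaledDepth_pos hm).trans_le
      ((rectDepth_le m p i).trans (h.depth_mono hk _))
    rw [← he, h.depth_targetCoord] at h1
    exact lt_irrefl _ h1
  by_cases hall : ∀ m < n, 8 * scaledDepth a b m p ≤ 10
  · exact ⟨0, by rw [aim_eq_targetCoord hall]; exact hz hp n 0 le_rfl⟩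
  -- At the first `m` with `s_m > 10/8`, all earlier transitions are complete, and `s_(m+1) > 20/8`
  -- excludes all later ones.
  · push Not at hall
    obtain ⟨hmn, hm⟩ := Nat.find_spec hall
    have hmin : ∀ k < Nat.find hall, 8 * scaledDepth a b k p ≤ 10 := fun k hk => by
      have := Nat.find_min hall hk
      push Not at this
      exact this (hk.trans hmn)
    set m := Nat.find hall
    have hnext : 3 / 2 ≤ scaledDepth a b (m + 1) p := by
      have := h.two_mul_scaledDepth_le m.lt_succ_self p
      linarith
    have haim : ∀ i, aim a b n p i = targetCoord a b m +
        (targetCoord a b (m + 1) - targetCoord a b m) * ramp a b (11 + (i : ℕ)) m p := fun i => by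
      rw [h.aim_eq_of_le hmn hnext, aim, Finset.sum_range_succ, ← add_assoc, ← aim,
        aim_eq_targetCoord hmin]
    have hpos : 0 < scaledDepth a b m p := by linarith
    -- Above `11` the horizontal transition has not begun; below it the vertical one is complete.
    rcases le_total 11 (8 * scaledDepth a b m p) with h11 | h11
    · refine ⟨0, ?_⟩
      rw [haim, ramp_eq_zero (by simpa using h11), mul_zero, add_zero]
      exact hz hpos m 0 le_rfl
    · refine ⟨1, ?_⟩
      rw [haim, ramp_eq_one (by simp; linarith), mul_one, add_sub_cancel]
      exact hz hpos (m + 1) 1 m.le_succ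

theorem stage_ne_self {n : ℕ} {p : Square} (hp : 1 < scaledDepth a b n p) : h.stage n p ≠ p := by
  intro he
  obtain ⟨i, hi⟩ := h.exists_aim_ne (zero_lt_one.trans hp)
  have h1 : (h.stage n p).1 i = p.1 i := by rw [he]
  rw [stage_apply, add_eq_left, mul_eq_zero, sub_eq_zero] at h1
  exact h1.elim (push_pos hp _).ne' hi

theorem push_eq_pushTerm {n : ℕ} {p : Square} (hp : scaledDepth a b n p ≤ 2) (r : ℕ → ℝ) :
    push a b n p r = pushTerm a b n p (r n) := by
  rw [push, Finset.sum_range_succ, Finset.sum_eq_zero, zero_add]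
  intro m hm
  have := h.two_mul_scaledDepth_le (Finset.mem_range.1 hm) p
  exact pushTerm_eq_zero (by linarith) _

theorem abs_stage_sub_le (n : ℕ) (p : Square) (i : Fin 2) :
    |(h.stage n p).1 i - p.1 i| ≤ push a b n p (targetDist a b p) := by
  rw [stage_apply, add_sub_cancel_left, abs_mul, abs_of_nonneg (push_nonneg n p _)]
  refine mul_le_of_le_one_right (push_nonneg n p _) (abs_le.2 ?_)
  have h1 := h.aim_mem_Icc n p i
  have h2 := p.2 i
  constructor <;> linarith [h1.1, h1.2, h2.1, h2.2]

/-- Where the scaled depth is at least `3/2` the two maps coincide. Elsewhere only the terms of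
index `n` and `n + 1` can contribute to the push, and they are of size `2⁻ⁿ`. -/
theorem dist_stage_succ_le (n : ℕ) (p : Square) :
    dist (h.stage n p) (h.stage (n + 1) p) ≤ 1 / 2 / 2 ^ n := by
  rcases le_or_gt (3 / 2) (scaledDepth a b n p) with hp | hp
  · rw [h.stage_eq_of_le n.le_succ hp, dist_self]; positivity
  · have h1 : push a b n p (targetDist a b p) ≤ (1 / 2) ^ n / 16 := by
      rw [h.push_eq_pushTerm (by linarith)]; exact h.pushTerm_le n p _
    have h2 : push a b (n + 1) p (targetDist a b p) ≤ (1 / 2) ^ n / 8 := by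
      rw [push, Finset.sum_range_succ, ← push]
      have := h.pushTerm_le (n + 1) p (targetDist a b p (n + 1))
      rw [pow_succ] at this
      have h0 : (0 : ℝ) < (1 / 2) ^ n := by positivity
      linarith
    have h3 : ∀ i, |(h.stage n p).1 i - (h.stage (n + 1) p).1 i| ≤ (1 / 2) ^ n / 4 := fun i => by
      have h4 := h.abs_stage_sub_le n p i
      have h5 := h.abs_stage_sub_le (n + 1) p i
      rw [abs_le] at h4 h5 ⊢
      have h0 : (0 : ℝ) < (1 / 2) ^ n := by positivity
      constructor <;> linarith
    refine (Square.dist_le _ _).trans ((add_le_add (h3 0) (h3 1)).trans (le_of_eq ?_))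
    rw [one_div_pow]; ring

theorem rectDepth_le_targetDist (n : ℕ) (p : Square) :
    rectDepth a b n p ≤ targetDist a b p n := by
  have h1 := (rectDepth_le (a := a) (b := b) n p 0).trans
    (depth_le_add n (p.1 0) (targetCoord a b n))
  rw [h.depth_targetCoord, zero_add, abs_sub_comm] at h1
  refine h1.trans ?_
  exact PiLp.norm_apply_le (target a b n - (p : Plane)) 0

/-- In the collar all earlier stages have scaled depth below `1`, so the aim is exactly `t_n` and
only the `n`-th push term survives, with cutoff `1`. The factors `2 ^ n` and `2⁻ⁿ` cancel and leave
the constant `(1 / 4) ^ n / 16`. -/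
theorem stage_sub_of_mem_collar {n : ℕ} {p : Square} (hp : p ∈ collar a b n) :
    (h.stage n p : Plane) - p =
      ((1 / 4) ^ n / 16 * Metric.infDist p (coreEdge (C a b n) ((1 / 2) ^ n))) •
        (‖target a b n - p‖⁻¹ • (target a b n - p)) := by
  obtain ⟨h1, h2⟩ := h.rectDepth_of_mem_collar hp
  have h2' : scaledDepth a b n p < 5 / 4 := by
    rw [← not_le, ← le_rectDepth_iff, not_le]; exact h2
  have e0 : scaledDepth a b n p - 1 = 2 ^ n * (rectDepth a b n p - (1 / 2) ^ n) := by
    rw [mul_sub, ← mul_pow, mul_one_div_cancel two_ne_zero, one_pow, scaledDepth]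
  have hpos : (0 : ℝ) < 2 ^ n := by positivity
  have h1' : 0 < scaledDepth a b n p - 1 := by rw [e0]; exact mul_pos hpos (sub_pos.2 h1)
  have hcut : cutoff a b n p = 1 := by
    cases n with
    | zero => rfl
    | succ m =>
      have := h.two_mul_scaledDepth_le m.lt_succ_self p
      exact ramp_eq_one (by linarith)
  have hD := h.rectDepth_le_targetDist n p
  have hD0 : 0 < targetDist a b p n := lt_of_lt_of_le (by positivity) (h1.le.trans hD)
  -- The truncation at `1`, which keeps the push Lipschitz near the target, is inactive here: `t_n`
  -- has depth zero, so its distance from `p` is at least the depth of `p`.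
  have hmax : max 1 (2 ^ n * targetDist a b p n) = 2 ^ n * targetDist a b p n := by
    refine max_eq_right ?_
    have := mul_le_mul_of_nonneg_left hD hpos.le
    rw [← scaledDepth] at this
    linarith
  have hpush : push a b n p (targetDist a b p) =
      (1 / 4) ^ n / 16 * (rectDepth a b n p - (1 / 2) ^ n) * (targetDist a b p n)⁻¹ := by
    rw [h.push_eq_pushTerm (by linarith), pushTerm, hcut, max_eq_right h1'.le, hmax, e0, mul_inv]
    field_simp
  rw [h.infDist_coreEdge (by positivity) h1.le, smul_smul]
  refine PiLp.ext fun i => ?_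
  have hv : target a b n i = targetCoord a b n := by fin_cases i <;> rfl
  change (h.stage n p).1 i - p.1 i = _ * (target a b n i - p.1 i)
  rw [stage_apply, add_sub_cancel_left, hpush, hv, aim_eq_targetCoord fun m hm => ?_]
  · rfl
  · have := h.two_mul_scaledDepth_le hm p
    linarith

/-! ### The uniform limit and its fixed points -/

instance : CompleteSpace Square := by
  have : IsClosed unitSquare := by
    unfold unitSquare
    simp only [ofPred_forall]
    exact isClosed_iInter fun i => isClosed_Icc.preimage (by fun_prop)
  exact this.completeSpace_coe

theorem exists_tendsto_stage (p : Square) : ∃ q, Tendsto (fun n => h.stage n p) atTop (𝓝 q) :=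
  cauchySeq_tendsto_of_complete (cauchySeq_of_le_geometric_two fun n => h.dist_stage_succ_le n p)

/-- The limit of the stage maps. -/
noncomputable def limitMap (p : Square) : Square := (h.exists_tendsto_stage p).choose

theorem dist_stage_limitMap_le (n : ℕ) (p : Square) :
    dist (h.stage n p) (h.limitMap p) ≤ (1 / 2) ^ n := by
  rw [one_div_pow]
  exact dist_le_of_le_geometric_two_of_tendsto (fun n => h.dist_stage_succ_le n p)
    (h.exists_tendsto_stage p).choose_spec n

theorem tendstoUniformly_stage : TendstoUniformly h.stage h.limitMap atTop := by
  refine Metric.tendstoUniformly_iff.2 fun ε hε => ?_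
  obtain ⟨N, hN⟩ := exists_pow_lt_of_lt_one hε (by norm_num : (1 / 2 : ℝ) < 1)
  filter_upwards [eventually_ge_atTop N] with n hn p
  rw [dist_comm]
  exact ((h.dist_stage_limitMap_le n p).trans
    (pow_le_pow_of_le_one (by norm_num) (by norm_num) hn)).trans_lt hN

theorem limitMap_eq_stage {n : ℕ} {p : Square} (hp : 3 / 2 ≤ scaledDepth a b n p) :
    h.limitMap p = h.stage n p :=
  tendsto_nhds_unique (h.exists_tendsto_stage p).choose_spec
    (tendsto_const_nhds.congr' ((eventually_ge_atTop n).mono fun _ hk =>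
      (h.stage_eq_of_le hk hp).symm))

/-- A point of the union acquires positive depth; the factor `2 ^ n` then raises its scaled depth
above `3/2`, where the limit equals a stage map that moves it. A point outside is fixed by every
stage map. -/
theorem limitMap_eq_self_iff {p : Square} : h.limitMap p = p ↔ p ∉ ⋃ n, C a b n := by
  constructor
  · intro hfix hp
    obtain ⟨n, hn⟩ := h.exists_rectDepth_pos hp
    obtain ⟨k, hk⟩ := pow_unbounded_of_one_lt (3 / 2 / rectDepth a b n p) one_lt_two
    have hs : 3 / 2 ≤ scaledDepth a b (max n k) p := by
      rw [div_lt_iff₀ hn] at hk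
      refine hk.le.trans (mul_le_mul (pow_le_pow_right₀ one_le_two (le_max_right _ _))
        (h.rectDepth_mono (le_max_left _ _) p) hn.le (by positivity))
    rw [h.limitMap_eq_stage hs] at hfix
    exact h.stage_ne_self (by linarith) hfix
  · intro hp
    have hs : ∀ n, h.stage n p = p := fun n => by
      refine h.stage_eq_self ?_
      by_contra hlt
      exact hp (mem_iUnion.2 ⟨n, mem_C_of_rectDepth_pos
        (rectDepth_pos_of_scaledDepth_pos (by linarith [not_le.1 hlt]))⟩)
    exact tendsto_nhds_unique (h.exists_tendsto_stage p).choose_spec (by simp [hs])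

end IsIntervalSystem

/-! ### Lipschitz constants -/

/-- `g` is Lipschitz with constant `L`. -/
def IsLip (L : ℝ) (g : Square → ℝ) : Prop := ∀ p q, |g p - g q| ≤ L * dist p q

theorem IsLip.of_le {L L' : ℝ} {g : Square → ℝ} (hg : IsLip L g) (hL : L ≤ L') : IsLip L' g :=
  fun p q => (hg p q).trans (mul_le_mul_of_nonneg_right hL dist_nonneg)

theorem IsLip.const (c : ℝ) : IsLip 0 fun _ => c := fun p q => by simp

theorem IsLip.add {L L' : ℝ} {f g : Square → ℝ} (hf : IsLip L f) (hg : IsLip L' g) :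
    IsLip (L + L') fun p => f p + g p := fun p q => by
  rw [add_sub_add_comm, add_mul]
  exact (abs_add_le _ _).trans (add_le_add (hf p q) (hg p q))

theorem IsLip.const_mul {L : ℝ} {g : Square → ℝ} (hg : IsLip L g) (c : ℝ) :
    IsLip (|c| * L) fun p => c * g p := fun p q => by
  rw [← mul_sub, abs_mul, mul_assoc]
  exact mul_le_mul_of_nonneg_left (hg p q) (abs_nonneg c)

theorem IsLip.sub {L L' : ℝ} {f g : Square → ℝ} (hf : IsLip L f) (hg : IsLip L' g) :
    IsLip (L + L') fun p => f p - g p := fun p q => by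
  rw [sub_sub_sub_comm, add_mul]
  exact (abs_sub _ _).trans (add_le_add (hf p q) (hg p q))

theorem IsLip.mul {L L' A B : ℝ} {f g : Square → ℝ} (hf : IsLip L f) (hg : IsLip L' g)
    (hA : ∀ p, |f p| ≤ A) (hB : ∀ p, |g p| ≤ B) : IsLip (L * B + A * L') fun p => f p * g p :=
  fun p q => by
    have e : f p * g p - f q * g q = (f p - f q) * g p + f q * (g p - g q) := by ring
    have hA0 : 0 ≤ A := (abs_nonneg _).trans (hA p)
    have h1 := mul_le_mul (hf p q) (hB p) (abs_nonneg _) ((abs_nonneg _).trans (hf p q))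
    have h2 := mul_le_mul (hA q) (hg p q) (abs_nonneg _) hA0
    rw [e]
    refine (abs_add_le _ _).trans ?_
    rw [abs_mul, abs_mul]
    linarith

theorem IsLip.max_const {L : ℝ} {g : Square → ℝ} (hg : IsLip L g) (c : ℝ) :
    IsLip L fun p => max c (g p) := fun p q => by
  refine le_trans ?_ (hg p q)
  have := abs_max_sub_max_le_max c (g p) c (g q)
  simpa using this

theorem IsLip.min_const {L : ℝ} {g : Square → ℝ} (hg : IsLip L g) (c : ℝ) :
    IsLip L fun p => min c (g p) := fun p q => by
  refine le_trans ?_ (hg p q)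
  have := abs_min_sub_min_le_max c (g p) c (g q)
  simpa using this

theorem IsLip.sum {L : ℕ → ℝ} {g : ℕ → Square → ℝ} (n : ℕ) (hg : ∀ m, IsLip (L m) (g m)) :
    IsLip (∑ m ∈ Finset.range n, L m) fun p => ∑ m ∈ Finset.range n, g m p := fun p q => by
  rw [← Finset.sum_sub_distrib, Finset.sum_mul]
  exact (Finset.abs_sum_le_sum_abs _ _).trans (Finset.sum_le_sum fun m _ => hg m p q)

theorem IsLip.inv_max_one {L : ℝ} {g : Square → ℝ} (hg : IsLip L g) :
    IsLip L fun p => (max 1 (g p))⁻¹ := fun p q => by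
  refine le_trans ?_ (hg.max_const 1 p q)
  have h1 : (1 : ℝ) ≤ max 1 (g p) := le_max_left _ _
  have h2 : (1 : ℝ) ≤ max 1 (g q) := le_max_left _ _
  rw [inv_sub_inv (by linarith) (by linarith), abs_div, abs_sub_comm]
  exact div_le_self (abs_nonneg _) ((le_abs_self _).trans' (one_le_mul_of_one_le_of_one_le h1 h2))

theorem isLip_coord (i : Fin 2) : IsLip 1 fun p => p.1 i := fun p q => by
  rw [one_mul]; exact Square.abs_sub_le_dist p q i

theorem isLip_scaledDepth (m : ℕ) : IsLip (2 ^ m) (scaledDepth a b m) := fun p q => by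
  rw [scaledDepth, scaledDepth, ← mul_sub, abs_mul, abs_of_pos (by positivity : (0 : ℝ) < 2 ^ m)]
  refine mul_le_mul_of_nonneg_left (abs_le.2 ⟨?_, ?_⟩) (by positivity)
  · have := rectDepth_le_add_dist (a := a) (b := b) m q p
    rw [dist_comm] at this
    linarith
  · linarith [rectDepth_le_add_dist (a := a) (b := b) m p q]

theorem isLip_ramp (c : ℝ) (m : ℕ) : IsLip (8 * 2 ^ m) (ramp a b c m) :=
  ((((IsLip.const c).sub ((isLip_scaledDepth m).const_mul 8)).min_const 1).max_const 0).of_le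
    (by norm_num)

theorem isLip_cutoff (m : ℕ) : IsLip (4 * 2 ^ m) (cutoff a b m) := by
  cases m with
  | zero => exact (IsLip.const 1).of_le (by positivity)
  | succ m => exact (isLip_ramp 12 m).of_le (by rw [pow_succ]; linarith)

theorem isLip_targetDist (m : ℕ) : IsLip 1 fun p => targetDist a b p m := fun p q => by
  rw [one_mul, Subtype.dist_eq, dist_comm, dist_eq_norm,
    ← sub_sub_sub_cancel_left (p : Plane) q (target a b m)]
  exact abs_norm_sub_norm_le _ _

namespace IsIntervalSystem

variable (h : IsIntervalSystem a b)
include h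

/-- Cutoff, excess depth and reciprocal have slopes of order `2 ^ m`, and the excess depth is
bounded by `2 ^ m`. The product has slope at most `6 * 4 ^ m`, which the weight `(1 / 4) ^ m / 16`
absorbs. -/
theorem isLip_pushTerm (m : ℕ) : IsLip 1 fun p => pushTerm a b m p (targetDist a b p m) := by
  have h1 : IsLip (2 ^ m) fun p => max 0 (scaledDepth a b m p - 1) :=
    (((isLip_scaledDepth m).sub (IsLip.const 1)).max_const 0).of_le (by simp)
  have h2 : IsLip (2 ^ m) fun p => (max 1 (2 ^ m * targetDist a b p m))⁻¹ :=
    (((isLip_targetDist m).const_mul (2 ^ m)).inv_max_one).of_le (by simp)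
  have h3 : ∀ p : Square, |max 0 (scaledDepth a b m p - 1)| ≤ 2 ^ m := fun p => by
    rw [abs_of_nonneg (le_max_left _ _)]
    exact max_le (by positivity) (by linarith [h.scaledDepth_le m p])
  have h4 : ∀ p : Square, |cutoff a b m p| ≤ 1 := fun p => by
    rw [abs_of_nonneg (cutoff_nonneg m p)]; exact cutoff_le_one m p
  have h5 : ∀ p : Square, |(max 1 (2 ^ m * targetDist a b p m))⁻¹| ≤ 1 := fun p => by
    rw [abs_of_nonneg (inv_max_one_nonneg _)]; exact inv_max_one_le_one _
  have h6 := (isLip_cutoff (a := a) (b := b) m).mul h1 h4 h3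
  have h7 := h6.mul h2 (fun p => by
    rw [abs_mul]; exact mul_le_mul (h4 p) (h3 p) (abs_nonneg _) zero_le_one) h5
  refine (h7.const_mul ((1 / 4) ^ m / 16)).of_le ?_
  have hpos : (0 : ℝ) < 2 ^ m := by positivity
  have hone : (1 : ℝ) ≤ 2 ^ m := one_le_pow₀ one_le_two
  have e : (1 / 4 : ℝ) ^ m = (2 ^ m * 2 ^ m)⁻¹ := by
    rw [← mul_pow, ← inv_pow]; norm_num
  rw [abs_of_nonneg (by positivity), e, div_mul_eq_mul_div, inv_mul_eq_div, div_div, div_le_one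
    (by positivity)]
  nlinarith

theorem isLip_push (n : ℕ) : IsLip (2 ^ (n + 1)) fun p => push a b n p (targetDist a b p) := by
  refine (IsLip.sum (n + 1) fun m => h.isLip_pushTerm m).of_le ?_
  simp only [Finset.sum_const, Finset.card_range, nsmul_eq_mul, mul_one]
  exact_mod_cast Nat.lt_two_pow_self.le

theorem isLip_aim (n : ℕ) (i : Fin 2) : IsLip (8 * 2 ^ n) fun p => aim a b n p i := by
  refine ((IsLip.const _).add (IsLip.sum n fun m => ((isLip_ramp (11 + (i : ℕ)) m).const_mul
    (targetCoord a b (m + 1) - targetCoord a b m)).of_le (L' := 8 * 2 ^ m) ?_)).of_le ?_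
  · refine mul_le_of_le_one_left (by positivity) (abs_le.2 ?_)
    have h1 := h.targetCoord_mem_Icc (m + 1)
    have h2 := h.targetCoord_mem_Icc m
    constructor <;> linarith [h1.1, h1.2, h2.1, h2.2]
  · rw [zero_add, ← Finset.mul_sum, geom_sum_eq (by norm_num)]
    norm_num

theorem isLip_stage (n : ℕ) (i : Fin 2) : IsLip (16 * 2 ^ n) fun p => (h.stage n p).1 i := by
  have h1 := (h.isLip_aim n i).sub (isLip_coord i)
  have h2 := (h.isLip_push n).mul (A := 1) (B := 1) h1 (fun p => by
    rw [abs_of_nonneg (push_nonneg n p _)]; linarith [h.push_le n p (targetDist a b p)])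
    (fun p => abs_le.2 (by
      have h1 := h.aim_mem_Icc n p i
      have h2 := p.2 i
      constructor <;> linarith [h1.1, h1.2, h2.1, h2.2]))
  refine ((isLip_coord i).add h2).of_le ?_
  have : (1 : ℝ) ≤ 2 ^ n := one_le_pow₀ one_le_two
  rw [pow_succ]
  linarith

theorem dist_stage_le (n : ℕ) (p q : Square) :
    dist (h.stage n p) (h.stage n q) ≤ 2 ^ (n + 5) * dist p q := by
  refine (Square.dist_le _ _).trans ((add_le_add (h.isLip_stage n 0 p q)
    (h.isLip_stage n 1 p q)).trans (le_of_eq ?_))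
  rw [pow_add]; ring

end IsIntervalSystem

end Stage

/-! ### Computability of the stage maps at rational points -/

section RatFamily

variable {α β : Type} [Primcodable α] [Primcodable β]

/-- A computable family of rationals, considered as a family of reals. -/
def RatFamily (x : α → ℝ) : Prop := ∃ q : α → ℚ, ComputableRat q ∧ ∀ i, x i = q i

theorem ComputableRat.ratFamily {q : α → ℚ} (hq : ComputableRat q) :
    RatFamily fun i => (q i : ℝ) := ⟨q, hq, fun _ => rfl⟩

namespace RatFamily

variable {x y : α → ℝ}

theorem comp {x : β → ℝ} (hx : RatFamily x) {g : α → β} (hg : Computable g) :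
    RatFamily fun i => x (g i) := by
  obtain ⟨q, hq, e⟩ := hx
  exact ⟨_, hq.comp hg, fun i => e (g i)⟩

theorem const (r : ℚ) : RatFamily fun _ : α => (r : ℝ) := (ComputableRat.const r).ratFamily

theorem add (hx : RatFamily x) (hy : RatFamily y) : RatFamily fun i => x i + y i := by
  obtain ⟨q, hq, e⟩ := hx
  obtain ⟨r, hr, e'⟩ := hy
  exact ⟨_, hq.add hr, fun i => by simp only [e, e', Rat.cast_add]⟩

theorem sub (hx : RatFamily x) (hy : RatFamily y) : RatFamily fun i => x i - y i := by
  obtain ⟨q, hq, e⟩ := hx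
  obtain ⟨r, hr, e'⟩ := hy
  exact ⟨_, hq.sub hr, fun i => by simp only [e, e', Rat.cast_sub]⟩

theorem mul (hx : RatFamily x) (hy : RatFamily y) : RatFamily fun i => x i * y i := by
  obtain ⟨q, hq, e⟩ := hx
  obtain ⟨r, hr, e'⟩ := hy
  exact ⟨_, hq.mul hr, fun i => by simp only [e, e', Rat.cast_mul]⟩

theorem inv (hx : RatFamily x) : RatFamily fun i => (x i)⁻¹ := by
  obtain ⟨q, hq, e⟩ := hx
  exact ⟨_, hq.inv, fun i => by simp only [e, Rat.cast_inv]⟩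

theorem max (hx : RatFamily x) (hy : RatFamily y) : RatFamily fun i => max (x i) (y i) := by
  obtain ⟨q, hq, e⟩ := hx
  obtain ⟨r, hr, e'⟩ := hy
  exact ⟨_, hq.max hr, fun i => by simp only [e, e', Rat.cast_max]⟩

theorem min (hx : RatFamily x) (hy : RatFamily y) : RatFamily fun i => min (x i) (y i) := by
  obtain ⟨q, hq, e⟩ := hx
  obtain ⟨r, hr, e'⟩ := hy
  exact ⟨_, hq.min hr, fun i => by simp only [e, e', Rat.cast_min]⟩

theorem pow (r : ℚ) {k : α → ℕ} (hk : Computable k) : RatFamily fun i => (r : ℝ) ^ k i :=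
  ⟨_, ComputableRat.pow (q := r) hk, fun i => by rw [Rat.cast_pow]⟩

theorem ite {t : α → Bool} (ht : Computable t) (hx : RatFamily x) (hy : RatFamily y) :
    RatFamily fun i => if t i = true then x i else y i := by
  obtain ⟨q, hq, e⟩ := hx
  obtain ⟨r, hr, e'⟩ := hy
  exact ⟨_, ComputableRat.ite ht hq hr, fun i => by simp only [e, e']; split_ifs <;> rfl⟩

theorem sum {N : α → ℕ} (hN : Computable N) {z : α × ℕ → ℝ} (hz : RatFamily z) :
    RatFamily fun i => ∑ k ∈ Finset.range (N i), z (i, k) := by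
  obtain ⟨q, hq, e⟩ := hz
  exact ⟨_, ComputableRat.sum hN hq, fun i => by rw [Rat.cast_sum]; simp only [e]⟩

end RatFamily

end RatFamily

section Evaluation

variable {a b : ℕ → ℚ}

instance (n k : ℕ) : Decidable (IsRightEdge a b n k) := by unfold IsRightEdge; infer_instance

instance (n k : ℕ) : Decidable (IsLeftEdge a b n k) := by unfold IsLeftEdge; infer_instance

/-- A formula for the depth of rational points. -/
def ratDepth (a b : ℕ → ℚ) (n : ℕ) (x : ℚ) : ℚ :=
  if ∃ k < n + 1, a k ≤ x ∧ x ≤ b k then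
    minBelow (fun k => min (if IsRightEdge a b n k then |x - b k| else 1)
      (if IsLeftEdge a b n k then |x - a k| else 1)) (n + 1)
  else 0

/-- A formula for the target coordinates. -/
def ratTarget (a b : ℕ → ℚ) (n : ℕ) : ℚ :=
  if ∃ k < n + 1, a k ≤ 0 ∧ 0 ≤ b k then
    minBelow (fun k => if IsRightEdge a b n k then b k else 1) (n + 1)
  else 0

theorem mem_J_ratCast {k : ℕ} {x : ℚ} : (x : ℝ) ∈ J a b k ↔ a k ≤ x ∧ x ≤ b k := by
  simp [J]

namespace IsIntervalSystem

variable (h : IsIntervalSystem a b)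
include h

/-- The value `1` given to non-edges, and to the empty minimum, is harmless because no point of the
unit interval has depth above `1`. -/
theorem depth_ratCast {n : ℕ} {x : ℚ} (hx : (x : ℝ) ∈ Icc (0 : ℝ) 1) :
    depth a b n x = ratDepth a b n x := by
  rw [ratDepth]
  split_ifs with hc
  · obtain ⟨k₀, hk₀, hxk⟩ := hc
    obtain ⟨e, he, hd⟩ := h.exists_edge (Nat.le_of_lt_succ hk₀) (mem_J_ratCast.2 hxk)
    have hd' : depth a b n x = ((|x - e| : ℚ) : ℝ) := by rw [hd]; push_cast; rfl
    have hone : |x - e| ≤ 1 := by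
      have := h.depth_le_one n hx
      rw [hd'] at this
      exact_mod_cast this
    have hmin : ∀ e' ∈ edges a b n, |x - e| ≤ |x - e'| := fun e' he' => by
      have := h.depth_le_of_edge x he'
      rw [hd'] at this
      exact_mod_cast this
    rw [hd', Rat.cast_inj]
    apply le_antisymm
    · refine le_minBelow_iff.2 ⟨hone, fun k hk => le_min ?_ ?_⟩
      · split_ifs with hE
        · exact hmin _ ⟨k, Nat.le_of_lt_succ hk, Or.inl ⟨rfl, hE⟩⟩
        · exact hone
      · split_ifs with hE
        · exact hmin _ ⟨k, Nat.le_of_lt_succ hk, Or.inr ⟨rfl, hE⟩⟩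
        · exact hone
    · obtain ⟨k, hk, ⟨rfl, hE⟩ | ⟨rfl, hE⟩⟩ := he
      · refine ((le_minBelow_iff.1 le_rfl).2 k (Nat.lt_succ_of_le hk)).trans
          ((min_le_left _ _).trans ?_)
        rw [if_pos hE]
      · refine ((le_minBelow_iff.1 le_rfl).2 k (Nat.lt_succ_of_le hk)).trans
          ((min_le_right _ _).trans ?_)
        rw [if_pos hE]
  · rw [depth_eq_zero (subset_closure ⟨hx, fun k hk hxk =>
      hc ⟨k, Nat.lt_succ_of_le hk, mem_J_ratCast.1 hxk⟩⟩), Rat.cast_zero]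

/-- If `0` is covered, the first gap opens at the smallest right edge: every uncovered point has a
right edge before it, and every edge is a limit of uncovered points. -/
theorem targetCoord_eq_ratTarget (n : ℕ) : targetCoord a b n = ratTarget a b n := by
  rw [ratTarget]
  split_ifs with hc
  · obtain ⟨k₀, hk₀, h0⟩ := hc
    have h0J : (0 : ℝ) ∈ J a b k₀ := by exact_mod_cast mem_J_ratCast.2 h0
    apply le_antisymm
    · rcases minBelow_eq (fun k => if IsRightEdge a b n k then b k else 1) (n + 1) with
        e | ⟨k, hk, e⟩
      · rw [e]; exact_mod_cast (h.targetCoord_mem_Icc n).2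
      · rw [e]
        split_ifs with hE
        · have hcl := h.edge_mem_closure (n := n) (e := b k)
            ⟨k, Nat.le_of_lt_succ hk, Or.inl ⟨rfl, hE⟩⟩
          rw [targetCoord_eq]
          exact closure_minimal (fun z hz => csInf_le (bddBelow_uncovered n) hz) isClosed_Ici hcl
        · exact_mod_cast (h.targetCoord_mem_Icc n).2
    · rw [targetCoord_eq]
      refine le_csInf (h.uncovered_nonempty n) fun z hz => ?_
      have hz0 : 0 < z := lt_of_le_of_ne hz.1.1 fun e =>
        hz.2 k₀ (Nat.le_of_lt_succ hk₀) (e ▸ h0J)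
      obtain ⟨k, hk, hE, -, hlt⟩ := h.exists_isRightEdge (Nat.le_of_lt_succ hk₀) h0J hz hz0
      have := (le_minBelow_iff.1 (le_refl (minBelow
        (fun k => if IsRightEdge a b n k then b k else 1)
        (n + 1)))).2 k (Nat.lt_succ_of_le hk)
      rw [if_pos hE] at this
      exact le_trans (by exact_mod_cast this) hlt.le
  · have h0 : (0 : ℝ) ∈ uncovered a b n := ⟨⟨le_rfl, zero_le_one⟩, fun k hk h0k =>
      hc ⟨k, Nat.lt_succ_of_le hk, mem_J_ratCast.1 (by exact_mod_cast h0k)⟩⟩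
    rw [targetCoord_eq, Rat.cast_zero]
    exact le_antisymm (csInf_le (bddBelow_uncovered n) h0) (le_csInf ⟨0, h0⟩ fun z hz => hz.1.1)

/-! ### Effective evaluation at rational points -/

variable {α : Type} [Primcodable α]

theorem computable_isRightEdge {n k : α → ℕ} (hn : Computable n) (hk : Computable k) :
    Computable fun i => decide (IsRightEdge a b (n i) (k i)) := by
  have h1 : Computable fun i : α × ℕ => decide (a i.2 = b (k i.1)) :=
    (h.computable_left.comp Computable.snd).decide_eq
      (h.computable_right.comp (hk.comp Computable.fst))
  have h2 := Computable.decide_exists_lt (hn.nat_add' (Computable.const 1)) h1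
  refine (((h.computable_right.comp hk).decide_eq (ComputableRat.const 1)).bool_not.bool_and
    h2.bool_not).of_eq fun i => ?_
  rw [Bool.eq_iff_iff, decide_eq_true_iff]
  simp [IsRightEdge]

theorem computable_isLeftEdge {n k : α → ℕ} (hn : Computable n) (hk : Computable k) :
    Computable fun i => decide (IsLeftEdge a b (n i) (k i)) := by
  have h1 : Computable fun i : α × ℕ => decide (b i.2 = a (k i.1)) :=
    (h.computable_right.comp Computable.snd).decide_eq
      (h.computable_left.comp (hk.comp Computable.fst))
  have h2 := Computable.decide_exists_lt (hn.nat_add' (Computable.const 1)) h1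
  refine (((h.computable_left.comp hk).decide_eq (ComputableRat.const 0)).bool_not.bool_and
    h2.bool_not).of_eq fun i => ?_
  rw [Bool.eq_iff_iff, decide_eq_true_iff]
  simp [IsLeftEdge]

theorem computable_covered {n : α → ℕ} {x : α → ℚ} (hn : Computable n) (hx : ComputableRat x) :
    Computable fun i => decide (∃ k < n i + 1, a k ≤ x i ∧ x i ≤ b k) := by
  have h1 : Computable fun i : α × ℕ => decide (a i.2 ≤ x i.1) && decide (x i.1 ≤ b i.2) :=
    ((h.computable_left.comp Computable.snd).decide_le (hx.comp Computable.fst)).bool_and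
      ((hx.comp Computable.fst).decide_le (h.computable_right.comp Computable.snd))
  exact (Computable.decide_exists_lt (hn.nat_add' (Computable.const 1)) h1).of_eq fun i => by simp

theorem computableRat_ratDepth {n : α → ℕ} {x : α → ℚ} (hn : Computable n) (hx : ComputableRat x) :
    ComputableRat fun i => ratDepth a b (n i) (x i) := by
  have hn' : Computable fun i : α × ℕ => n i.1 := hn.comp Computable.fst
  have hx' : ComputableRat fun i : α × ℕ => x i.1 := hx.comp Computable.fst
  have h1 : ComputableRat fun i : α × ℕ =>
      min (if IsRightEdge a b (n i.1) i.2 then |x i.1 - b i.2| else 1)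
        (if IsLeftEdge a b (n i.1) i.2 then |x i.1 - a i.2| else 1) :=
    ((ComputableRat.ite (h.computable_isRightEdge hn' Computable.snd)
      (hx'.sub (h.computable_right.comp Computable.snd)).abs (ComputableRat.const 1)).min
      (ComputableRat.ite (h.computable_isLeftEdge hn' Computable.snd)
        (hx'.sub (h.computable_left.comp Computable.snd)).abs (ComputableRat.const 1))).of_eq
      fun i => by simp only [decide_eq_true_eq]
  exact (ComputableRat.ite (h.computable_covered hn hx)
    (ComputableRat.minBelow (hn.nat_add' (Computable.const 1)) h1) (ComputableRat.const 0)).of_eq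
      fun i => by simp only [decide_eq_true_eq, ratDepth]

theorem computableRat_ratTarget : ComputableRat (ratTarget a b) := by
  have h1 : ComputableRat fun i : ℕ × ℕ => if IsRightEdge a b i.1 i.2 then b i.2 else 1 :=
    (ComputableRat.ite (h.computable_isRightEdge Computable.fst Computable.snd)
      (h.computable_right.comp Computable.snd) (ComputableRat.const 1)).of_eq
      fun i => by simp only [decide_eq_true_eq]
  exact (ComputableRat.ite (h.computable_covered Computable.id (ComputableRat.const 0))
    (ComputableRat.minBelow (Computable.id.nat_add' (Computable.const 1)) h1)
      (ComputableRat.const 0)).of_eq fun i => by simp only [decide_eq_true_eq, ratTarget, id]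

theorem ratFamily_targetCoord : RatFamily (targetCoord a b) :=
  ⟨_, h.computableRat_ratTarget, h.targetCoord_eq_ratTarget⟩

theorem ratFamily_depth {n : α → ℕ} {x : α → ℝ} (hn : Computable n) (hx : RatFamily x)
    (hI : ∀ i, x i ∈ Icc (0 : ℝ) 1) : RatFamily fun i => depth a b (n i) (x i) := by
  obtain ⟨q, hq, e⟩ := hx
  refine ⟨_, h.computableRat_ratDepth hn hq, fun i => ?_⟩
  have := hI i
  simp only [e] at this ⊢
  exact h.depth_ratCast this

variable {P : α → Square} {n : α → ℕ}

theorem ratFamily_scaledDepth (hP : ∀ i, RatFamily fun k => (P k).1 i) (hn : Computable n) :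
    RatFamily fun k => scaledDepth a b (n k) (P k) :=
  RatFamily.mul (by simpa using RatFamily.pow 2 hn)
    ((h.ratFamily_depth hn (hP 0) fun k => (P k).2 0).min
    (h.ratFamily_depth hn (hP 1) fun k => (P k).2 1))

theorem ratFamily_ramp (hP : ∀ i, RatFamily fun k => (P k).1 i) (hn : Computable n) (c : ℕ) :
    RatFamily fun k => ramp a b c (n k) (P k) := by
  have h0 : RatFamily fun _ : α => (0 : ℝ) := by simpa using RatFamily.const (α := α) 0
  have h1 : RatFamily fun _ : α => (1 : ℝ) := by simpa using RatFamily.const (α := α) 1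
  have h8 : RatFamily fun _ : α => (8 : ℝ) := by simpa using RatFamily.const (α := α) 8
  have hc : RatFamily fun _ : α => (c : ℝ) := by simpa using RatFamily.const (α := α) c
  exact h0.max (h1.min (hc.sub (h8.mul (h.ratFamily_scaledDepth hP hn))))

theorem ratFamily_aim (hP : ∀ i, RatFamily fun k => (P k).1 i) (hn : Computable n) (i : Fin 2) :
    RatFamily fun k => aim a b (n k) (P k) i := by
  have hr : RatFamily fun k : α × ℕ => ramp a b (11 + (i : ℕ)) k.2 (P k.1) := by
    simpa using h.ratFamily_ramp (P := fun k : α × ℕ => P k.1)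
      (fun i => (hP i).comp Computable.fst) Computable.snd (11 + (i : ℕ))
  exact (h.ratFamily_targetCoord.comp (Computable.const 0)).add (RatFamily.sum hn
    (((h.ratFamily_targetCoord.comp (Computable.succ.comp Computable.snd)).sub
      (h.ratFamily_targetCoord.comp Computable.snd)).mul hr))

theorem ratFamily_cutoff (hP : ∀ i, RatFamily fun k => (P k).1 i) (hn : Computable n) :
    RatFamily fun k => cutoff a b (n k) (P k) := by
  have h1 : RatFamily fun _ : α => (1 : ℝ) := by simpa using RatFamily.const (α := α) 1
  have h2 := h.ratFamily_ramp hP (Computable.pred.comp hn) 12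
  obtain ⟨q, hq, e⟩ := RatFamily.ite (hn.decide_nat_eq (Computable.const 0)) h1 h2
  refine ⟨q, hq, fun k => ?_⟩
  rw [← e]
  rcases Nat.eq_zero_or_eq_succ_pred (n k) with hk | hk
  · simp [hk, cutoff]
  · simp only
    rw [hk]
    simp [cutoff]

theorem ratFamily_push (hP : ∀ i, RatFamily fun k => (P k).1 i) (hn : Computable n)
    {r : α → ℕ → ℝ} (hr : RatFamily fun k : α × ℕ => r k.1 k.2) :
    RatFamily fun k => push a b (n k) (P k) (r k) := by
  have hP' : ∀ i, RatFamily fun k : α × ℕ => (P k.1).1 i := fun i => (hP i).comp Computable.fst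
  have h0 : RatFamily fun _ : α × ℕ => (0 : ℝ) := by simpa using RatFamily.const (α := α × ℕ) 0
  have h1 : RatFamily fun _ : α × ℕ => (1 : ℝ) := by simpa using RatFamily.const (α := α × ℕ) 1
  have h16 : RatFamily fun _ : α × ℕ => (16 : ℝ) := by simpa using RatFamily.const (α := α × ℕ) 16
  have h2 : RatFamily fun k : α × ℕ => (2 : ℝ) ^ k.2 := by
    simpa using RatFamily.pow (α := α × ℕ) 2 Computable.snd
  have h4 : RatFamily fun k : α × ℕ => (1 / 4 : ℝ) ^ k.2 := by
    simpa using RatFamily.pow (α := α × ℕ) (1 / 4) Computable.snd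
  exact RatFamily.sum (hn.nat_add' (Computable.const 1)) ((h4.mul h16.inv).mul
    (((h.ratFamily_cutoff hP' Computable.snd).mul
      (h0.max ((h.ratFamily_scaledDepth hP' Computable.snd).sub h1))).mul
      (h1.max (h2.mul hr)).inv))

omit h in
theorem targetDist_eq_sqrt (p : Square) (m : ℕ) : targetDist a b p m =
    Real.sqrt ((targetCoord a b m - p.1 0) * (targetCoord a b m - p.1 0) +
      (targetCoord a b m - p.1 1) * (targetCoord a b m - p.1 1)) := by
  rw [targetDist, EuclideanSpace.norm_eq, Fin.sum_univ_two]
  rw [Real.norm_eq_abs, Real.norm_eq_abs, sq_abs, sq_abs, sq, sq]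
  rfl

/-- The distance to a target is the only irrational ingredient of a stage map at a rational point,
as the root of a computable rational. -/
theorem exists_ratFamily_targetDist (hP : ∀ i, RatFamily fun k => (P k).1 i) {K : α → ℕ}
    (hK : Computable K) : ∃ r : α → ℕ → ℝ, (RatFamily fun k : α × ℕ => r k.1 k.2) ∧
      ∀ k m, |r k m - targetDist a b (P k) m| ≤ (1 / 2) ^ K k := by
  have hd : ∀ i, RatFamily fun k : α × ℕ => targetCoord a b k.2 - (P k.1).1 i := fun i =>
    (h.ratFamily_targetCoord.comp Computable.snd).sub ((hP i).comp Computable.fst)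
  obtain ⟨S, hS, e⟩ := ((hd 0).mul (hd 0)).add ((hd 1).mul (hd 1))
  have hS0 : ∀ k, 0 ≤ S k := fun k => by
    have : (0 : ℝ) ≤ S k := by
      rw [← e]; exact add_nonneg (mul_self_nonneg _) (mul_self_nonneg _)
    exact_mod_cast this
  refine ⟨fun k m => ratSqrt (S (k, m)) (K k),
    (hS.ratSqrt hS0 (hK.comp Computable.fst)).ratFamily, fun k m => ?_⟩
  rw [targetDist_eq_sqrt]
  have e' := e (k, m)
  simp only at e'
  rw [e']
  exact abs_ratSqrt_sub_le (hS0 (k, m)) _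

theorem abs_pushTerm_sub_le (m : ℕ) (p : Square) (r s : ℝ) :
    |pushTerm a b m p r - pushTerm a b m p s| ≤ |r - s| := by
  have hpos : (0 : ℝ) < 2 ^ m := by positivity
  have hinv : |(max 1 (2 ^ m * r))⁻¹ - (max 1 (2 ^ m * s))⁻¹| ≤ 2 ^ m * |r - s| := by
    have h1 : (1 : ℝ) ≤ max 1 (2 ^ m * r) := le_max_left _ _
    have h2 : (1 : ℝ) ≤ max 1 (2 ^ m * s) := le_max_left _ _
    rw [inv_sub_inv (by linarith) (by linarith), abs_div, abs_sub_comm]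
    refine (div_le_self (abs_nonneg _) ((le_abs_self _).trans'
      (one_le_mul_of_one_le_of_one_le h1 h2))).trans ?_
    refine (abs_max_sub_max_le_max _ _ _ _).trans ?_
    rw [sub_self, abs_zero, max_eq_right (abs_nonneg _), ← mul_sub, abs_mul, abs_of_pos hpos]
  have hc : cutoff a b m p * max 0 (scaledDepth a b m p - 1) ≤ 1 * 2 ^ m :=
    mul_le_mul (cutoff_le_one m p) (max_le (by positivity) (by linarith [h.scaledDepth_le m p]))
      (le_max_left _ _) zero_le_one
  have hc0 : 0 ≤ cutoff a b m p * max 0 (scaledDepth a b m p - 1) :=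
    mul_nonneg (cutoff_nonneg m p) (le_max_left _ _)
  have e4 : (1 / 4 : ℝ) ^ m = (2 ^ m * 2 ^ m)⁻¹ := by rw [← mul_pow, ← inv_pow]; norm_num
  rw [pushTerm, pushTerm, ← mul_sub, ← mul_sub, abs_mul, abs_mul, abs_of_nonneg hc0,
    abs_of_nonneg (by positivity)]
  refine (mul_le_mul_of_nonneg_left (mul_le_mul hc hinv (abs_nonneg _) (by positivity))
    (by positivity)).trans ?_
  have e5 : (1 / 4 : ℝ) ^ m / 16 * (1 * 2 ^ m * (2 ^ m * |r - s|)) = |r - s| / 16 := by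
    rw [e4]; field_simp
  rw [e5]
  linarith [abs_nonneg (r - s)]

theorem abs_push_sub_le (n : ℕ) (p : Square) (r s : ℕ → ℝ) {ε : ℝ} (hr : ∀ m, |r m - s m| ≤ ε) :
    |push a b n p r - push a b n p s| ≤ 2 ^ n * ε := by
  have hε : 0 ≤ ε := (abs_nonneg _).trans (hr 0)
  rw [push, push, ← Finset.sum_sub_distrib]
  refine (Finset.abs_sum_le_sum_abs _ _).trans ((Finset.sum_le_sum fun m _ =>
    (h.abs_pushTerm_sub_le m p (r m) (s m)).trans (hr m)).trans ?_)
  rw [Finset.sum_const, Finset.card_range, nsmul_eq_mul]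
  refine mul_le_mul_of_nonneg_right ?_ hε
  exact_mod_cast Nat.succ_le_of_lt Nat.lt_two_pow_self

/-- A map that is approximated effectively by the stage maps is computable. -/
theorem polishComputable_of_dist_stage_le {g : Square → Square} {N : ℕ → ℕ} (hN : Computable N)
    (hg : ∀ k p, dist (h.stage (N k) p) (g p) ≤ (1 / 2) ^ (k + 2)) : PolishComputable g where
  modulus := by
    -- The summand `N k + 5` cancels the Lipschitz constant, leaving `2⁻⁽ᵏ⁺¹⁾`; the two replacements
    -- of `g` by a stage map cost `2⁻⁽ᵏ⁺²⁾` each.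
    refine ⟨fun k => N k + 5 + (k + 1), (hN.nat_add' (Computable.const 5)).nat_add' Computable.succ,
      fun k p q hpq => ?_⟩
    have h1 := hg k p
    have h2 := hg k q
    rw [dist_comm] at h1
    have h3 := (h.dist_stage_le (N k) p q).trans (mul_le_mul_of_nonneg_left hpq (by positivity))
    rw [pow_add (1 / 2 : ℝ), ← mul_assoc, ← mul_pow, mul_one_div_cancel two_ne_zero, one_pow,
      one_mul, pow_succ] at h3
    have h4 := dist_triangle4 (g p) (h.stage (N k) p) (h.stage (N k) q) (g q)
    rw [pow_add] at h1 h2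
    linarith
  map_seq := by
    intro p hp
    choose q hq happ using hp
    -- With this precision the square roots cost `1/1024` and the rational approximation of the
    -- point `32/1024` of the allowed error; a quarter is spent on replacing `g` by the stage map.
    have hK : Computable fun i : ℕ × ℕ => N i.2 + i.2 + 10 :=
      ((hN.comp Computable.snd).nat_add' Computable.snd).nat_add' (Computable.const 10)
    -- Truncation to `[0, 1]` makes the approximation a point of the square and does not increase
    -- its error.
    let x : Fin 2 → ℕ × ℕ → ℚ := fun i k => max 0 (min 1 (q i (k.1, N k.2 + k.2 + 10)))
    have hx : ∀ i, ComputableRat (x i) := fun i => (ComputableRat.const 0).max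
      ((ComputableRat.const 1).min ((hq i).comp (Computable.fst.pair hK)))
    have hxI : ∀ k i, (x i k : ℝ) ∈ Icc (0 : ℝ) 1 := fun k i =>
      ⟨by exact_mod_cast le_max_left _ _, by exact_mod_cast max_le zero_le_one (min_le_left _ _)⟩
    let P : ℕ × ℕ → Square := fun k => Square.ofFun (fun i => x i k) (hxI k)
    have hP : ∀ i, RatFamily fun k => (P k).1 i := fun i => (hx i).ratFamily
    have hclose : ∀ k i, |(P k).1 i - (p k.1).1 i| ≤ (1 / 2) ^ (N k.2 + k.2 + 10) := fun k i => by
      refine le_trans ?_ (happ i k.1 (N k.2 + k.2 + 10))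
      have e1 : (P k).1 i = max 0 (min 1 (q i (k.1, N k.2 + k.2 + 10) : ℝ)) := by
        change ((x i k : ℚ) : ℝ) = _
        push_cast [x]
        rfl
      have e2 : (p k.1).1 i = max 0 (min 1 ((p k.1).1 i)) := by
        rw [min_eq_right ((p k.1).2 i).2, max_eq_right ((p k.1).2 i).1]
      rw [e1]
      conv_lhs => rw [e2]
      refine (abs_max_sub_max_le_max _ _ _ _).trans ?_
      rw [sub_self, abs_zero, max_eq_right (abs_nonneg _)]
      refine (abs_min_sub_min_le_max _ _ _ _).trans ?_
      rw [sub_self, abs_zero, max_eq_right (abs_nonneg _)]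
    obtain ⟨r, hr, hr'⟩ := h.exists_ratFamily_targetDist hP hK
    intro i
    have hNk : Computable fun k : ℕ × ℕ => N k.2 := hN.comp Computable.snd
    obtain ⟨y, hy, e⟩ := (hP i).add ((h.ratFamily_push hP hNk hr).mul
      ((h.ratFamily_aim hP hNk i).sub (hP i)))
    refine ⟨y, hy, fun k j => ?_⟩
    rw [← e]
    set n := N j
    set ε : ℝ := (1 / 2) ^ (n + j + 10) with hε
    have h1 : |(P (k, j)).1 i + push a b n (P (k, j)) (r (k, j)) *
        (aim a b n (P (k, j)) i - (P (k, j)).1 i) - (h.stage n (P (k, j))).1 i| ≤ 2 ^ n * ε := by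
      rw [stage_apply, add_sub_add_left_eq_sub, ← sub_mul, abs_mul]
      refine (mul_le_of_le_one_right (abs_nonneg _) (abs_le.2 ?_)).trans
        (h.abs_push_sub_le n _ _ _ (hr' (k, j)))
      have h1 := h.aim_mem_Icc n (P (k, j)) i
      have h2 := (P (k, j)).2 i
      constructor <;> linarith [h1.1, h1.2, h2.1, h2.2]
    have h2 : |(h.stage n (P (k, j))).1 i - (h.stage n (p k)).1 i| ≤ 32 * (2 ^ n * ε) := by
      refine (h.isLip_stage n i _ _).trans ?_
      have := (Square.dist_le (P (k, j)) (p k)).trans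
        (add_le_add (hclose (k, j) 0) (hclose (k, j) 1))
      refine (mul_le_mul_of_nonneg_left this (by positivity)).trans (le_of_eq ?_)
      change 16 * 2 ^ n * (ε + ε) = _
      ring
    have h3 : |(h.stage n (p k)).1 i - (g (p k)).1 i| ≤ (1 / 2) ^ (j + 2) :=
      (Square.abs_sub_le_dist _ _ i).trans (hg j (p k))
    have e1 : 2 ^ n * ε = (1 / 2) ^ j / 1024 := by
      rw [hε, add_assoc, pow_add, ← mul_assoc, ← mul_pow, mul_one_div_cancel two_ne_zero, one_pow,
        one_mul, pow_add]
      norm_num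
      ring
    have h0 : (0 : ℝ) < (1 / 2) ^ j := by positivity
    rw [e1] at h1 h2
    rw [pow_add] at h3
    rw [abs_le] at h1 h2 h3 ⊢
    constructor <;> linarith [h1.1, h1.2, h2.1, h2.2, h3.1, h3.2]

theorem polishComputable_stage (n : ℕ) : PolishComputable (h.stage n) :=
  h.polishComputable_of_dist_stage_le (N := fun _ => n) (Computable.const n) fun k p => by
    rw [dist_self]; positivity

theorem polishComputable_limitMap : PolishComputable h.limitMap :=
  h.polishComputable_of_dist_stage_le (N := fun k => k + 2)
    (Computable.id.nat_add' (Computable.const 2)) fun k p => h.dist_stage_limitMap_le (k + 2) p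

/-! ### Fixed points -/

theorem isStageSequence_stage : IsStageSequence a b h.stage where
  computable := h.polishComputable_stage
  moves n p hp := by
    refine h.stage_ne_self ?_
    have h1 := h.lt_rectDepth_of_mem_interior_core (by positivity) hp
    by_contra hle
    rw [not_lt, scaledDepth, ← le_div_iff₀' (by positivity), ← one_div_pow] at hle
    exact absurd h1 (not_lt.2 hle)
  identity n p hp := by
    refine h.stage_eq_self ?_
    by_contra hlt
    exact hp ((h.mem_core_iff (by positivity)).2 (one_le_scaledDepth_iff.2 (not_le.1 hlt).le))
  push n := ⟨(1 / 4) ^ n / 16, by positivity, fun p hp => h.stage_sub_of_mem_collar hp⟩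
  agree n p hp := h.stage_eq_of_le n.le_succ
    (le_rectDepth_iff.1 ((h.mem_core_iff (by positivity)).1 hp))

theorem limitMap_eq_self_of_coord {p : Square} {i : Fin 2} (hp : p.1 i ∉ ⋃ n, J a b n) :
    h.limitMap p = p :=
  h.limitMap_eq_self_iff.2 fun hC => hp (mem_iUnion_C_iff.1 hC i)

/-- The union of the `C_n` is a product of two copies of the covered set, so a single uncovered
coordinate already makes the whole line fixed. -/
theorem exists_coord_of_limitMap_eq_self {p : Square} (hp : h.limitMap p = p) :
    ∃ i, ∀ q : Square, q.1 i = p.1 i → h.limitMap q = q := by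
  rw [h.limitMap_eq_self_iff, mem_iUnion_C_iff] at hp
  push Not at hp
  obtain ⟨i, hi⟩ := hp
  exact ⟨i, fun q hq => h.limitMap_eq_self_of_coord (i := i) (hq ▸ hi)⟩

/-- Other fixed points are found arbitrarily near by moving along the fixed line through `p`. -/
theorem accPt_fixedPoints_limitMap {p : Square} (hp : h.limitMap p = p) :
    AccPt p (𝓟 (Function.fixedPoints h.limitMap)) := by
  obtain ⟨i, hi⟩ := h.exists_coord_of_limitMap_eq_self hp
  rw [accPt_iff_nhds]
  intro u hu
  obtain ⟨δ, hδ, hball⟩ := Metric.mem_nhds_iff.1 hu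
  have hacc : AccPt (p.1 i.rev) (𝓟 (Icc (0 : ℝ) 1)) := by
    exact isPreconnected_Icc.preperfect_of_nontrivial ⟨0, by simp, 1, by simp, zero_ne_one⟩ _
      (p.2 i.rev)
  obtain ⟨y, ⟨hy, hyI⟩, hne⟩ := accPt_iff_nhds.1 hacc _ (Metric.ball_mem_nhds _ hδ)
  refine ⟨Square.cons i (p.2 i) hyI, ⟨hball ?_, hi _ (Square.cons_self _ _)⟩, fun e => hne ?_⟩
  · rw [Metric.mem_ball, dist_comm]
    refine (Square.dist_cons_le _ _ p).trans_lt ?_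
    rw [sub_self, abs_zero, zero_add, abs_sub_comm]
    exact hy
  · rw [← e, Square.cons_rev]

theorem computablePoint_limitMap_ne {p : Square} (hp : ComputablePoint p) : h.limitMap p ≠ p :=
  fun hfix => h.limitMap_eq_self_iff.1 hfix
    (mem_iUnion_C_iff.2 fun i => h.covers.subset ⟨p.2 i, hp i⟩)

end IsIntervalSystem

end Evaluation

theorem mainTheorem1 :
    ∃ (a b : ℕ → ℚ) (F : ℕ → Square → Square) (f : Square → Square),
      IsIntervalSystem a b ∧
      IsStageSequence a b F ∧
      TendstoUniformly F f atTop ∧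
      PolishComputable f ∧
      (∀ p : Square, ComputablePoint p → f p ≠ p) ∧
      Function.fixedPoints f = (⋃ n, C a b n)ᶜ ∧
      (∀ p : Square, f p = p →
        (∀ q : Square, q.1 0 = p.1 0 → f q = q) ∨ (∀ q : Square, q.1 1 = p.1 1 → f q = q)) ∧
      (∀ p : Square, f p = p → AccPt p (𝓟 (Function.fixedPoints f))) ∧
      ∃ v : Icc (0 : ℝ) 1,
        Tendsto (targetCoord a b) atTop (𝓝 (v : ℝ)) ∧
        ¬ ComputableReal v ∧
        f (diag v) = diag v := by
  have h := isIntervalSystem_tree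
  obtain ⟨v, hvI, hv, hvU⟩ := h.exists_tendsto_targetCoord
  refine ⟨treeLeft, treeRight, h.stage, h.limitMap, h, h.isStageSequence_stage,
    h.tendstoUniformly_stage, h.polishComputable_limitMap,
    fun p hp => h.computablePoint_limitMap_ne hp, ext fun p => h.limitMap_eq_self_iff,
    fun p hp => Fin.exists_fin_two.1 (h.exists_coord_of_limitMap_eq_self hp),
    fun p hp => h.accPt_fixedPoints_limitMap hp, ⟨v, hvI⟩, hv,
    fun hc => hvU (h.covers.subset ⟨hvI, hc⟩), h.limitMap_eq_self_of_coord (i := 0) hvU⟩
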